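/- **Conventions.** Digraphs are finite, without loops; parallel and opposite arcs are allowed. A weighted digraph is a pair $(D,w)$ with $D=(V,A)$ a digraph and $w\in\mathbb{Z}_{\ge 0}^A$; write $w(F)=\sum_{a\in F}w_a$. A dicut is a set $\delta^+(U)$ with $\emptyset\ne U\subsetneq V$ and $\delta^-(U)=\emptyset$. A dijoin is a set of arcs that meets every dicut. A $w$-weighted packing of dijoins of size $\nu$ is a collection $J_1,\dots,J_\nu$ of (not necessarily distinct) dijoins such that every arc $a$ lies in at most $w_a$ of them. For $w\in\{0,1\}^A$ it is equitable if $|J_i\cap B|-|J_j\cap B|\in\{-1,0,1\}$ for all $i,j$ and every inclusionwise minimal dicut $B$. For general $w$, an equitable $w$-weighted packing is an equitable packing in the weighted digraph with weights in $\{0,1\}$ obtained from $(D,w)$ by replacing each arc $a$ with $w_a\ge1$ by $w_a$ parallel arcs of weight $1$; that is, its members are pairwise disjoint sets of copies of arcs, and all copies are counted. For an integer $\tau\ge 2$ let $$\rho(\tau,D,w)=\frac1\tau\sum_{v\in V}\Big(\big(w(\delta^+(v))-w(\delta^-(v))\big)\bmod \tau\Big),$$ with residues taken in $\{0,\dots,\tau-1\}$.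 A weighted $(\tau,\tau+1)$-bipartite digraph is a weighted digraph in which every vertex is a source or a sink, every vertex has weighted degree $\tau$ or $\tau+1$, no arc joins two vertices of weighted degree $\tau+1$, and every dicut has weight at least $\tau$. It is sink-regular if every sink has weighted degree $\tau$, and balanced if it has as many sources as sinks. A clutter over a finite ground set is a family of subsets none of which contains another. Contracting a set $X$ of elements in a clutter $\mathcal C$ gives the clutter, over the remaining elements, of the minimal sets among $\{C\setminus X: C\in\mathcal C\}$; the result is a contraction minor of $\mathcal C$. The product $\prod_{i\in I}\mathcal C_i$ of clutters over disjoint ground sets is the clutter, over the union of the ground sets, of the minimal sets among the unions $\bigcup_{i\in I} C_i$ with $C_i\in\mathcal C_i$. For a weighted digraph $(D,w)$, let $\mathcal C(D,w)$ be the clutter obtained from the clutter of minimal dijoins of $D$ by deleting each arc $a$ with $w_a=0$ (that is, keeping only the members that avoid $a$) and replicating each arc $a$ with $w_a\ge1$ exactly $w_a-1$ times (so that $a$ is replaced by $w_a$ copies, and a member uses one copy of each of its arcs). **Theorem.** Let $\tau\ge2$ be an integer. *(Decompose-and-Lift)* Let $(D,w)$ be a weighted digraph in which every dicut has weight at least $\tau$.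 Then there are a finite index set $I$ and weighted $(\tau,\tau+1)$-bipartite digraphs $(D'_i,w'_i)$, $i\in I$, such that 1. if $w>\mathbf 0$ (that is, $w_a>0$ for every arc $a$) and $\tau\ge3$, then $w'_i>\mathbf 0$ for each $i\in I$; 2. if $D$ is planar, then so is each $D'_i$; 3. up to a bijection of ground sets, $\mathcal C(D,w)=\prod_{i\in I}\mathcal C_i$, where each $\mathcal C_i$ is a contraction minor of $\mathcal C(D'_i,w'_i)$. Moreover, the $(D'_i,w'_i)$ can be chosen such that 1–3 hold and all of them are balanced; they can also be chosen such that 1–3 hold and all of them are sink-regular with $\rho(\tau,D'_i,w'_i)\le\rho(\tau,D,w)$. *(Reducing)* For an integer $\rho\ge0$, let $[\mathrm{wt},\tau,\rho;\mathrm{pl},\mathrm{eqt}]$ be the statement: every weighted digraph $(D,w)$ such that $D$ is planar, every dicut has weight at least $\tau$, and $\rho(\tau,D,w)\le\rho$ has an equitable $w$-weighted packing of dijoins of size $\tau$. If $\mathrm{pl}$ is omitted, planarity is not required; if $\mathrm{eqt}$ is omitted, the packing need not be equitable; if $\rho$ is omitted, the condition $\rho(\tau,D,w)\le\rho$ is dropped.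 1. Each statement $[\mathrm{wt},\tau;\dots]$ without $\rho$, with or without $\mathrm{pl}$ and with or without $\mathrm{eqt}$, is true if and only if it is true for all balanced weighted $(\tau,\tau+1)$-bipartite digraphs. 2. For every integer $\rho\ge0$, each statement $[\mathrm{wt},\tau,\rho;\dots]$, with or without $\mathrm{pl}$ and with or without $\mathrm{eqt}$, is true if and only if it is true for all sink-regular weighted $(\tau,\tau+1)$-bipartite digraphs. -/

import Mathlib

universe u

/-- A finite loopless directed multigraph with vertex set `V` and arc set `A`; parallel and opposite
arcs are allowed. -/
structure DiMultigraph : Type (u + 1) where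
  V : Type u
  A : Type u
  [fintypeV : Fintype V]
  [fintypeA : Fintype A]
  tail : A → V
  head : A → V
  tail_ne_head : ∀ a, tail a ≠ head a

attribute [instance] DiMultigraph.fintypeV DiMultigraph.fintypeA

noncomputable section

open scoped Classical

namespace DiMultigraph

variable (D : DiMultigraph.{u})

/-- The set of arcs leaving `U`. -/
def outArcs (U : Finset D.V) : Finset D.A :=
  Finset.univ.filter fun a => D.tail a ∈ U ∧ D.head a ∉ U

/-- The set of arcs entering `U`. -/
def inArcs (U : Finset D.V) : Finset D.A :=
  Finset.univ.filter fun a => D.tail a ∉ U ∧ D.head a ∈ U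

/-- A dicut: the set of arcs leaving a nonempty proper vertex set that no arc enters. -/
def IsDicut (B : Finset D.A) : Prop :=
  ∃ U : Finset D.V, U.Nonempty ∧ U ≠ Finset.univ ∧ D.inArcs U = ∅ ∧ B = D.outArcs U

/-- An inclusionwise minimal dicut. -/
def IsMinimalDicut (B : Finset D.A) : Prop := Minimal D.IsDicut B

/-- A dijoin: a set of arcs that meets every dicut. -/
def IsDijoin (J : Finset D.A) : Prop :=
  ∀ B, D.IsDicut B → (J ∩ B).Nonempty

/-- A vertex that no arc enters. -/
def IsSource (v : D.V) : Prop := ∀ a, D.head a ≠ v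

/-- A vertex that no arc leaves. -/
def IsSink (v : D.V) : Prop := ∀ a, D.tail a ≠ v

/-- Every vertex is a source or a sink. -/
def IsBipartite : Prop := ∀ v, D.IsSource v ∨ D.IsSink v

/-! ### Planarity -/

/-- The two ends of the arcs: `(a, false)` is the end of `a` at its tail, and `(a, true)` the end
of `a` at its head. -/
abbrev Dart : Type u := D.A × Bool

/-- The vertex at which a dart is attached. -/
def dartVertex (x : D.Dart) : D.V := if x.2 then D.head x.1 else D.tail x.1

/-- The involution exchanging the two ends of each arc. -/
def dartFlip : Equiv.Perm D.Dart := (Equiv.refl D.A).prodCongr Equiv.boolNot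

/-- The number of orbits of the group generated by a set of permutations. -/
def numOrbits {X : Type u} (S : Set (Equiv.Perm X)) : ℕ :=
  Nat.card (MulAction.orbitRel.Quotient (Subgroup.closure S) X)

/-- The underlying undirected graph has an embedding in the plane, described combinatorially.
An embedding in a closed oriented surface (one sphere with handles for each connected component)
is a rotation system `σ`, which permutes the darts at each vertex cyclically in the order in which
they leave that vertex; its faces are the orbits of `σ * D.dartFlip`. All the surfaces are spheres
if and only if (non-isolated vertices) - (arcs) + (faces) is twice the number of connected
components with at least one arc. Isolated vertices do not affect planarity. -/
def IsPlanar : Prop :=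
  ∃ σ : Equiv.Perm D.Dart,
    (∀ x y, σ.SameCycle x y ↔ D.dartVertex x = D.dartVertex y) ∧
    numOrbits {σ} + numOrbits {σ * D.dartFlip} =
      Fintype.card D.A + 2 * numOrbits {σ, D.dartFlip}

/-! ### Weights -/

variable {D}

/-- The weight of a set of arcs. -/
def weight (w : D.A → ℕ) (F : Finset D.A) : ℕ := ∑ a ∈ F, w a

/-- Every dicut has weight at least `τ`. -/
def DicutsAtLeast (w : D.A → ℕ) (τ : ℕ) : Prop :=
  ∀ B, D.IsDicut B → τ ≤ weight w B

/-- The weighted degree of a vertex. -/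
def wdeg (w : D.A → ℕ) (v : D.V) : ℕ :=
  weight w (D.outArcs {v}) + weight w (D.inArcs {v})

/-- The parameter `ρ(τ, D, w)`, the sum over the vertices `v` of the residues modulo `τ` in
`{0, …, τ - 1}` of `w(δ⁺(v)) - w(δ⁻(v))`, divided by `τ`. -/
def rho (τ : ℕ) (w : D.A → ℕ) : ℚ :=
  (1 / (τ : ℚ)) *
    ∑ v : D.V,
      ((((weight w (D.outArcs {v}) : ℤ) - (weight w (D.inArcs {v}) : ℤ)) % (τ : ℤ) : ℤ) : ℚ)

/-- Weighted `(τ, τ + 1)`-bipartite digraphs. -/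
structure IsTauBipartite (τ : ℕ) (w : D.A → ℕ) : Prop where
  bipartite : D.IsBipartite
  wdeg_eq : ∀ v, wdeg w v = τ ∨ wdeg w v = τ + 1
  stable : ∀ a, ¬ (wdeg w (D.tail a) = τ + 1 ∧ wdeg w (D.head a) = τ + 1)
  dicuts : DicutsAtLeast w τ

/-- Every sink has weighted degree `τ`. -/
def IsSinkRegular (τ : ℕ) (w : D.A → ℕ) : Prop :=
  ∀ v, D.IsSink v → wdeg w v = τ

variable (D) in
/-- The numbers of sources and of sinks are equal. -/
def IsBalanced : Prop :=
  (Finset.univ.filter fun v => D.IsSource v).card = (Finset.univ.filter fun v => D.IsSink v).card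

/-- The (not necessarily distinct) sets `J i` form a `w`-weighted packing of dijoins of size `ν`. -/
def IsWeightedPacking (w : D.A → ℕ) {ν : ℕ} (J : Fin ν → Finset D.A) : Prop :=
  (∀ i, D.IsDijoin (J i)) ∧ ∀ a, (Finset.univ.filter fun i => a ∈ J i).card ≤ w a

variable (D) in
/-- The copies of the arcs of `D`, with `w a` copies of each arc `a`. -/
abbrev Copies (w : D.A → ℕ) : Type u := Σ a : D.A, Fin (w a)

/-- An equitable `w`-weighted packing of dijoins of size `ν`, where parallel copies are told apart:
after each arc `a` of nonzero weight has been replaced by `w a` parallel arcs of weight `1`, the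
`J i` are pairwise disjoint sets of arcs of weight `1`, each of them is a dijoin, and on each minimal
dicut the numbers of elements of any two of them differ by at most one. (A set of copies meets every
dicut if and only if the set of the underlying arcs of `D` does, and each minimal dicut contains all
the copies of an arc or none.) -/
structure IsEquitablePacking (w : D.A → ℕ) {ν : ℕ} (J : Fin ν → Finset (D.Copies w)) : Prop where
  dijoin : ∀ i, D.IsDijoin ((J i).image Sigma.fst)
  disjoint : ∀ i j, i ≠ j → Disjoint (J i) (J j)
  equitable : ∀ B, D.IsMinimalDicut B → ∀ i j,
    ((((J i).filter fun c => c.1 ∈ B).card : ℤ) - (((J j).filter fun c => c.1 ∈ B).card : ℤ)) ∈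
      ({-1, 0, 1} : Set ℤ)

end DiMultigraph

/-! ### Clutters -/

/-- A clutter over the ground set `E`: a family of subsets none of which contains another. -/
structure Clutter (E : Type u) where
  members : Set (Finset E)
  antichain : IsAntichain (· ⊆ ·) members

namespace Clutter

variable {E : Type u}

/-- The clutter of the inclusionwise minimal sets of a family. -/
def ofMinimal (P : Finset E → Prop) : Clutter E where
  members := {S | Minimal P S}
  antichain := fun _ hS _ hT hne hle => hne (hT.eq_of_le hS.prop hle)

/-- Relabelling the elements of the ground set along a bijection. -/
def relabel {E' : Type u} (e : E ≃ E') (C : Clutter E) : Clutter E' where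
  members := {S | S.map e.symm.toEmbedding ∈ C.members}
  antichain := fun _ hS _ hT hne hle =>
    C.antichain hS hT (fun h => hne (Finset.map_injective _ h)) (Finset.map_subset_map.2 hle)

/-- Delete each element `a` with `w a = 0`, and replicate each other element `a` exactly
`w a - 1` times. The copies of `a` are the pairs `⟨a, k⟩` with `k < w a`, and a member is obtained
from a member of `C` by choosing one copy of each of its elements. -/
def replicate (C : Clutter E) (w : E → ℕ) : Clutter (Σ a : E, Fin (w a)) where
  members := {S | Set.InjOn Sigma.fst (S : Set (Σ a : E, Fin (w a))) ∧
    S.image Sigma.fst ∈ C.members}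
  antichain := by
    intro S hS T hT hne hle
    refine hne (Finset.Subset.antisymm hle fun x hx => ?_)
    have himg : S.image Sigma.fst = T.image Sigma.fst := by
      by_contra h
      exact C.antichain hS.2 hT.2 h (Finset.image_subset_image hle)
    have hx' : x.1 ∈ S.image Sigma.fst := himg ▸ Finset.mem_image_of_mem _ hx
    obtain ⟨y, hy, hyx⟩ := Finset.mem_image.1 hx'
    have : y = x := hT.1 (hle hy) hx hyx
    exact this ▸ hy

/-- The clutter obtained by contracting all the elements of `X` (in any order): the minimal sets
among the sets `M - X` with `M` a member. -/
def contract (C : Clutter E) (X : Finset E) : Clutter {x : E // x ∉ X} :=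
  ofMinimal fun S => ∃ M ∈ C.members, S = M.subtype (· ∉ X)

/-- The product of a finite family of clutters, over the disjoint union of the ground sets: the
minimal sets among the unions of one member of each clutter. -/
def prod {n : ℕ} {E : Fin n → Type u} (C : ∀ i, Clutter (E i)) : Clutter (Σ i, E i) :=
  ofMinimal fun S => ∃ M : ∀ i, Finset (E i), (∀ i, M i ∈ (C i).members) ∧
    S = Finset.univ.sigma M

end Clutter

namespace DiMultigraph

/-- The clutter `C(D)` of minimal dijoins of `D`. -/
def dijoinClutter (D : DiMultigraph.{u}) : Clutter D.A := Clutter.ofMinimal D.IsDijoin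

/-- The clutter `C(D, w)`, over the set of copies of the arcs of `D`. -/
def weightedDijoinClutter {D : DiMultigraph.{u}} (w : D.A → ℕ) : Clutter (D.Copies w) :=
  D.dijoinClutter.replicate w

/-- `(D, w)` has a decomposition into finitely many weighted `(τ, τ + 1)`-bipartite digraphs
`(D' i, w' i)`, each with the additional property `Q`. The sets `X i` are those contracted in
`C(D' i, w' i)`, and the bijection `e` identifies the ground set of `C(D, w)` with the disjoint
union of the ground sets of the resulting contraction minors. -/
def HasDecomposeLift (τ : ℕ) (D : DiMultigraph.{u}) (w : D.A → ℕ)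
    (Q : ∀ D' : DiMultigraph.{u}, (D'.A → ℕ) → Prop) : Prop :=
  ∃ (n : ℕ) (D' : Fin n → DiMultigraph.{u}) (w' : ∀ i, (D' i).A → ℕ),
    (∀ i, IsTauBipartite τ (w' i)) ∧
    ((∀ a, 0 < w a) → 3 ≤ τ → ∀ i a, 0 < w' i a) ∧
    (D.IsPlanar → ∀ i, (D' i).IsPlanar) ∧
    (∃ (X : ∀ i, Finset ((D' i).Copies (w' i)))
      (e : D.Copies w ≃ Σ i, {x : (D' i).Copies (w' i) // x ∉ X i}),
      (weightedDijoinClutter w).relabel e =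
        Clutter.prod fun i => (weightedDijoinClutter (w' i)).contract (X i)) ∧
    ∀ i, Q (D' i) (w' i)

/-- The weighted packing statement with parameters `τ`, `r`, restricted to the weighted digraphs
in the class `K`: if every dicut of `(D, w)` has weight at least `τ`, if `D` is planar (required
only when `pl` is true), and if `ρ(τ, D, w) ≤ r` (no condition when `r` is `none`), then `(D, w)`
has a `w`-weighted packing of dijoins of size `τ`, an equitable one when `eqt` is true. -/
def PackingStatementOn (K : ∀ D : DiMultigraph.{u}, (D.A → ℕ) → Prop)
    (τ : ℕ) (r : Option ℕ) (pl eqt : Bool) : Prop :=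
  ∀ (D : DiMultigraph.{u}) (w : D.A → ℕ), K D w →
    DicutsAtLeast w τ →
    (pl = true → D.IsPlanar) →
    (∀ k ∈ r, rho τ w ≤ (k : ℚ)) →
    if eqt = true then ∃ J : Fin τ → Finset (D.Copies w), IsEquitablePacking w J
    else ∃ J : Fin τ → Finset D.A, IsWeightedPacking w J

/-- The weighted packing statement for all weighted digraphs. -/
def PackingStatement (τ : ℕ) (r : Option ℕ) (pl eqt : Bool) : Prop :=
  PackingStatementOn.{u} (fun _ _ => True) τ r pl eqt

end DiMultigraph

end

/-! One bipartite digraph suffices: the index set has a single element. The weighted digraph `(D,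
w)` is refined to a `(τ, τ + 1)`-bipartite `(D', w')` by a `CutLift`. Under it the dicuts of `D`
become exactly the dicuts of `D'` all of whose arcs of positive weight are old, so every other dicut
of `D'` contains a new arc of positive weight and is met once all copies of new arcs are contracted.
This yields the clutter identity. It also shows that the old arcs of a packing for `(D', w')` form a
packing for `(D, w)`; minimal dicuts lift to minimal dicuts, so equitability survives.

The refinement composes three lifts. Pendant sources and sinks of weighted degree `τ` or `τ + 1`
absorb the imbalance `d` of each vertex. Writing `d = d(τ + 1) - dτ` uses equally many sources and
sinks. With `r = d mod τ` and `e = ⌊d/τ⌋`, writing `d = r(τ + 1) + (e - r)τ` avoids sinks of degree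
`τ + 1` and preserves `ρ`. Next, arcs are split into parallel arcs of weight at most 1. Finally each
old vertex, by now balanced, is replaced by a shield with four vertices for every dart at it: two
concentric rings of alternating sources and sinks, spokes between the rings, and chords inside the
inner one that pair the positions of unit incoming arcs with those of unit outgoing arcs. Every ring
vertex has weighted degree `τ`.

The core is `shield_dicut_cases`. Let `n` be the total excess of sources over sinks, over all rings,
in a closed set. The ring arcs leaving it weigh `(τ - 1) n`. If `n = 0`, no ring is split and the
set comes from a closed set of `D`. If `n ≥ 2`, then `2(τ - 1) ≥ τ` is enough. If `n = 1`, one more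
leaving arc of positive weight is needed. When an inner ring is split, counting along the chords
produces a spoke or a chord. When an outer ring is split, the lack of such an arc would give a set
of `D` entered by a single arc, of weight 1, and left by no arc of positive weight, which
`IsShieldable.mate` forbids.

Planarity is tracked by counting faces of rotation systems. For a connected digraph with arcs,
`euler_le` reduces planarity to a lower bound on the number of faces. A pendant arc loses no face, a
parallel arc gains one, the faces of the shield without chords are counted by labelling its darts,
and the chords are drawn inside the inner faces by `exists_noncrossing`, where balance makes the two
kinds of ends equally numerous. -/

noncomputable section
open scoped Classical
namespace DiMultigraph

/-! ### Counting orbits of permutations -/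

section Orbits

variable {X : Type u}

/-- The equivalence relation whose classes are counted by `numOrbits`. -/
def orbSetoid (S : Set (Equiv.Perm X)) : Setoid X :=
  MulAction.orbitRel (Subgroup.closure S) X

theorem numOrbits_eq (S : Set (Equiv.Perm X)) :
    numOrbits S = Nat.card (Quotient (orbSetoid S)) := rfl

theorem orbSetoid_of_mem {S : Set (Equiv.Perm X)} {g : Equiv.Perm X} (hg : g ∈ S) (x : X) :
    orbSetoid S x (g x) := by
  refine Setoid.symm' _ ?_
  exact ⟨⟨g, Subgroup.subset_closure hg⟩, rfl⟩

/-- Orbits are generated by single steps of the generators, so the orbit relation is the finest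
equivalence relation containing those steps. All upper and lower bounds on orbit numbers below rest
on this. -/
theorem orbSetoid_le {S : Set (Equiv.Perm X)} {r : Setoid X} (h : ∀ g ∈ S, ∀ x, r x (g x)) :
    orbSetoid S ≤ r := by
  rintro a b ⟨⟨g, hg⟩, rfl⟩
  change r (g b) b
  have key : ∀ b, r b (g b) := by
    induction hg using Subgroup.closure_induction with
    | mem g hg => exact fun b => h g hg b
    | one => exact fun b => Setoid.refl' _ b
    | mul f g _ _ hf hg => exact fun b => Setoid.trans' _ (hg b) (hf (g b))
    | inv g _ hg =>
      intro b
      have := hg (g⁻¹ b)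
      rw [Equiv.Perm.inv_def, Equiv.apply_symm_apply] at this
      exact Setoid.symm' _ this
  exact Setoid.symm' _ (key b)

theorem orbSetoid_mono {S T : Set (Equiv.Perm X)} (h : S ⊆ T) : orbSetoid S ≤ orbSetoid T :=
  orbSetoid_le fun _ hg x => orbSetoid_of_mem (h hg) x

theorem orbSetoid_singleton (g : Equiv.Perm X) (a b : X) :
    orbSetoid {g} a b ↔ g.SameCycle a b := by
  constructor
  · intro h
    exact orbSetoid_le (r := Equiv.Perm.SameCycle.setoid g)
      (fun f hf x => by
        rw [Set.mem_singleton_iff.1 hf]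
        exact Equiv.Perm.sameCycle_apply_right.2 (Equiv.Perm.SameCycle.refl g x)) h
  · rintro ⟨n, rfl⟩
    refine Setoid.symm' _ ?_
    have hg : g ∈ Subgroup.closure {g} := Subgroup.subset_closure (Set.mem_singleton g)
    exact MulAction.mem_orbit a (⟨g ^ n, Subgroup.zpow_mem _ hg n⟩ : Subgroup.closure {g})

/-- An equivalence relation that relates each element to its image relates all the elements of a
cycle. -/
theorem sameCycle_induction {g : Equiv.Perm X} {Y : Type*} (r : Setoid Y) (f : X → Y)
    (h : ∀ x, r (f x) (f (g x))) {a b : X} (hab : g.SameCycle a b) : r (f a) (f b) :=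
  orbSetoid_le (r := Setoid.comap f r)
    (fun k hk x => by rw [Set.mem_singleton_iff.1 hk]; exact h x)
    ((orbSetoid_singleton g a b).2 hab)

theorem card_quotient_le_of_le [Finite X] {r s : Setoid X} (h : r ≤ s) :
    Nat.card (Quotient s) ≤ Nat.card (Quotient r) :=
  Nat.card_le_card_of_surjective (Quotient.map' (s₁ := r) (s₂ := s) id h) fun q => by
    induction q using Quotient.inductionOn' with | h a => exact ⟨Quotient.mk'' a, rfl⟩

theorem card_quotient_lt_of_le [Finite X] {r s : Setoid X} (h : r ≤ s) {x y : X} (hs : s x y)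
    (hr : ¬ r x y) : Nat.card (Quotient s) + 1 ≤ Nat.card (Quotient r) := by
  refine Nat.succ_le_of_lt (lt_of_le_of_ne (card_quotient_le_of_le h) fun hc => hr ?_)
  have hsurj : Function.Surjective (Quotient.map' (s₁ := r) (s₂ := s) id h) := fun q => by
    induction q using Quotient.inductionOn' with | h a => exact ⟨Quotient.mk'' a, rfl⟩
  have hbij := (Nat.bijective_iff_surjective_and_card _).2 ⟨hsurj, hc.symm⟩
  have := @hbij.1 (Quotient.mk'' x) (Quotient.mk'' y) (Quotient.sound' hs)
  exact Quotient.exact' this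

/-- The coarsening of an equivalence relation that identifies the classes of `x` and `y`. -/
def mergeSetoid (r : Setoid X) (x y : X) : Setoid X where
  r a b := r a b ∨ ((r a x ∨ r a y) ∧ (r b x ∨ r b y))
  iseqv := by
    refine ⟨fun a => Or.inl (Setoid.refl' r a), ?_, ?_⟩
    · rintro a b (h | h)
      · exact Or.inl (Setoid.symm' r h)
      · exact Or.inr h.symm
    · rintro a b c (h | h) (k | k)
      · exact Or.inl (Setoid.trans' r h k)
      · exact Or.inr ⟨k.1.imp (Setoid.trans' r h) (Setoid.trans' r h), k.2⟩
      · have k' := Setoid.symm' r k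
        exact Or.inr ⟨h.1, h.2.imp (Setoid.trans' r k') (Setoid.trans' r k')⟩
      · exact Or.inr ⟨h.1, k.2⟩

/-- Map the class of `x` to `none` and every other class to its merged class: the only
identification that merging makes involves the class of `x`, so this map is injective. -/
theorem card_quotient_merge [Finite X] (r : Setoid X) (x y : X) :
    Nat.card (Quotient r) ≤ Nat.card (Quotient (mergeSetoid r x y)) + 1 := by
  rw [← Finite.card_option]
  have hle : r ≤ mergeSetoid r x y := fun _ _ h => Or.inl h
  refine Nat.card_le_card_of_injective
    (fun q => if q = Quotient.mk'' x then none
      else some (Quotient.map' (s₁ := r) (s₂ := mergeSetoid r x y) id hle q)) ?_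
  intro a b
  induction a using Quotient.inductionOn' with | h a => ?_
  induction b using Quotient.inductionOn' with | h b => ?_
  intro h
  by_cases ha : (Quotient.mk'' a : Quotient r) = Quotient.mk'' x
  · by_cases hb : (Quotient.mk'' b : Quotient r) = Quotient.mk'' x
    · rw [ha, hb]
    · simp [ha, hb] at h
  · by_cases hb : (Quotient.mk'' b : Quotient r) = Quotient.mk'' x
    · simp [ha, hb] at h
    · simp only [ha, hb, if_false, Option.some.injEq] at h
      have h' : mergeSetoid r x y a b := Quotient.exact' h
      rcases h' with h' | ⟨h1, h2⟩
      · exact Quotient.sound' h'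
      · have h1' := h1.resolve_left fun k => ha (Quotient.sound' k)
        have h2' := h2.resolve_left fun k => hb (Quotient.sound' k)
        exact Quotient.sound' (Setoid.trans' r h1' (Setoid.symm' r h2'))

theorem numOrbits_le_insert_swap [Finite X] [DecidableEq X] (S : Set (Equiv.Perm X)) (x y : X) :
    numOrbits S ≤ numOrbits (insert (Equiv.swap x y) S) + 1 := by
  rw [numOrbits_eq, numOrbits_eq]
  refine (card_quotient_merge (orbSetoid S) x y).trans (Nat.add_le_add_right ?_ 1)
  refine card_quotient_le_of_le (orbSetoid_le ?_)
  rintro g (rfl | hg) z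
  · by_cases hx : z = x
    · subst hx
      rw [Equiv.swap_apply_left]
      exact Or.inr ⟨Or.inl (Setoid.refl' _ _), Or.inr (Setoid.refl' _ _)⟩
    · by_cases hy : z = y
      · subst hy
        rw [Equiv.swap_apply_right]
        exact Or.inr ⟨Or.inr (Setoid.refl' _ _), Or.inl (Setoid.refl' _ _)⟩
      · rw [Equiv.swap_apply_of_ne_of_ne hx hy]
  · exact Or.inl (orbSetoid_of_mem hg z)

theorem numOrbits_insert_swap [Finite X] [DecidableEq X] (S : Set (Equiv.Perm X)) {x y : X}
    (h : orbSetoid S x y) : numOrbits S ≤ numOrbits (insert (Equiv.swap x y) S) := by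
  refine card_quotient_le_of_le (orbSetoid_le ?_)
  rintro g (rfl | hg) z
  · by_cases hx : z = x
    · subst hx; rwa [Equiv.swap_apply_left]
    · by_cases hy : z = y
      · subst hy; rw [Equiv.swap_apply_right]; exact Setoid.symm' _ h
      · rw [Equiv.swap_apply_of_ne_of_ne hx hy]
  · exact orbSetoid_of_mem hg z

/-- The transposition together with `g * swap x y` generates `g`, so this pair has no more orbits
than `g`; removing the transposition from the generators gains at most one orbit. -/
theorem numOrbits_mul_swap_le [Finite X] [DecidableEq X] (g : Equiv.Perm X) (x y : X) :
    numOrbits {g * Equiv.swap x y} ≤ numOrbits {g} + 1 := by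
  refine (numOrbits_le_insert_swap _ x y).trans (Nat.add_le_add_right ?_ 1)
  refine card_quotient_le_of_le (orbSetoid_le ?_)
  rintro f rfl z
  have h1 := orbSetoid_of_mem
    (S := insert (Equiv.swap x y) {f * Equiv.swap x y}) (Set.mem_insert _ _) z
  have h2 := orbSetoid_of_mem (S := insert (Equiv.swap x y) {f * Equiv.swap x y})
    (Set.mem_insert_of_mem _ rfl) (Equiv.swap x y z)
  have h3 := Setoid.trans' _ h1 h2
  rwa [Equiv.Perm.mul_apply, Equiv.swap_apply_self] at h3

/-- Multiplying by a transposition of elements in different cycles joins these cycles: the orbit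
relation of the product contains that of `g` and relates `x` to `y` as well. -/
theorem numOrbits_mul_swap_of_not_sameCycle [Finite X] [DecidableEq X] {g : Equiv.Perm X} {x y : X}
    (h : ¬ g.SameCycle x y) : numOrbits {g * Equiv.swap x y} + 1 ≤ numOrbits {g} := by
  have hxy : x ≠ y := fun e => h (e ▸ Equiv.Perm.SameCycle.refl _ _)
  set s := orbSetoid {g * Equiv.swap x y} with hs
  have hstep : ∀ z, s z (g (Equiv.swap x y z)) := fun z => orbSetoid_of_mem (Set.mem_singleton _) z
  have hyx : s y x := by
    -- From `y` the product jumps to `g x` and then follows the `g`-cycle of `x`. Before the first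
    -- return to `x` it meets neither `x` nor `y`, so the transposition does not interfere.
    have hex : ∃ n, 0 < n ∧ (g ^ n) x = x :=
      ⟨orderOf g, orderOf_pos g, by rw [pow_orderOf_eq_one]; rfl⟩
    obtain ⟨hn0, hn⟩ := Nat.find_spec hex
    have key : ∀ j, j + 1 ≤ Nat.find hex → s y ((g ^ (j + 1)) x) := by
      intro j
      induction j with
      | zero =>
        intro _
        have := hstep y
        rwa [Equiv.swap_apply_right] at this
      | succ j ih =>
        intro hj
        have h1 := ih (by omega)
        have hne1 : (g ^ (j + 1)) x ≠ x := fun e =>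
          Nat.find_min hex (m := j + 1) (by omega) ⟨by omega, e⟩
        have hne2 : (g ^ (j + 1)) x ≠ y := fun e => h ⟨(j + 1 : ℕ), by rw [zpow_natCast]; exact e⟩
        have h2 := hstep ((g ^ (j + 1)) x)
        rw [Equiv.swap_apply_of_ne_of_ne hne1 hne2] at h2
        rw [pow_succ' g (j + 1)]
        exact Setoid.trans' _ h1 h2
    have := key (Nat.find hex - 1) (by omega)
    rwa [Nat.sub_add_cancel hn0, hn] at this
  refine card_quotient_lt_of_le (orbSetoid_le ?_) (Setoid.symm' _ hyx)
    (fun k => h ((orbSetoid_singleton _ _ _).1 k))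
  intro f hf z
  rw [Set.mem_singleton_iff.1 hf]
  by_cases hx : z = x
  · subst hx
    have := hstep y
    rw [Equiv.swap_apply_right] at this
    exact Setoid.trans' _ (Setoid.symm' _ hyx) this
  · by_cases hy : z = y
    · subst hy
      have := hstep x
      rw [Equiv.swap_apply_left] at this
      exact Setoid.trans' _ hyx this
    · have := hstep z
      rwa [Equiv.swap_apply_of_ne_of_ne hx hy] at this

/-- The device for all lower bounds on face numbers: label the darts so that labels are constant
along faces and every label occurs. -/
theorem le_numOrbits_of_invariant [Finite X] {g : Equiv.Perm X} {L : Type*} (f : X → L)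
    (hf : ∀ x, f (g x) = f x) (hs : Function.Surjective f) : Nat.card L ≤ numOrbits {g} := by
  refine Nat.card_le_card_of_surjective
    (Quotient.lift (s := orbSetoid {g}) f fun a b hab => ?_) fun l => ?_
  · exact sameCycle_induction (⊥ : Setoid L) f (fun x => (hf x).symm)
      ((orbSetoid_singleton _ _ _).1 hab)
  · obtain ⟨x, rfl⟩ := hs l
    exact ⟨Quotient.mk _ x, rfl⟩

end Orbits

/-! ### The Euler inequality for rotation systems -/

section Euler

variable (D : DiMultigraph.{u})

/-- The involution exchanging the two ends of each arc of `F`. -/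
def flipOn (F : Finset D.A) : Equiv.Perm D.Dart :=
  (show Function.Involutive fun x : D.Dart => if x.1 ∈ F then (x.1, !x.2) else x from by
    rintro ⟨a, b⟩
    by_cases h : a ∈ F <;> simp [h]).toPerm

theorem flipOn_apply (F : Finset D.A) (x : D.Dart) :
    D.flipOn F x = if x.1 ∈ F then (x.1, !x.2) else x := rfl

@[simp] theorem dartFlip_apply (x : D.Dart) : D.dartFlip x = (x.1, !x.2) := by
  rcases x with ⟨a, _ | _⟩ <;> rfl

/-- The Euler characteristic of a closed oriented surface is at most two per component. -/
theorem euler_le (σ : Equiv.Perm D.Dart) :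
    numOrbits {σ} + numOrbits {σ * D.dartFlip} ≤
      Fintype.card D.A + 2 * numOrbits {σ, D.dartFlip} := by
  set sw : D.A → Equiv.Perm D.Dart := fun a => Equiv.swap (a, false) (a, true) with hsw
  -- Arcs are switched on one at a time: for an arc outside `F`, `flipOn F` fixes both ends, and
  -- adding it multiplies the face permutation by a transposition.
  have key : ∀ F : Finset D.A, numOrbits {σ} + numOrbits {σ * D.flipOn F} ≤
      F.card + 2 * numOrbits (insert σ (sw '' (F : Set D.A))) := by
    intro F
    induction F using Finset.induction_on with
    | empty =>
      have : D.flipOn ∅ = 1 := by ext x <;> simp [flipOn_apply]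
      rw [this]
      simp
      omega
    | insert a F ha ih =>
      have h1 : σ * D.flipOn (insert a F) = σ * D.flipOn F * Equiv.swap (a, false) (a, true) := by
        rw [mul_assoc]
        congr 1
        refine Equiv.ext ?_
        rintro ⟨c, b⟩
        rw [Equiv.Perm.mul_apply]
        by_cases hc : c = a
        · subst hc
          cases b
          · rw [Equiv.swap_apply_left]; simp [flipOn_apply, ha]
          · rw [Equiv.swap_apply_right]; simp [flipOn_apply, ha]
        · rw [Equiv.swap_apply_of_ne_of_ne (by simp [hc]) (by simp [hc])]
          simp [flipOn_apply, hc]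
      have h2 : insert σ (sw '' ((insert a F : Finset D.A) : Set D.A)) =
          insert (Equiv.swap (a, false) (a, true)) (insert σ (sw '' (F : Set D.A))) := by
        rw [Finset.coe_insert, Set.image_insert_eq, Set.insert_comm]
      rw [h1, h2, Finset.card_insert_of_notMem ha]
      have h3 := numOrbits_le_insert_swap (insert σ (sw '' (F : Set D.A))) (a, false) (a, true)
      -- If both ends lie in one face, that component already contains them and at most one face is
      -- gained. Otherwise a face is lost, which pays for the component that may be lost.
      by_cases hs : (σ * D.flipOn F).SameCycle (a, false) (a, true)
      · have h4 := numOrbits_mul_swap_le (σ * D.flipOn F) (a, false) (a, true)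
        have h5 : orbSetoid (insert σ (sw '' (F : Set D.A))) (a, false) (a, true) := by
          refine sameCycle_induction (orbSetoid _) id (fun x => ?_) hs
          have e1 : orbSetoid (insert σ (sw '' (F : Set D.A))) x (D.flipOn F x) := by
            rw [flipOn_apply]
            split_ifs with hx
            · have := orbSetoid_of_mem (S := insert σ (sw '' (F : Set D.A)))
                (Set.mem_insert_of_mem _ ⟨x.1, hx, rfl⟩) x
              rcases x with ⟨c, _ | _⟩
              · rwa [hsw, Equiv.swap_apply_left] at this
              · rwa [hsw, Equiv.swap_apply_right] at this
            · exact Setoid.refl' _ _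
          exact Setoid.trans' _ e1 (orbSetoid_of_mem (Set.mem_insert _ _) _)
        have h6 := numOrbits_insert_swap _ h5
        omega
      · have h4 := numOrbits_mul_swap_of_not_sameCycle hs
        omega
  have h := key Finset.univ
  have h1 : D.flipOn Finset.univ = D.dartFlip := by
    refine Equiv.ext fun x => ?_
    rw [flipOn_apply, dartFlip_apply, if_pos (Finset.mem_univ _)]
  have h2 : numOrbits (insert σ (sw '' ((Finset.univ : Finset D.A) : Set D.A))) ≤
      numOrbits {σ, D.dartFlip} := by
    refine card_quotient_le_of_le (orbSetoid_le ?_)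
    rintro g (rfl | rfl) x
    · exact orbSetoid_of_mem (Set.mem_insert _ _) x
    · have := orbSetoid_of_mem (S := insert σ (sw '' ((Finset.univ : Finset D.A) : Set D.A)))
        (Set.mem_insert_of_mem _ ⟨x.1, by simp, rfl⟩) x
      rw [dartFlip_apply]
      rcases x with ⟨c, _ | _⟩
      · rwa [hsw, Equiv.swap_apply_left] at this
      · rwa [hsw, Equiv.swap_apply_right] at this
  rw [h1, Finset.card_univ] at h
  omega

end Euler

end DiMultigraph
end

noncomputable section
open scoped Classical
namespace DiMultigraph

/-! ### Connected digraphs, rotation systems and planarity -/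

section Rotation

variable {D E : DiMultigraph.{u}}

/-- A rotation system: a permutation of the darts whose cycles are the sets of darts at the
vertices. -/
def IsRotation (σ : Equiv.Perm D.Dart) : Prop :=
  ∀ x y, σ.SameCycle x y ↔ D.dartVertex x = D.dartVertex y

theorem IsRotation.dartVertex_apply {σ : Equiv.Perm D.Dart} (h : IsRotation σ) (x : D.Dart) :
    D.dartVertex (σ x) = D.dartVertex x :=
  ((h _ _).1 (Equiv.Perm.sameCycle_apply_right.2 (Equiv.Perm.SameCycle.refl σ x))).symm

variable (D) in
/-- The underlying undirected graph is connected. -/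
def CutConnected : Prop :=
  ∀ U : Finset D.V, U.Nonempty → U ≠ Finset.univ → ∃ a, ¬ (D.tail a ∈ U ↔ D.head a ∈ U)

variable (D) in
/-- Some rotation system has at least `k` faces. -/
def HasFaces (k : ℕ) : Prop :=
  ∃ σ : Equiv.Perm D.Dart, IsRotation σ ∧ k ≤ numOrbits {σ * D.dartFlip}

/-- A vertex set crossed by no arc would give the empty dicut, of weight 0. -/
theorem DicutsAtLeast.cutConnected {w : D.A → ℕ} {τ : ℕ} (h : DicutsAtLeast w τ) (hτ : 0 < τ) :
    D.CutConnected := by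
  intro U hU hU'
  by_contra hcon
  push Not at hcon
  have := h (D.outArcs U) ⟨U, hU, hU', by
    ext a; simp only [inArcs, Finset.mem_filter, Finset.mem_univ, true_and, Finset.notMem_empty,
      iff_false, not_and]; exact fun h1 h2 => h1 ((hcon a).2 h2), rfl⟩
  have h0 : D.outArcs U = ∅ := by
    ext a; simp only [outArcs, Finset.mem_filter, Finset.mem_univ, true_and, Finset.notMem_empty,
      iff_false, not_and, not_not]; exact fun h1 => (hcon a).1 h1
  rw [h0] at this
  simp [weight] at this
  omega

theorem exists_transitive_perm (Y : Type u) [Fintype Y] :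
    ∃ g : Equiv.Perm Y, ∀ x y, g.SameCycle x y := by
  cases isEmpty_or_nonempty Y with
  | inl h => exact ⟨1, fun x => (h.false x).elim⟩
  | inr h =>
    have : NeZero (Fintype.card Y) := ⟨Fintype.card_ne_zero⟩
    have e : Y ≃ ZMod (Fintype.card Y) := Fintype.equivOfCardEq (by rw [ZMod.card])
    refine ⟨e.permCongr.symm (Equiv.addRight 1), fun x y => ?_⟩
    have key : ∀ n : ℕ, e (((e.permCongr.symm (Equiv.addRight 1)) ^ n) x) = e x + n := by
      intro n
      induction n with
      | zero => simp
      | succ n ih =>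
        rw [pow_succ', Equiv.Perm.mul_apply]
        simp only [Equiv.permCongr_symm_apply, Equiv.apply_symm_apply, Equiv.coe_addRight, ih]
        push_cast
        ring
    refine ⟨((e y - e x).val : ℕ), ?_⟩
    rw [zpow_natCast]
    apply e.injective
    rw [key, ZMod.natCast_zmod_val]
    ring

variable (D) in
-- Needed when `D` is not planar: the shield is built from some cyclic order of the darts at each
-- vertex in any case.
theorem exists_isRotation : ∃ σ : Equiv.Perm D.Dart, IsRotation σ := by
  choose g hg using fun v : D.V => exists_transitive_perm {x : D.Dart // D.dartVertex x = v}
  set e := Equiv.sigmaFiberEquiv D.dartVertex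
  refine ⟨e.permCongr (Equiv.sigmaCongrRight g), fun x y => ⟨fun h => ?_, fun h => ?_⟩⟩
  · refine sameCycle_induction (⊥ : Setoid D.V) D.dartVertex (fun z => ?_) h
    obtain ⟨⟨v, z, hz⟩, rfl⟩ := e.surjective z
    rw [Equiv.permCongr_apply, Equiv.symm_apply_apply]
    change D.dartVertex z = D.dartVertex (g v ⟨z, hz⟩ : {x : D.Dart // D.dartVertex x = v}).1
    rw [hz, (g v ⟨z, hz⟩).2]
  · have h' := hg (D.dartVertex y) ⟨x, h⟩ ⟨y, rfl⟩
    refine (orbSetoid_singleton _ _ _).1 (sameCycle_induction (orbSetoid _)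
      (fun z : {x : D.Dart // D.dartVertex x = D.dartVertex y} => z.1) (fun z => ?_) h')
    have := orbSetoid_of_mem (S := {e.permCongr (Equiv.sigmaCongrRight g)})
      (Set.mem_singleton _) (e ⟨_, z⟩)
    rw [Equiv.permCongr_apply, Equiv.symm_apply_apply] at this
    exact this

theorem CutConnected.exists_dart (hc : D.CutConnected) [hA : Nonempty D.A] (v : D.V) :
    ∃ x, D.dartVertex x = v := by
  by_cases hU : ({v} : Finset D.V) = Finset.univ
  · obtain ⟨a⟩ := hA
    have h1 : D.tail a ∈ ({v} : Finset D.V) := hU ▸ Finset.mem_univ _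
    exact ⟨(a, false), Finset.mem_singleton.1 h1⟩
  · obtain ⟨a, ha⟩ := hc {v} (Finset.singleton_nonempty v) hU
    simp only [Finset.mem_singleton] at ha
    by_cases h : D.tail a = v
    · exact ⟨(a, false), h⟩
    · by_cases h' : D.head a = v
      · exact ⟨(a, true), h'⟩
      · exact (ha (by simp [h, h'])).elim

theorem IsRotation.numOrbits_eq_card {σ : Equiv.Perm D.Dart} (h : IsRotation σ)
    (hs : ∀ v, ∃ x, D.dartVertex x = v) : numOrbits {σ} = Fintype.card D.V := by
  rw [numOrbits_eq, ← Nat.card_eq_fintype_card]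
  refine Nat.card_congr (Equiv.ofBijective (Quotient.lift (s := orbSetoid {σ}) D.dartVertex
    fun a b hab => (h a b).1 ((orbSetoid_singleton _ _ _).1 hab)) ⟨?_, ?_⟩)
  · intro a b
    induction a using Quotient.inductionOn with | h a => ?_
    induction b using Quotient.inductionOn with | h b => ?_
    intro hab
    exact Quotient.sound ((orbSetoid_singleton _ _ _).2 ((h a b).2 hab))
  · intro v
    obtain ⟨x, rfl⟩ := hs v
    exact ⟨Quotient.mk _ x, rfl⟩

theorem CutConnected.numOrbits_le_one (hc : D.CutConnected) {σ : Equiv.Perm D.Dart}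
    (h : IsRotation σ) : numOrbits {σ, D.dartFlip} ≤ 1 := by
  rw [numOrbits_eq, Finite.card_le_one_iff_subsingleton]
  refine ⟨fun a b => ?_⟩
  induction a using Quotient.inductionOn with | h x => ?_
  induction b using Quotient.inductionOn with | h y => ?_
  refine Quotient.sound ?_
  set r := orbSetoid {σ, D.dartFlip}
  have hvert : ∀ z z', D.dartVertex z = D.dartVertex z' → r z z' := fun z z' hz =>
    orbSetoid_mono (by simp) ((orbSetoid_singleton σ z z').2 ((h z z').2 hz))
  set U : Finset D.V := Finset.univ.filter fun v => ∃ z, r x z ∧ D.dartVertex z = v with hU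
  have hmem : ∀ z, D.dartVertex z ∈ U ↔ r x z := by
    intro z
    simp only [hU, Finset.mem_filter, Finset.mem_univ, true_and]
    exact ⟨fun ⟨z', h1, h2⟩ => Setoid.trans' r h1 (hvert _ _ h2), fun h => ⟨z, h, rfl⟩⟩
  have huniv : U = Finset.univ := by
    by_contra hne
    obtain ⟨a, ha⟩ := hc U ⟨_, (hmem x).2 (Setoid.refl' r x)⟩ hne
    apply ha
    have hf : r (a, false) (a, true) := by
      have := orbSetoid_of_mem (S := {σ, D.dartFlip}) (g := D.dartFlip) (by simp) (a, false)
      rwa [dartFlip_apply] at this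
    exact (hmem (a, false)).trans
      ((⟨fun k => Setoid.trans' r k hf, fun k => Setoid.trans' r k (Setoid.symm' r hf)⟩ :
        r x (a, false) ↔ r x (a, true)).trans (hmem (a, true)).symm)
  exact (hmem y).1 (huniv ▸ Finset.mem_univ _)

/-- Connectedness and the existence of an arc make the orbits of `σ` correspond to the vertices and
leave one component. The reverse inequality always holds by `euler_le`, so a lower bound on the
faces is enough; this is why `HasFaces` only asks for one. -/
theorem CutConnected.isPlanar_iff (hc : D.CutConnected) [Nonempty D.A] :
    D.IsPlanar ↔ ∃ σ : Equiv.Perm D.Dart, IsRotation σ ∧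
      Fintype.card D.A + 2 ≤ Fintype.card D.V + numOrbits {σ * D.dartFlip} := by
  constructor
  · rintro ⟨σ, h, he⟩
    refine ⟨σ, h, ?_⟩
    have h1 : 0 < numOrbits {σ, D.dartFlip} := by
      rw [numOrbits_eq]
      have : Nonempty (Quotient (orbSetoid {σ, D.dartFlip})) :=
        ⟨Quotient.mk _ (Classical.arbitrary D.A, false)⟩
      exact Nat.card_pos
    rw [IsRotation.numOrbits_eq_card h hc.exists_dart] at he
    omega
  · rintro ⟨σ, h, he⟩
    refine ⟨σ, h, ?_⟩
    have h1 := D.euler_le σ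
    have h2 := hc.numOrbits_le_one h
    rw [IsRotation.numOrbits_eq_card h hc.exists_dart] at *
    omega

theorem isPlanar_of_isEmpty [IsEmpty D.A] : D.IsPlanar := by
  refine ⟨1, fun x => isEmptyElim x.1, ?_⟩
  have : ∀ S : Set (Equiv.Perm D.Dart), numOrbits S = 0 := fun S => by
    rw [numOrbits_eq]
    have : IsEmpty (Quotient (orbSetoid S)) :=
      ⟨fun q => Quotient.inductionOn q fun x => isEmptyElim x.1⟩
    exact Nat.card_of_isEmpty
  simp [this]

theorem HasFaces.of_equiv {k : ℕ} (h : D.HasFaces k) (eV : D.V ≃ E.V) (eA : D.A ≃ E.A)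
    (ht : ∀ a, E.tail (eA a) = eV (D.tail a)) (hh : ∀ a, E.head (eA a) = eV (D.head a)) :
    E.HasFaces k := by
  obtain ⟨σ, hσ, hk⟩ := h
  set e : D.Dart ≃ E.Dart := eA.prodCongr (Equiv.refl Bool) with he
  have hv : ∀ x, E.dartVertex (e x) = eV (D.dartVertex x) := by
    rintro ⟨a, _ | _⟩
    · exact ht a
    · exact hh a
  have happ : ∀ x, e.permCongr σ (e x) = e (σ x) := fun x => by
    rw [Equiv.permCongr_apply, Equiv.symm_apply_apply]
  refine ⟨e.permCongr σ, fun x y => ?_, hk.trans ?_⟩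
  · obtain ⟨x, rfl⟩ := e.surjective x
    obtain ⟨y, rfl⟩ := e.surjective y
    rw [hv, hv, eV.apply_eq_iff_eq, ← hσ]
    constructor
    · intro h
      have := sameCycle_induction (orbSetoid {σ}) e.symm (fun z => by
        rw [Equiv.permCongr_apply, Equiv.symm_apply_apply]
        exact orbSetoid_of_mem (Set.mem_singleton _) _) h
      rw [Equiv.symm_apply_apply, Equiv.symm_apply_apply] at this
      exact (orbSetoid_singleton _ _ _).1 this
    · intro h
      refine (orbSetoid_singleton _ _ _).1 (sameCycle_induction (orbSetoid _) e (fun z => ?_) h)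
      rw [← happ]
      exact orbSetoid_of_mem (Set.mem_singleton _) _
  · rw [numOrbits_eq {σ * D.dartFlip}]
    refine le_numOrbits_of_invariant (fun x => Quotient.mk _ (e.symm x)) (fun x => ?_) fun q => ?_
    · obtain ⟨⟨a, b⟩, rfl⟩ := e.surjective x
      refine Quotient.sound (Setoid.symm' _ ?_)
      have h1 := orbSetoid_of_mem (S := {σ * D.dartFlip}) (Set.mem_singleton _) (a, b)
      rw [Equiv.symm_apply_apply, Equiv.Perm.mul_apply]
      have h2 : E.dartFlip (e (a, b)) = e (D.dartFlip (a, b)) := by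
        rw [dartFlip_apply, dartFlip_apply]; rfl
      rw [h2, happ, Equiv.symm_apply_apply]
      exact h1
    · induction q using Quotient.inductionOn with | h x => ?_
      exact ⟨e x, by simp only [Equiv.symm_apply_apply]⟩

end Rotation

/-! ### Inserting an arc into a face -/

section AddArcs

variable (D : DiMultigraph.{u})

/-- `D` with additional arcs. -/
@[reducible] def withArcs (K : Type u) [Fintype K] (t h : K → D.V) (hne : ∀ k, t k ≠ h k) :
    DiMultigraph.{u} where
  V := D.V
  A := D.A ⊕ K
  tail := Sum.elim D.tail t
  head := Sum.elim D.head h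
  tail_ne_head := by rintro (a | k); exacts [D.tail_ne_head a, hne k]

variable {D}

/-- A dart of `D` as a dart of a digraph with more arcs. -/
def oldDart {K : Type u} (x : D.Dart) : (D.A ⊕ K) × Bool := (Sum.inl x.1, x.2)

theorem exists_perm_of_injective {X : Type u} [Finite X] (f : X → X) (hf : Function.Injective f) :
    ∃ σ : Equiv.Perm X, ∀ x, σ x = f x :=
  ⟨Equiv.ofBijective f (Finite.injective_iff_bijective.1 hf), fun _ => rfl⟩

/-- Inserting an arc between two corners of a face splits that face. -/
theorem insert_arc {σ : Equiv.Perm D.Dart} (hσ : IsRotation σ) {x y : D.Dart}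
    (hne : D.dartVertex x ≠ D.dartVertex y) {k : ℕ}
    (hk : ((σ * D.dartFlip) ^ k) x = y)
    (hmin : ∀ j < k, ((σ * D.dartFlip) ^ j) x ≠ y) :
    ∃ σ' : Equiv.Perm (D.withArcs PUnit (fun _ => D.dartVertex x) (fun _ => D.dartVertex y)
        (fun _ => hne)).Dart, IsRotation σ' ∧
      numOrbits {σ * D.dartFlip} + 1 ≤ numOrbits {σ' * dartFlip _} ∧
      ∀ z z', (∀ j < k, ((σ * D.dartFlip) ^ j) x ≠ z) → (∀ j < k, ((σ * D.dartFlip) ^ j) x ≠ z') →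
        ((σ' * dartFlip _).SameCycle (oldDart z) (oldDart z') ↔
          (σ * D.dartFlip).SameCycle z z') := by
  set φ := σ * D.dartFlip with hφ
  set D' := D.withArcs PUnit (fun _ => D.dartVertex x) (fun _ => D.dartVertex y) (fun _ => hne)
    with hD'
  have hxy : x ≠ y := fun h => hne (h ▸ rfl)
  set p : D'.Dart := (Sum.inr PUnit.unit, false) with hp
  set q : D'.Dart := (Sum.inr PUnit.unit, true) with hq
  have hk0 : 0 < k := Nat.pos_of_ne_zero fun h => hxy (by rw [← hk, h]; rfl)
  have hinj : Function.Injective (oldDart : D.Dart → D'.Dart) := by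
    rintro ⟨a, b⟩ ⟨a', b'⟩ h
    simpa [oldDart] using h
  have hnp : ∀ z : D.Dart, (oldDart z : D'.Dart) ≠ p := fun z h => by simp [oldDart, hp] at h
  have hnq : ∀ z : D.Dart, (oldDart z : D'.Dart) ≠ q := fun z h => by simp [oldDart, hq] at h
  have hpq : p ≠ q := by simp [hp, hq]
  have hcases : ∀ z : D'.Dart, z = p ∨ z = q ∨ ∃ z₀ : D.Dart, z = oldDart z₀ := by
    rintro ⟨a | ⟨⟩, b⟩
    · exact Or.inr (Or.inr ⟨(a, b), rfl⟩)
    · cases b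
      · exact Or.inl rfl
      · exact Or.inr (Or.inl rfl)
  -- The tail end `p` of the new arc is placed immediately before `x` in the rotation, and the head
  -- end `q` immediately before `y`.
  set f : D'.Dart → D'.Dart := fun z => match z with
    | (Sum.inl a, b) => if σ (a, b) = x then p else if σ (a, b) = y then q else oldDart (σ (a, b))
    | (Sum.inr _, false) => oldDart x
    | (Sum.inr _, true) => oldDart y with hf
  have hfold : ∀ z : D.Dart, f (oldDart z) =
      if σ z = x then p else if σ z = y then q else oldDart (σ z) := fun z => rfl
  have hfp : f p = oldDart x := rfl
  have hfq : f q = oldDart y := rfl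
  have hfinj : Function.Injective f := by
    intro z z' hzz
    rcases hcases z with rfl | rfl | ⟨z, rfl⟩ <;> rcases hcases z' with rfl | rfl | ⟨z', rfl⟩
    · rfl
    · rw [hfp, hfq] at hzz; exact (hxy (hinj hzz)).elim
    · rw [hfp, hfold] at hzz
      split_ifs at hzz with h1 h2
      · exact (hnp _ hzz).elim
      · exact (hnq _ hzz).elim
      · exact (h1 (hinj hzz).symm).elim
    · rw [hfp, hfq] at hzz; exact (hxy (hinj hzz.symm)).elim
    · rfl
    · rw [hfq, hfold] at hzz
      split_ifs at hzz with h1 h2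
      · exact (hnp _ hzz).elim
      · exact (hnq _ hzz).elim
      · exact (h2 (hinj hzz).symm).elim
    · rw [hfp, hfold] at hzz
      split_ifs at hzz with h1 h2
      · exact (hnp _ hzz.symm).elim
      · exact (hnq _ hzz.symm).elim
      · exact (h1 (hinj hzz)).elim
    · rw [hfq, hfold] at hzz
      split_ifs at hzz with h1 h2
      · exact (hnp _ hzz.symm).elim
      · exact (hnq _ hzz.symm).elim
      · exact (h2 (hinj hzz)).elim
    · rw [hfold, hfold] at hzz
      congr 1
      apply σ.injective
      split_ifs at hzz with h1 h2 h3 h4 h5 h6 h7 h8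
      · rw [h1, h2]
      · exact (hpq hzz).elim
      · exact (hnp _ hzz.symm).elim
      · exact (hpq hzz.symm).elim
      · rw [h4, h6]
      · exact (hnq _ hzz.symm).elim
      · exact (hnp _ hzz).elim
      · exact (hnq _ hzz).elim
      · exact hinj hzz
  obtain ⟨σ', hσ'⟩ := exists_perm_of_injective f hfinj
  have hvold : ∀ z : D.Dart, D'.dartVertex (oldDart z) = D.dartVertex z := by
    rintro ⟨a, _ | _⟩ <;> rfl
  have hvp : D'.dartVertex p = D.dartVertex x := rfl
  have hvq : D'.dartVertex q = D.dartVertex y := rfl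
  have hmem : ∀ z, orbSetoid {σ'} z (f z) := fun z => by
    have := orbSetoid_of_mem (S := {σ'}) (Set.mem_singleton _) z
    rwa [hσ'] at this
  have hstep : ∀ z : D.Dart, orbSetoid {σ'} (oldDart z) (oldDart (σ z)) := by
    intro z
    have h1 := hmem (oldDart z)
    rw [hfold] at h1
    split_ifs at h1 with h2 h3
    · rw [h2]; exact Setoid.trans' _ h1 (hmem p)
    · rw [h3]; exact Setoid.trans' _ h1 (hmem q)
    · exact h1
  have hrot : IsRotation σ' := by
    intro z z'
    constructor
    · intro h
      refine sameCycle_induction (⊥ : Setoid D'.V) D'.dartVertex (fun z => ?_) h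
      rw [hσ']
      change D'.dartVertex z = D'.dartVertex (f z)
      rcases hcases z with rfl | rfl | ⟨z, rfl⟩
      · rw [hfp, hvold, hvp]
      · rw [hfq, hvold, hvq]
      · rw [hfold, hvold, ← hσ.dartVertex_apply z]
        split_ifs with h1 h2
        · rw [h1, hvp]
        · rw [h2, hvq]
        · rw [hvold]
    · have hrep : ∀ z : D'.Dart, ∃ z₀ : D.Dart, D'.dartVertex z = D.dartVertex z₀ ∧
          orbSetoid {σ'} z (oldDart z₀) := by
        intro z
        rcases hcases z with rfl | rfl | ⟨z, rfl⟩
        · exact ⟨x, rfl, hmem p⟩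
        · exact ⟨y, rfl, hmem q⟩
        · exact ⟨z, hvold z, Setoid.refl' _ _⟩
      intro h
      obtain ⟨z₀, h1, h2⟩ := hrep z
      obtain ⟨z₁, h3, h4⟩ := hrep z'
      rw [h1, h3, ← hσ] at h
      exact (orbSetoid_singleton _ _ _).1 (Setoid.trans' _ h2 (Setoid.trans' _
        (sameCycle_induction (orbSetoid {σ'}) oldDart hstep h) (Setoid.symm' _ h4)))
  set φ' := σ' * D'.dartFlip with hφ'
  have hφp : φ' p = oldDart y := by
    rw [hφ', Equiv.Perm.mul_apply, dartFlip_apply, hσ']; rfl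
  have hφq : φ' q = oldDart x := by
    rw [hφ', Equiv.Perm.mul_apply, dartFlip_apply, hσ']; rfl
  have hφold : ∀ z : D.Dart, φ' (oldDart z) =
      if φ z = x then p else if φ z = y then q else oldDart (φ z) := by
    intro z
    rw [hφ', Equiv.Perm.mul_apply, dartFlip_apply, hσ', hφ, Equiv.Perm.mul_apply, dartFlip_apply]
    rfl
  -- The stretch of the old face from `x` up to, but not including, `y`. It is closed up by `q` into
  -- a face of its own; the rest of the old face is closed up by `p`.
  set Seg : D.Dart → Prop := fun z => ∃ j < k, (φ ^ j) x = z with hSeg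
  have hsx : Seg x := ⟨0, hk0, rfl⟩
  have hsy : ¬ Seg y := fun ⟨j, hj, e⟩ => hmin j hj e
  have hsucc : ∀ z, Seg z → φ z = y ∨ (Seg (φ z) ∧ φ z ≠ x) := by
    rintro z ⟨j, hj, rfl⟩
    rw [← Equiv.Perm.mul_apply, ← pow_succ']
    by_cases hjk : j + 1 = k
    · left; rw [hjk, hk]
    · right
      refine ⟨⟨j + 1, by omega, rfl⟩, fun h => ?_⟩
      refine hmin (k - (j + 1)) (by omega) ?_
      have h3 : k = (k - (j + 1)) + (j + 1) := by omega
      have h2 : (φ ^ k) x = (φ ^ (k - (j + 1))) ((φ ^ (j + 1)) x) := by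
        rw [← Equiv.Perm.mul_apply, ← pow_add, ← h3]
      rw [h, hk] at h2
      exact h2.symm
  have hpred : ∀ z, ¬ Seg z → φ z ≠ y ∧ (φ z = x ∨ ¬ Seg (φ z)) := by
    intro z hz
    refine ⟨fun h => hz ⟨k - 1, by omega, φ.injective ?_⟩, ?_⟩
    · rw [← Equiv.Perm.mul_apply, ← pow_succ', Nat.sub_add_cancel hk0, hk, h]
    · by_contra hcon
      push Not at hcon
      obtain ⟨h1, j, hj, h2⟩ := hcon
      rcases j with _ | j
      · exact h1 h2.symm
      · rw [pow_succ', Equiv.Perm.mul_apply] at h2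
        exact hz ⟨j, by omega, φ.injective h2⟩
  -- The label `none` marks the face cut off, made of `q` and the stretch. The dart `p` inherits the
  -- old face of `x`, and all other darts keep theirs.
  set lab : D'.Dart → Option (Quotient (orbSetoid {φ})) := fun z => match z with
    | (Sum.inl a, b) => if Seg (a, b) then none else some (Quotient.mk _ (a, b))
    | (Sum.inr _, false) => some (Quotient.mk _ x)
    | (Sum.inr _, true) => none with hlab
  have hlold : ∀ z : D.Dart, lab (oldDart z) = if Seg z then none else some (Quotient.mk _ z) :=
    fun z => rfl
  have hlp : lab p = some (Quotient.mk _ x) := rfl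
  have hlq : lab q = none := rfl
  have hq1 : ∀ z, (Quotient.mk _ (φ z) : Quotient (orbSetoid {φ})) = Quotient.mk _ z := fun z =>
    Quotient.sound (Setoid.symm' _ (orbSetoid_of_mem (Set.mem_singleton _) z))
  have hqy : (Quotient.mk _ y : Quotient (orbSetoid {φ})) = Quotient.mk _ x :=
    Quotient.sound (Setoid.symm' _ ((orbSetoid_singleton _ _ _).2 ⟨k, by rw [zpow_natCast, hk]⟩))
  have hlinv : ∀ z, lab (φ' z) = lab z := by
    intro z
    rcases hcases z with rfl | rfl | ⟨z, rfl⟩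
    · rw [hφp, hlp, hlold, if_neg hsy, hqy]
    · rw [hφq, hlq, hlold, if_pos hsx]
    · rw [hφold, hlold]
      by_cases hz : Seg z
      · rw [if_pos hz]
        rcases hsucc z hz with h | ⟨h1, h2⟩
        · rw [if_neg (by rw [h]; exact hxy.symm), if_pos h]
        · rw [if_neg h2, if_neg (fun h : φ z = y => hsy (h ▸ h1)), hlold, if_pos h1]
      · rw [if_neg hz]
        obtain ⟨h1, h2⟩ := hpred z hz
        by_cases h3 : φ z = x
        · rw [if_pos h3, hlp, ← h3, hq1]
        · rw [if_neg h3, if_neg h1, hlold, if_neg (h2.resolve_left h3), hq1]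
  refine ⟨σ', hrot, ?_, ?_⟩
  · rw [numOrbits_eq {φ}, ← Finite.card_option]
    refine le_numOrbits_of_invariant lab hlinv fun l => ?_
    rcases l with _ | l
    · exact ⟨q, rfl⟩
    · induction l using Quotient.inductionOn with | h z => ?_
      by_cases hz : Seg z
      · refine ⟨p, ?_⟩
        obtain ⟨j, _, rfl⟩ := hz
        rw [hlp]
        congr 1
        exact Quotient.sound ((orbSetoid_singleton _ _ _).2 ⟨j, by rw [zpow_natCast]⟩)
      · exact ⟨oldDart z, by rw [hlold, if_neg hz]⟩
  · intro z z' hz hz'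
    have hz1 : ¬ Seg z := fun ⟨j, hj, e⟩ => hz j hj e
    have hz2 : ¬ Seg z' := fun ⟨j, hj, e⟩ => hz' j hj e
    constructor
    · intro h
      have h1 := sameCycle_induction (⊥ : Setoid _) lab (fun z => (hlinv z).symm) h
      change lab (oldDart z) = lab (oldDart z') at h1
      rw [hlold, hlold, if_neg hz1, if_neg hz2, Option.some.injEq] at h1
      exact (orbSetoid_singleton _ _ _).1 (Quotient.exact h1)
    · intro h
      -- Following an old face, the stretch cut off is collapsed to the dart `p`, which replaces it
      -- in the new face.
      have h1 := sameCycle_induction (orbSetoid {φ'})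
        (fun z => if Seg z then p else oldDart z) (fun z => ?_) h
      · rw [if_neg hz1, if_neg hz2] at h1
        exact (orbSetoid_singleton _ _ _).1 h1
      · have hm : ∀ z, orbSetoid {φ'} z (φ' z) := fun z =>
          orbSetoid_of_mem (Set.mem_singleton _) z
        change orbSetoid {φ'} (if Seg z then p else oldDart z) (if Seg (φ z) then p else oldDart (φ z))
        by_cases hs : Seg z
        · rw [if_pos hs]
          rcases hsucc z hs with h | ⟨h1, h2⟩
          · rw [h, if_neg hsy, ← hφp]; exact hm p
          · rw [if_pos h1]
        · rw [if_neg hs]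
          obtain ⟨h1, h2⟩ := hpred z hs
          have h3 := hm (oldDart z)
          rw [hφold] at h3
          by_cases h4 : φ z = x
          · rw [if_pos h4] at h3
            rwa [h4, if_pos hsx]
          · rw [if_neg h4, if_neg h1] at h3
            rwa [if_neg (h2.resolve_left h4)]

end AddArcs

end DiMultigraph
end

noncomputable section
open scoped Classical
namespace DiMultigraph

/-! ### Pendant arcs keep the faces -/

section Pendants

variable (D : DiMultigraph.{u})

/-- `D` with pendant vertices `P`, each joined to its base by one arc; `p` is a source if `dir p` is
true and a sink otherwise. -/
@[reducible] def withPendants (P : Type u) [Fintype P] (base : P → D.V) (dir : P → Bool) :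
    DiMultigraph.{u} where
  V := D.V ⊕ P
  A := D.A ⊕ P
  tail := Sum.elim (fun a => Sum.inl (D.tail a))
    (fun p => if dir p then Sum.inr p else Sum.inl (base p))
  head := Sum.elim (fun a => Sum.inl (D.head a))
    (fun p => if dir p then Sum.inl (base p) else Sum.inr p)
  tail_ne_head := by
    rintro (a | p)
    · simpa using D.tail_ne_head a
    · cases h : dir p <;> simp [h]

variable {D}

/-- The near end of the new arc is put just before `x` and its far end is alone at its vertex. The
face through this corner makes a detour along both sides of the arc, and no other face changes. -/
theorem insert_pendant {k : ℕ} (h : D.HasFaces k) (x : D.Dart) (dir : Bool) :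
    (D.withPendants PUnit (fun _ => D.dartVertex x) (fun _ => dir)).HasFaces k := by
  obtain ⟨σ, hσ, hk⟩ := h
  set φ := σ * D.dartFlip with hφ
  set D' := D.withPendants PUnit (fun _ => D.dartVertex x) (fun _ => dir) with hD'
  set p : D'.Dart := (Sum.inr PUnit.unit, dir) with hp
  set q : D'.Dart := (Sum.inr PUnit.unit, !dir) with hq
  have hinj : Function.Injective (oldDart : D.Dart → D'.Dart) := by
    rintro ⟨a, b⟩ ⟨a', b'⟩ h
    simpa [oldDart] using h
  have hnp : ∀ z : D.Dart, (oldDart z : D'.Dart) ≠ p := fun z h => by simp [oldDart, hp] at h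
  have hnq : ∀ z : D.Dart, (oldDart z : D'.Dart) ≠ q := fun z h => by simp [oldDart, hq] at h
  have hpq : p ≠ q := by simp [hp, hq]
  have hcases : ∀ z : D'.Dart, z = p ∨ z = q ∨ ∃ z₀ : D.Dart, z = oldDart z₀ := by
    rintro ⟨a | ⟨⟩, b⟩
    · exact Or.inr (Or.inr ⟨(a, b), rfl⟩)
    · by_cases hb : b = dir
      · exact Or.inl (by rw [hb])
      · exact Or.inr (Or.inl (by rw [Bool.eq_not_of_ne hb]))
  set f : D'.Dart → D'.Dart := fun z => match z with
    | (Sum.inl a, b) => if σ (a, b) = x then p else oldDart (σ (a, b))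
    | (Sum.inr _, b) => if b = dir then oldDart x else q with hf
  have hfold : ∀ z : D.Dart, f (oldDart z) = if σ z = x then p else oldDart (σ z) :=
    fun z => rfl
  have hfp : f p = oldDart x := if_pos rfl
  have hfq : f q = q := if_neg (by simp)
  have hfinj : Function.Injective f := by
    intro z z' hzz
    rcases hcases z with rfl | rfl | ⟨z, rfl⟩ <;> rcases hcases z' with rfl | rfl | ⟨z', rfl⟩
    · rfl
    · rw [hfp, hfq] at hzz; exact (hnq _ hzz).elim
    · rw [hfp, hfold] at hzz
      split_ifs at hzz with h1
      · exact (hnp _ hzz).elim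
      · exact (h1 (hinj hzz).symm).elim
    · rw [hfp, hfq] at hzz; exact (hnq _ hzz.symm).elim
    · rfl
    · rw [hfq, hfold] at hzz
      split_ifs at hzz with h1
      · exact (hpq hzz.symm).elim
      · exact (hnq _ hzz.symm).elim
    · rw [hfp, hfold] at hzz
      split_ifs at hzz with h1
      · exact (hnp _ hzz.symm).elim
      · exact (h1 (hinj hzz)).elim
    · rw [hfq, hfold] at hzz
      split_ifs at hzz with h1
      · exact (hpq hzz).elim
      · exact (hnq _ hzz).elim
    · rw [hfold, hfold] at hzz
      congr 1
      apply σ.injective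
      split_ifs at hzz with h1 h2 h3
      · rw [h1, h2]
      · exact (hnp _ hzz.symm).elim
      · exact (hnp _ hzz).elim
      · exact hinj hzz
  obtain ⟨σ', hσ'⟩ := exists_perm_of_injective f hfinj
  have hvold : ∀ z : D.Dart, D'.dartVertex (oldDart z) = Sum.inl (D.dartVertex z) := by
    rintro ⟨a, _ | _⟩ <;> rfl
  have hvp : D'.dartVertex p = Sum.inl (D.dartVertex x) := by
    cases dir <;> rfl
  have hvq : D'.dartVertex q = Sum.inr PUnit.unit := by
    cases dir <;> rfl
  have hmem : ∀ z, orbSetoid {σ'} z (f z) := fun z => by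
    have := orbSetoid_of_mem (S := {σ'}) (Set.mem_singleton _) z
    rwa [hσ'] at this
  have hstep : ∀ z : D.Dart, orbSetoid {σ'} (oldDart z) (oldDart (σ z)) := by
    intro z
    have h1 := hmem (oldDart z)
    rw [hfold] at h1
    split_ifs at h1 with h2
    · have h3 := hmem p
      rw [hfp] at h3
      rw [h2]; exact Setoid.trans' _ h1 h3
    · exact h1
  refine ⟨σ', fun z z' => ⟨fun h => ?_, fun h => ?_⟩, ?_⟩
  · refine sameCycle_induction (⊥ : Setoid D'.V) D'.dartVertex (fun z => ?_) h
    rw [hσ']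
    change D'.dartVertex z = D'.dartVertex (f z)
    rcases hcases z with rfl | rfl | ⟨z, rfl⟩
    · rw [hfp, hvold, hvp]
    · rw [hfq]
    · rw [hfold, hvold, ← hσ.dartVertex_apply z]
      split_ifs with h1
      · rw [h1, hvp]
      · rw [hvold]
  · have hrep : ∀ z : D'.Dart, z = q ∨ ∃ z₀ : D.Dart,
        D'.dartVertex z = Sum.inl (D.dartVertex z₀) ∧ orbSetoid {σ'} z (oldDart z₀) := by
      intro z
      rcases hcases z with rfl | rfl | ⟨z, rfl⟩
      · exact Or.inr ⟨x, hvp, by have := hmem p; rwa [hfp] at this⟩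
      · exact Or.inl rfl
      · exact Or.inr ⟨z, hvold z, Setoid.refl' _ _⟩
    rcases hrep z with rfl | ⟨z₀, h1, h2⟩ <;> rcases hrep z' with rfl | ⟨z₁, h3, h4⟩
    · exact Equiv.Perm.SameCycle.refl _ _
    · rw [hvq, h3] at h; cases h
    · rw [hvq, h1] at h; cases h
    · rw [h1, h3, Sum.inl.injEq, ← hσ] at h
      exact (orbSetoid_singleton _ _ _).1 (Setoid.trans' _ h2 (Setoid.trans' _
        (sameCycle_induction (orbSetoid {σ'}) oldDart hstep h) (Setoid.symm' _ h4)))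
  · refine hk.trans ?_
    have hqφ : ∀ z, (Quotient.mk _ (φ z) : Quotient (orbSetoid {φ})) = Quotient.mk _ z := fun z =>
      Quotient.sound (Setoid.symm' _ (orbSetoid_of_mem (Set.mem_singleton _) z))
    rw [numOrbits_eq {φ}]
    refine le_numOrbits_of_invariant (fun z : D'.Dart => match z with
      | (Sum.inl a, b) => Quotient.mk (orbSetoid {φ}) (a, b)
      | (Sum.inr _, _) => Quotient.mk _ x) (fun z => ?_) fun l => ?_
    · rw [Equiv.Perm.mul_apply, dartFlip_apply, hσ']
      rcases hcases z with rfl | rfl | ⟨z, rfl⟩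
      · change (match f q with
          | (Sum.inl a, b) => Quotient.mk (orbSetoid {φ}) (a, b)
          | (Sum.inr _, _) => Quotient.mk _ x) = _
        rw [hfq]
      · have : ((q.1, !q.2) : D'.Dart) = p := by simp [hp, hq]
        rw [this, hfp]
        rfl
      · change (match (if φ z = x then p else oldDart (φ z) : D'.Dart) with
          | (Sum.inl a, b) => Quotient.mk (orbSetoid {φ}) (a, b)
          | (Sum.inr _, _) => Quotient.mk _ x) = Quotient.mk _ z
        rw [← hqφ z]
        split_ifs with h1
        · rw [h1]
        · rfl
    · induction l using Quotient.inductionOn with | h z => ?_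
      exact ⟨oldDart z, rfl⟩

theorem HasFaces.withPendants {k : ℕ} (h : D.HasFaces k) (P : Type u) [Fintype P] :
    ∀ (base : P → D.V) (dir : P → Bool), (∀ p, ∃ x, D.dartVertex x = base p) →
      (D.withPendants P base dir).HasFaces k := by
  refine Fintype.induction_empty_option
    (P := fun P _ => ∀ (base : P → D.V) (dir : P → Bool), (∀ p, ∃ x, D.dartVertex x = base p) →
      (D.withPendants P base dir).HasFaces k) ?_ ?_ ?_ P
  · intro P Q _ e ih base dir hb
    let _ : Fintype P := Fintype.ofEquiv Q e.symm
    refine (ih (base ∘ e) (dir ∘ e) fun p => hb (e p)).of_equiv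
      (Equiv.sumCongr (Equiv.refl _) e) (Equiv.sumCongr (Equiv.refl _) e) ?_ ?_
    · rintro (a | p)
      · rfl
      · cases hd : dir (e p) <;> simp [hd]
    · rintro (a | p)
      · rfl
      · cases hd : dir (e p) <;> simp [hd]
  · intro base dir _
    refine h.of_equiv (Equiv.sumEmpty _ _).symm (Equiv.sumEmpty _ _).symm ?_ ?_ <;>
      intro a <;> rfl
  · intro P _ ih base dir hb
    have h1 := ih (base ∘ some) (dir ∘ some) fun p => hb (some p)
    obtain ⟨x, hx⟩ := hb none
    have h2 := insert_pendant h1 (oldDart x) (dir none)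
    have hv : (D.withPendants P (base ∘ some) (dir ∘ some)).dartVertex (oldDart x) =
        Sum.inl (base none) := by
      rw [← hx]; rcases x with ⟨a, _ | _⟩ <;> rfl
    rw [hv] at h2
    set e : ∀ Y : Type u, (Y ⊕ P) ⊕ PUnit.{u + 1} ≃ Y ⊕ Option P := fun Y =>
      (Equiv.sumAssoc Y P PUnit).trans (Equiv.sumCongr (Equiv.refl _) (Equiv.optionEquivSumPUnit P).symm)
    refine h2.of_equiv (e D.V) (e D.A) ?_ ?_
    · rintro ((a | p) | ⟨⟩)
      · rfl
      · cases hd : dir (some p) <;> simp [e, hd]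
      · cases hd : dir none <;> simp [e, hd]
    · rintro ((a | p) | ⟨⟩)
      · rfl
      · cases hd : dir (some p) <;> simp [e, hd]
      · cases hd : dir none <;> simp [e, hd]

end Pendants

/-! ### Parallel arcs add one face each -/

section Parallel

variable {D : DiMultigraph.{u}}

/-- The dart after the tail end of `a` is the image of the head end of `a` under the face
permutation. Both therefore lie in one face, at the two ends of `a`, and an arc drawn between these
corners splits that face. -/
theorem insert_parallel {k : ℕ} (h : D.HasFaces k) (a : D.A) :
    (D.withArcs PUnit (fun _ => D.tail a) (fun _ => D.head a)
      (fun _ => D.tail_ne_head a)).HasFaces (k + 1) := by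
  obtain ⟨σ, hσ, hk⟩ := h
  have hv : D.dartVertex (σ (a, false)) = D.tail a := hσ.dartVertex_apply _
  have hcyc : (σ * D.dartFlip).SameCycle (σ (a, false)) (a, true) := by
    have h1 : (σ * D.dartFlip) (a, true) = σ (a, false) := by
      rw [Equiv.Perm.mul_apply, dartFlip_apply]; rfl
    rw [← h1]
    exact (Equiv.Perm.sameCycle_apply_right.2 (Equiv.Perm.SameCycle.refl _ _)).symm
  have hex : ∃ k, ((σ * D.dartFlip) ^ k) (σ (a, false)) = (a, true) := by
    obtain ⟨i, _, hi⟩ := hcyc.exists_pow_eq'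
    exact ⟨i, hi⟩
  have hne : D.dartVertex (σ (a, false)) ≠ D.dartVertex (a, true) := by
    rw [hv]; exact D.tail_ne_head a
  obtain ⟨σ', h1, h2, _⟩ := insert_arc hσ hne (Nat.find_spec hex) fun j hj => Nat.find_min hex hj
  refine HasFaces.of_equiv (D := D.withArcs PUnit _ _ fun _ => hne) ⟨σ', h1, ?_⟩
    (Equiv.refl _) (Equiv.refl _) ?_ ?_
  · omega
  · rintro (a | ⟨⟩)
    · rfl
    · exact hv.symm
  · rintro (a | ⟨⟩) <;> rfl

theorem HasFaces.withParallel {k : ℕ} (h : D.HasFaces k) (K : Type u) [Fintype K] :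
    ∀ c : K → D.A, (D.withArcs K (fun i => D.tail (c i)) (fun i => D.head (c i))
      (fun i => D.tail_ne_head (c i))).HasFaces (k + Fintype.card K) := by
  refine Fintype.induction_empty_option
    (P := fun K _ => ∀ c : K → D.A, (D.withArcs K (fun i => D.tail (c i)) (fun i => D.head (c i))
      (fun i => D.tail_ne_head (c i))).HasFaces (k + Fintype.card K)) ?_ ?_ ?_ K
  · intro P Q _ e ih c
    let _ : Fintype P := Fintype.ofEquiv Q e.symm
    rw [← Fintype.card_congr e]
    refine (ih (c ∘ e)).of_equiv (Equiv.refl _) (Equiv.sumCongr (Equiv.refl _) e) ?_ ?_ <;>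
      rintro (a | p) <;> rfl
  · intro c
    refine h.of_equiv (Equiv.refl _) (Equiv.sumEmpty _ _).symm ?_ ?_ <;> intro a <;> rfl
  · intro K _ ih c
    have h2 := insert_parallel (ih (c ∘ some)) (Sum.inl (c none))
    rw [Fintype.card_option, ← add_assoc]
    refine h2.of_equiv (Equiv.refl _) ((Equiv.sumAssoc _ _ _).trans
      (Equiv.sumCongr (Equiv.refl _) (Equiv.optionEquivSumPUnit K).symm)) ?_ ?_ <;>
      rintro ((a | p) | ⟨⟩) <;> rfl

end Parallel

/-! ### Noncrossing matchings inside faces -/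

section Noncrossing

/-- Removing one element from a finite set of darts, after insertion of an arc. -/
theorem exists_erase_equiv {D : DiMultigraph.{u}} {K : Type u} {S : Finset D.Dart} {x : D.Dart}
    (hx : x ∈ S) {S' : Finset ((D.A ⊕ K) × Bool)}
    (hS' : ∀ s, s ∈ S' ↔ ∃ z ∈ S.erase x, oldDart z = s) :
    ∃ e : S ≃ PUnit.{u + 1} ⊕ S',
      e ⟨x, hx⟩ = Sum.inl PUnit.unit ∧
      ∀ z s, e z = Sum.inr s → s.1 = oldDart z.1 := by
  have hinj : Function.Injective (oldDart (D := D) (K := K)) := by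
    rintro ⟨a, b⟩ ⟨a', b'⟩ h
    simpa [oldDart] using h
  set f : S → PUnit.{u + 1} ⊕ S' := fun z =>
    if h : z.1 = x then Sum.inl PUnit.unit
    else Sum.inr ⟨oldDart z.1, (hS' _).2 ⟨z.1, Finset.mem_erase.2 ⟨h, z.2⟩, rfl⟩⟩ with hf
  have hbij : Function.Bijective f := by
    constructor
    · rintro ⟨z, hz⟩ ⟨z', hz'⟩ h
      simp only [hf] at h
      split_ifs at h with h1 h2 h2
      · exact Subtype.ext (h1.trans h2.symm)
      · simp only [Sum.inr.injEq, Subtype.mk.injEq] at h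
        exact Subtype.ext (hinj h)
    · rintro (⟨⟩ | ⟨s, hs⟩)
      · exact ⟨⟨x, hx⟩, by simp [hf]⟩
      · obtain ⟨z, hz, rfl⟩ := (hS' _).1 hs
        obtain ⟨h1, h2⟩ := Finset.mem_erase.1 hz
        exact ⟨⟨z, h2⟩, by simp [hf, h1]⟩
  refine ⟨Equiv.ofBijective f hbij, by simp [hf], fun z s hs => ?_⟩
  simp only [Equiv.ofBijective_apply, hf] at hs
  split_ifs at hs with h
  simp only [Sum.inr.injEq] at hs
  rw [← hs]

/-- Corners of two kinds, equally many of each kind in every face, can be matched within the faces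
by noncrossing arcs. -/
theorem exists_noncrossing (n : ℕ) : ∀ {D : DiMultigraph.{u}} {σ : Equiv.Perm D.Dart},
    IsRotation σ → ∀ S T : Finset D.Dart, S.card = n → T.card = n →
    (∀ x ∈ S, ∀ y ∈ T, D.dartVertex x ≠ D.dartVertex y) →
    (∀ z ∈ S, (S.filter ((σ * D.dartFlip).SameCycle z)).card =
      (T.filter ((σ * D.dartFlip).SameCycle z)).card) →
    ∃ (μ : S ≃ T) (hne : ∀ x : S, D.dartVertex x.1 ≠ D.dartVertex (μ x).1),
      (∀ x, (σ * D.dartFlip).SameCycle x.1 (μ x).1) ∧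
      (D.withArcs S (fun x => D.dartVertex x.1) (fun x => D.dartVertex (μ x).1) hne).HasFaces
        (numOrbits {σ * D.dartFlip} + n) := by
  induction n with
  | zero =>
    intro D σ hσ S T hS hT _ _
    rw [Finset.card_eq_zero] at hS hT
    subst hS hT
    refine ⟨Equiv.equivOfIsEmpty _ _, isEmptyElim, isEmptyElim, ?_⟩
    exact HasFaces.of_equiv (D := D) ⟨σ, hσ, le_rfl⟩ (Equiv.refl _) (Equiv.sumEmpty _ _).symm
      (fun _ => rfl) (fun _ => rfl)
  | succ n ih =>
    intro D σ hσ S T hS hT hne hbal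
    set φ := σ * D.dartFlip with hφ
    -- Choose `x ∈ S` and `y ∈ T` in a common face with the fewest steps from `x` to `y`. The new
    -- arc then cuts off a stretch that contains no other corner to be matched.
    have hex : ∃ k, ∃ x ∈ S, ∃ y ∈ T, (φ ^ k) x = y := by
      obtain ⟨x, hx⟩ := Finset.card_pos.1 (by omega : 0 < S.card)
      have h1 : 0 < (T.filter (φ.SameCycle x)).card := by
        rw [← hbal x hx]
        exact Finset.card_pos.2 ⟨x, Finset.mem_filter.2 ⟨hx, Equiv.Perm.SameCycle.refl _ _⟩⟩
      obtain ⟨y, hy⟩ := Finset.card_pos.1 h1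
      obtain ⟨hy, hxy⟩ := Finset.mem_filter.1 hy
      obtain ⟨i, _, hi⟩ := hxy.exists_pow_eq'
      exact ⟨i, x, hx, y, hy, hi⟩
    obtain ⟨x, hx, y, hy, hk⟩ := Nat.find_spec hex
    set k := Nat.find hex with hkdef
    have hmin : ∀ j < k, ∀ z ∈ T, (φ ^ j) x ≠ z := fun j hj z hz h =>
      Nat.find_min hex hj ⟨x, hx, z, hz, h⟩
    -- A corner of `S` strictly inside the stretch would be closer to `y`.
    have hminS : ∀ j < k, ∀ z ∈ S, z ≠ x → (φ ^ j) x ≠ z := by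
      intro j hj z hz hzx h
      have hj0 : j ≠ 0 := fun h0 => hzx (by rw [← h, h0]; rfl)
      refine Nat.find_min hex (m := k - j) (by omega) ⟨z, hz, y, hy, ?_⟩
      rw [← h, ← Equiv.Perm.mul_apply, ← pow_add, Nat.sub_add_cancel hj.le, hk]
    have hxy : φ.SameCycle x y := ⟨k, by rw [zpow_natCast, hk]⟩
    set D' := D.withArcs PUnit (fun _ => D.dartVertex x) (fun _ => D.dartVertex y)
      (fun _ => hne x hx y hy) with hD'
    obtain ⟨σ', hσ', hfaces, hsame⟩ :=
      insert_arc hσ (hne x hx y hy) hk fun j hj => hmin j hj y hy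
    set φ' := σ' * D'.dartFlip with hφ'
    have hinj : Function.Injective (oldDart : D.Dart → D'.Dart) := by
      rintro ⟨a, b⟩ ⟨a', b'⟩ h
      simpa [oldDart] using h
    have hvold : ∀ z : D.Dart, D'.dartVertex (oldDart z) = D.dartVertex z := by
      rintro ⟨a, _ | _⟩ <;> rfl
    set S' : Finset D'.Dart := (S.erase x).image oldDart with hS'
    set T' : Finset D'.Dart := (T.erase y).image oldDart with hT'
    have hsegS : ∀ z ∈ S.erase x, ∀ j < k, (φ ^ j) x ≠ z := fun z hz j hj =>
      hminS j hj z (Finset.mem_of_mem_erase hz) (Finset.ne_of_mem_erase hz)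
    have hsegT : ∀ z ∈ T.erase y, ∀ j < k, (φ ^ j) x ≠ z := fun z hz j hj =>
      hmin j hj z (Finset.mem_of_mem_erase hz)
    -- The remaining corners avoid the stretch, so they share a face after the insertion exactly if
    -- they did before. The face of `x` and `y` loses one corner of each kind, and balance persists.
    have hcount : ∀ (R : Finset D.Dart) (r : D.Dart), r ∈ R →
        (∀ z ∈ R.erase r, ∀ j < k, (φ ^ j) x ≠ z) → ∀ z, (∀ j < k, (φ ^ j) x ≠ z) →
        (((R.erase r).image oldDart).filter (φ'.SameCycle (oldDart z))).card +
          (if φ.SameCycle z r then 1 else 0) = (R.filter (φ.SameCycle z)).card := by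
      intro R r hr hR z hz
      rw [Finset.filter_image, Finset.card_image_of_injective _ hinj]
      have h1 : (R.erase r).filter (fun a => φ'.SameCycle (oldDart z) (oldDart a)) =
          (R.filter (φ.SameCycle z)).erase r := by
        ext a
        simp only [Finset.mem_filter, Finset.mem_erase]
        constructor
        · rintro ⟨⟨h1, h2⟩, h3⟩
          exact ⟨h1, h2, (hsame z a hz (hR a (Finset.mem_erase.2 ⟨h1, h2⟩))).1 h3⟩
        · rintro ⟨h1, h2, h3⟩
          exact ⟨⟨h1, h2⟩, (hsame z a hz (hR a (Finset.mem_erase.2 ⟨h1, h2⟩))).2 h3⟩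
      rw [h1]
      split_ifs with h2
      · exact Finset.card_erase_add_one (Finset.mem_filter.2 ⟨hr, h2⟩)
      · rw [Finset.erase_eq_of_notMem (fun h => h2 (Finset.mem_filter.1 h).2), add_zero]
    obtain ⟨μ', hne', hμ', hfaces'⟩ := ih hσ' S' T'
      (by rw [hS', Finset.card_image_of_injective _ hinj, Finset.card_erase_of_mem hx, hS]; rfl)
      (by rw [hT', Finset.card_image_of_injective _ hinj, Finset.card_erase_of_mem hy, hT]; rfl)
      (by
        intro a ha b hb
        obtain ⟨a', ha', rfl⟩ := Finset.mem_image.1 ha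
        obtain ⟨b', hb', rfl⟩ := Finset.mem_image.1 hb
        rw [hvold, hvold]
        exact hne a' (Finset.mem_of_mem_erase ha') b' (Finset.mem_of_mem_erase hb'))
      (by
        intro z hz
        obtain ⟨z, hz', rfl⟩ := Finset.mem_image.1 hz
        have h1 := hcount S x hx hsegS z (hsegS z hz')
        have h2 := hcount T y hy hsegT z (hsegS z hz')
        have h3 := hbal z (Finset.mem_of_mem_erase hz')
        have h4 : φ.SameCycle z x ↔ φ.SameCycle z y :=
          ⟨fun h => h.trans hxy, fun h => h.trans hxy.symm⟩
        simp only [h4] at h1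
        rw [← hS'] at h1
        rw [← hT'] at h2
        have h5 : (S'.filter (φ'.SameCycle (oldDart z))).card =
          (T'.filter (φ'.SameCycle (oldDart z))).card := by omega
        convert h5)
    obtain ⟨eS, heSx, heS⟩ := exists_erase_equiv (K := PUnit.{u + 1}) hx
      (S' := S') (fun s => by rw [hS', Finset.mem_image])
    obtain ⟨eT, heTy, heT⟩ := exists_erase_equiv (K := PUnit.{u + 1}) hy
      (S' := T') (fun s => by rw [hT', Finset.mem_image])
    set μ : S ≃ T := eS.trans ((Equiv.sumCongr (Equiv.refl _) μ').trans eT.symm) with hμ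
    have hμspec : ∀ z : S, (z.1 = x ∧ (μ z).1 = y) ∨ (∃ s, eS z = Sum.inr s ∧
        s.1 = oldDart z.1 ∧ (μ' s).1 = oldDart (μ z).1) := by
      intro z
      rcases hz : eS z with ⟨⟩ | s
      · left
        have h1 : z = ⟨x, hx⟩ := eS.injective (by rw [hz, heSx])
        refine ⟨by rw [h1], ?_⟩
        have h2 : μ z = ⟨y, hy⟩ := by
          rw [hμ, Equiv.trans_apply, Equiv.trans_apply, hz, Equiv.symm_apply_eq, heTy]; rfl
        rw [h2]
      · right
        refine ⟨s, rfl, heS z s hz, heT (μ z) (μ' s) ?_⟩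
        rw [hμ, Equiv.trans_apply, Equiv.trans_apply, hz, Equiv.apply_symm_apply]; rfl
    have hneμ : ∀ z : S, D.dartVertex z.1 ≠ D.dartVertex (μ z).1 := fun z =>
      hne z.1 z.2 (μ z).1 (μ z).2
    refine ⟨μ, hneμ, fun z => ?_, ?_⟩
    · rcases hμspec z with ⟨h1, h2⟩ | ⟨s, h0, h1, h2⟩
      · rw [h1, h2]; exact hxy
      · have h3 := hμ' s
        rw [h1, h2] at h3
        have hz : z.1 ∈ S.erase x := by
          obtain ⟨r, hr, hr'⟩ := Finset.mem_image.1 s.2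
          rw [h1] at hr'
          rwa [← hinj hr']
        have hz' : (μ z).1 ∈ T.erase y := by
          obtain ⟨r, hr, hr'⟩ := Finset.mem_image.1 (μ' s).2
          rw [h2] at hr'
          rwa [← hinj hr']
        exact (hsame _ _ (hsegS _ hz) (hsegT _ hz')).1 h3
    · obtain ⟨σ'', hr, hle⟩ := hfaces'
      have hcard : numOrbits {φ} + (n + 1) ≤ numOrbits {φ'} + n := by
        rw [← add_assoc, add_right_comm]
        exact Nat.add_le_add_right hfaces n
      refine HasFaces.of_equiv (D := D'.withArcs S' _ _ hne') ⟨σ'', hr, hcard.trans hle⟩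
        (Equiv.refl _)
        ((Equiv.sumAssoc _ _ _).trans (Equiv.sumCongr (Equiv.refl _) eS.symm)) ?_ ?_
      · rintro ((a | ⟨⟩) | s)
        · rfl
        · change D.dartVertex (eS.symm (Sum.inl PUnit.unit)).1 = D.dartVertex x
          rw [← heSx, Equiv.symm_apply_apply]
        · change D.dartVertex (eS.symm (Sum.inr s)).1 = D'.dartVertex s.1
          rw [heS (eS.symm (Sum.inr s)) s (Equiv.apply_symm_apply _ _), hvold]
      · rintro ((a | ⟨⟩) | s)
        · rfl
        · change D.dartVertex (μ (eS.symm (Sum.inl PUnit.unit))).1 = D.dartVertex y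
          rcases hμspec (eS.symm (Sum.inl PUnit.unit)) with ⟨_, h⟩ | ⟨s, h, _⟩
          · rw [h]
          · rw [Equiv.apply_symm_apply] at h; cases h
        · change D.dartVertex (μ (eS.symm (Sum.inr s))).1 = D'.dartVertex (μ' s).1
          rcases hμspec (eS.symm (Sum.inr s)) with ⟨h, _⟩ | ⟨s', h, _, h2⟩
          · exfalso
            have h3 : eS.symm (Sum.inr s) = ⟨x, hx⟩ := Subtype.ext h
            rw [Equiv.symm_apply_eq, heSx] at h3
            cases h3
          · rw [Equiv.apply_symm_apply, Sum.inr.injEq] at h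
            subst h
            have h3 := congrArg D'.dartVertex h2
            rw [hvold] at h3
            exact h3.symm

end Noncrossing

end DiMultigraph
end

/-! ### Minimal sets, contractions and products of clutters -/

noncomputable section
open scoped Classical

/-- A subfamily that reaches below every member has the same minimal members. Contraction minors are
rewritten with it, since removing `X` from members gives such a subfamily. -/
theorem minimal_iff_of_cofinal {α : Type*} [PartialOrder α] {P Q : α → Prop}
    (h1 : ∀ S, Q S → P S) (h2 : ∀ S, P S → ∃ T ≤ S, Q T) (S : α) : Minimal Q S ↔ Minimal P S := by
  constructor
  · intro h
    refine ⟨h1 S h.prop, fun T hT hle => ?_⟩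
    obtain ⟨R, hR, hQ⟩ := h2 T hT
    exact (h.le_of_le hQ (hR.trans hle)).trans hR
  · intro h
    obtain ⟨T, hT, hQ⟩ := h2 S h.prop
    have : S = T := le_antisymm (h.le_of_le (h1 T hQ) hT) hT
    exact ⟨this ▸ hQ, fun R hR hle => h.le_of_le (h1 R hR) hle⟩

namespace Clutter

theorem ext_members {E : Type u} {C C' : Clutter E} (h : ∀ S, S ∈ C.members ↔ S ∈ C'.members) :
    C = C' := by
  cases C; cases C'; congr; ext S; exact h S

theorem mem_ofMinimal {E : Type u} {P : Finset E → Prop} {S : Finset E} :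
    S ∈ (ofMinimal P).members ↔ Minimal P S := Iff.rfl

/-- For a monotone property, contracting `X` amounts to granting all of `X` for free. -/
theorem mem_contract_iff {E : Type u} [Finite E] [d : DecidableEq E] {C : Clutter E} {P : Finset E → Prop}
    (hP : ∀ S T, S ⊆ T → P S → P T) (hC : ∀ S, S ∈ C.members ↔ Minimal P S) (X : Finset E)
    (S : Finset {x // x ∉ X}) : S ∈ (C.contract X).members ↔
      Minimal (fun S : Finset {x // x ∉ X} => P (S.map (Function.Embedding.subtype _) ∪ X)) S := by
  obtain rfl : d = fun a b => Classical.propDecidable (a = b) := Subsingleton.elim _ _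
  rw [contract, mem_ofMinimal]
  refine minimal_iff_of_cofinal (fun S => ?_) (fun S hS => ?_) S
  · rintro ⟨M, hM, rfl⟩
    refine hP M _ (fun x hx => ?_) ((hC M).1 hM).prop
    by_cases h : x ∈ X
    · exact Finset.mem_union_right _ h
    · refine Finset.mem_union_left _ ?_
      exact Finset.mem_map.2 ⟨⟨x, h⟩, (Finset.mem_subtype (a := ⟨x, h⟩)).2 hx, rfl⟩
  · obtain ⟨M, hM, hmin⟩ := (Set.toFinite {T | P T}).exists_le_minimal hS
    refine ⟨_, fun x hx => ?_, M, (hC M).2 hmin, rfl⟩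
    have h1 := hM ((Finset.mem_subtype (a := x)).1 hx)
    rcases Finset.mem_union.1 h1 with h | h
    · obtain ⟨y, hy, hyx⟩ := Finset.mem_map.1 h
      rwa [← Subtype.ext (a1 := y) (a2 := x) hyx]
    · exact (x.2 h).elim

/-- The component of a set in a disjoint union indexed by `Fin 1`. -/
def fiberZero {E : Fin 1 → Type u} (S : Finset (Σ i, E i)) : Finset (E 0) :=
  S.preimage (Sigma.mk 0) sigma_mk_injective.injOn

theorem sigma_fiberZero {E : Fin 1 → Type u} (S : Finset (Σ i, E i)) :
    (Finset.univ.sigma fun i => (Subsingleton.elim 0 i ▸ fiberZero S : Finset (E i))) = S := by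
  ext ⟨i, x⟩
  obtain rfl : i = 0 := Subsingleton.elim _ _
  simp [fiberZero]

/-- With one factor, passing to minimal sets changes nothing, because the factor is already an
antichain. -/
theorem mem_prod_one_iff {E : Fin 1 → Type u} (C : ∀ i, Clutter (E i)) (S : Finset (Σ i, E i)) :
    S ∈ (Clutter.prod C).members ↔ fiberZero S ∈ (C 0).members := by
  have key : ∀ S : Finset (Σ i, E i), (∃ M : ∀ i, Finset (E i), (∀ i, M i ∈ (C i).members) ∧
      S = Finset.univ.sigma M) ↔ fiberZero S ∈ (C 0).members := by
    intro S
    constructor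
    · rintro ⟨M, hM, rfl⟩
      have : fiberZero (Finset.univ.sigma M) = M 0 := by ext x; simp [fiberZero]
      rw [this]; exact hM 0
    · intro h
      refine ⟨fun i => (Subsingleton.elim 0 i ▸ fiberZero S : Finset (E i)), fun i => ?_,
        (sigma_fiberZero S).symm⟩
      obtain rfl : i = 0 := Subsingleton.elim _ _
      exact h
  rw [prod, mem_ofMinimal]
  constructor
  · intro h
    exact (key S).1 h.1
  · intro h
    refine ⟨(key S).2 h, fun T hT hle => ?_⟩
    have h1 := (key T).1 hT
    have hsub : fiberZero T ⊆ fiberZero S := fun x hx => by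
      simp only [fiberZero, Finset.mem_preimage] at hx ⊢
      exact hle hx
    have h2 : fiberZero T = fiberZero S := by
      by_contra hne
      exact (C 0).antichain h1 h hne hsub
    rw [← sigma_fiberZero T, h2, sigma_fiberZero S]

end Clutter

namespace DiMultigraph

/-! ### Refinements of weighted digraphs and what they transfer -/

section CutLift

variable {D D' D'' : DiMultigraph.{u}}

/-- The arcs of `D'` lying over `B`. -/
def liftArcs (g : D'.A → Option D.A) (B : Finset D.A) : Finset D'.A :=
  Finset.univ.filter fun a' => ∃ a ∈ B, g a' = some a

theorem mem_liftArcs {g : D'.A → Option D.A} {B : Finset D.A} {a' : D'.A} :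
    a' ∈ liftArcs g B ↔ ∃ a ∈ B, g a' = some a := by
  simp [liftArcs]

/-- The weighted digraph `(D', w')` refines `(D, w)`: the partial map `g` sends arcs of `D'` onto arcs
of `D`, weights are summed along the fibres, and the dicuts of `D` correspond to the dicuts of `D'`
all whose arcs of positive weight lie in the domain of `g`. -/
structure CutLift (w : D.A → ℕ) (w' : D'.A → ℕ) (g : D'.A → Option D.A) : Prop where
  weight_eq : ∀ a, ∑ a' with g a' = some a, w' a' = w a
  surj : ∀ a, ∃ a', g a' = some a
  lift : ∀ B, D.IsDicut B → D'.IsDicut (liftArcs g B)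
  desc : ∀ B', D'.IsDicut B' → (∀ a' ∈ B', 0 < w' a' → g a' ≠ none) →
    ∃ B, D.IsDicut B ∧ B' = liftArcs g B

variable {w : D.A → ℕ} {w' : D'.A → ℕ} {w'' : D''.A → ℕ} {g : D'.A → Option D.A}
  {h : D''.A → Option D'.A}

theorem CutLift.trans (hg : CutLift w w' g) (hh : CutLift w' w'' h) :
    CutLift w w'' fun a => (h a).bind g := by
  have hlift : ∀ B, liftArcs (fun a => (h a).bind g) B = liftArcs h (liftArcs g B) := by
    intro B
    ext a
    simp only [mem_liftArcs, Option.bind_eq_some_iff]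
    constructor
    · rintro ⟨b, hb, c, h1, h2⟩
      exact ⟨c, ⟨b, hb, h2⟩, h1⟩
    · rintro ⟨c, ⟨b, hb, h2⟩, h1⟩
      exact ⟨b, hb, c, h1, h2⟩
  refine ⟨fun a => ?_, fun a => ?_, fun B hB => ?_, fun B'' hB hpos => ?_⟩
  · rw [← hg.weight_eq a, Finset.sum_congr rfl fun a' _ => (hh.weight_eq a').symm]
    rw [← Finset.sum_biUnion]
    · refine Finset.sum_congr ?_ fun _ _ => rfl
      ext b
      simp only [Finset.mem_filter, Finset.mem_univ, true_and, Finset.mem_biUnion,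
        Option.bind_eq_some_iff]
      exact ⟨fun ⟨c, h1, h2⟩ => ⟨c, h2, h1⟩, fun ⟨c, h1, h2⟩ => ⟨c, h2, h1⟩⟩
    · intro b _ c _ hbc
      refine Finset.disjoint_left.2 fun x hx hx' => hbc ?_
      simp only [Finset.mem_filter, Finset.mem_univ, true_and] at hx hx'
      exact Option.some_injective _ (hx.symm.trans hx')
  · obtain ⟨b, hb⟩ := hg.surj a
    obtain ⟨c, hc⟩ := hh.surj b
    exact ⟨c, by simp [hc, hb]⟩
  · rw [hlift]; exact hh.lift _ (hg.lift _ hB)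
  · obtain ⟨B', hB', rfl⟩ := hh.desc B'' hB fun a ha hw h0 => hpos a ha hw (by simp [h0])
    -- An arc of `D'` of positive weight has some arc of positive weight above it, since weights are
    -- summed along fibres; the hypothesis on `B''` therefore passes down.
    obtain ⟨B, hB₀, rfl⟩ := hg.desc B' hB' fun a ha hw => by
      rw [← hh.weight_eq a] at hw
      obtain ⟨c, hc, hwc⟩ := Finset.sum_pos_iff.1 hw
      have hc' := (Finset.mem_filter.1 hc).2
      have := hpos c (mem_liftArcs.2 ⟨a, ha, hc'⟩) hwc
      simpa [hc'] using this
    exact ⟨B, hB₀, (hlift B).symm⟩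

/-- A dicut inside a lifted dicut consists of arcs in the domain of `g`, so it descends to `D`.
Equitability concerns minimal dicuts only, and this is what carries it over. -/
theorem CutLift.lift_minimal (hg : CutLift w w' g) {B : Finset D.A} (hB : D.IsMinimalDicut B) :
    D'.IsMinimalDicut (liftArcs g B) := by
  refine ⟨hg.lift B hB.prop, fun B' hB' hle => ?_⟩
  obtain ⟨C, hC, rfl⟩ := hg.desc B' hB' fun a ha _ h0 => by
    obtain ⟨b, _, hb⟩ := mem_liftArcs.1 (hle ha)
    rw [h0] at hb; cases hb
  have hCB : C ⊆ B := fun a ha => by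
    obtain ⟨a', ha'⟩ := hg.surj a
    obtain ⟨b, hb, hb'⟩ := mem_liftArcs.1 (hle (mem_liftArcs.2 ⟨a, ha, ha'⟩))
    rw [ha', Option.some.injEq] at hb'
    rwa [hb']
  rw [hB.eq_of_le hC hCB]

/-- Project each dijoin along `g`. It meets every dicut of `D` because it met the lifted one, and an
arc is used at most as often as its whole fibre. -/
theorem CutLift.exists_packing (hg : CutLift w w' g) {ν : ℕ} {J' : Fin ν → Finset D'.A}
    (hJ : IsWeightedPacking w' J') : ∃ J : Fin ν → Finset D.A, IsWeightedPacking w J := by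
  refine ⟨fun i => Finset.univ.filter fun a => ∃ a' ∈ J' i, g a' = some a, fun i B hB => ?_,
    fun a => ?_⟩
  · obtain ⟨a', ha'⟩ := hJ.1 i _ (hg.lift B hB)
    obtain ⟨h1, h2⟩ := Finset.mem_inter.1 ha'
    obtain ⟨a, ha, h3⟩ := mem_liftArcs.1 h2
    exact ⟨a, Finset.mem_inter.2 ⟨Finset.mem_filter.2 ⟨Finset.mem_univ _, a', h1, h3⟩, ha⟩⟩
  · rw [← hg.weight_eq a]
    refine le_trans ?_ (Finset.sum_le_sum fun a' _ => hJ.2 a')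
    refine le_trans (Finset.card_le_card ?_) Finset.card_biUnion_le
    intro i hi
    obtain ⟨a', h1, h2⟩ := (Finset.mem_filter.1 (Finset.mem_filter.1 hi).2).2
    exact Finset.mem_biUnion.2 ⟨a', by simp [h2], by simp [h1]⟩

/-- The fibre over `a` carries `w a` copies in total, so the copies over the domain of `g` can be
identified with the copies of the arcs of `D`. -/
theorem CutLift.exists_equiv (hg : CutLift w w' g) {p : D'.Copies w' → Prop}
    (hp : ∀ c, p c ↔ g c.1 ≠ none) :
    ∃ e : D.Copies w ≃ {c : D'.Copies w' // p c}, ∀ c, g (e c).1.1 = some c.1 := by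
  have hcard : ∀ a, Fintype.card {c : D'.Copies w' // g c.1 = some a} = w a := by
    intro a
    rw [← hg.weight_eq a, Fintype.card_subtype]
    have : (Finset.univ.filter fun c : D'.Copies w' => g c.1 = some a) =
        (Finset.univ.filter fun a' => g a' = some a).sigma fun a' => (Finset.univ : Finset (Fin (w' a'))) := by
      ext ⟨a', k⟩; simp
    rw [this, Finset.card_sigma]
    simp
  set f : ∀ a, Fin (w a) ≃ {c : D'.Copies w' // g c.1 = some a} := fun a =>
    (Fintype.equivFinOfCardEq (hcard a)).symm
  have hbij : Function.Bijective fun c : D.Copies w =>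
      (⟨(f c.1 c.2).1, (hp _).2 (by rw [(f c.1 c.2).2]; simp)⟩ : {c : D'.Copies w' // p c}) := by
    constructor
    · rintro ⟨a, k⟩ ⟨b, l⟩ hab
      have h1 := congrArg Subtype.val hab
      simp only at h1
      have h2 := (f a k).2
      rw [h1, (f b l).2, Option.some.injEq] at h2
      subst h2
      congr 1
      exact (f b).injective (Subtype.ext h1)
    · rintro ⟨c, hc⟩
      obtain ⟨a, ha⟩ := Option.ne_none_iff_exists'.1 ((hp c).1 hc)
      refine ⟨⟨a, (f a).symm ⟨c, ha⟩⟩, ?_⟩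
      simp
  exact ⟨Equiv.ofBijective _ hbij, fun c => (f c.1 c.2).2⟩

theorem CutLift.exists_equitablePacking (hg : CutLift w w' g) {ν : ℕ}
    {J' : Fin ν → Finset (D'.Copies w')} (hJ : IsEquitablePacking w' J') :
    ∃ J : Fin ν → Finset (D.Copies w), IsEquitablePacking w J := by
  obtain ⟨e, he⟩ := hg.exists_equiv (p := fun c => g c.1 ≠ none) fun _ => Iff.rfl
  have hmem : ∀ (i : Fin ν) (c : D.Copies w),
      c ∈ (Finset.univ.filter fun c => (e c).1 ∈ J' i) ↔ (e c).1 ∈ J' i := by simp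
  refine ⟨fun i => Finset.univ.filter fun c => (e c).1 ∈ J' i, ⟨fun i B hB => ?_, fun i j hij => ?_,
    fun B hB i j => ?_⟩⟩
  · obtain ⟨a', ha'⟩ := hJ.dijoin i _ (hg.lift B hB)
    obtain ⟨h1, h2⟩ := Finset.mem_inter.1 ha'
    obtain ⟨c', hc', rfl⟩ := Finset.mem_image.1 h1
    obtain ⟨a, ha, h3⟩ := mem_liftArcs.1 h2
    obtain ⟨c, hc⟩ := e.surjective ⟨c', by rw [h3]; simp⟩
    have h4 := he c
    rw [hc, h3, Option.some.injEq] at h4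
    refine ⟨a, Finset.mem_inter.2 ⟨Finset.mem_image.2 ⟨c, ?_, h4.symm⟩, ha⟩⟩
    rw [hmem, hc]
    exact hc'
  · refine Finset.disjoint_left.2 fun c hc hc' => ?_
    rw [hmem] at hc hc'
    exact Finset.disjoint_left.1 (hJ.disjoint i j hij) hc hc'
  · have hcount : ∀ i, ((Finset.univ.filter fun c => (e c).1 ∈ J' i).filter fun c => c.1 ∈ B).card =
        ((J' i).filter fun c => c.1 ∈ liftArcs g B).card := by
      intro i
      refine Finset.card_bij (fun c _ => (e c).1) ?_ ?_ ?_
      · intro c hc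
        obtain ⟨h1, h2⟩ := Finset.mem_filter.1 hc
        rw [hmem] at h1
        exact Finset.mem_filter.2 ⟨h1, mem_liftArcs.2 ⟨c.1, h2, he c⟩⟩
      · intro c _ c' _ h
        exact e.injective (Subtype.ext h)
      · intro c' hc'
        obtain ⟨h1, h2⟩ := Finset.mem_filter.1 hc'
        obtain ⟨a, ha, h3⟩ := mem_liftArcs.1 h2
        obtain ⟨c, hc⟩ := e.surjective ⟨c', by rw [h3]; simp⟩
        have h4 := he c
        rw [hc, h3, Option.some.injEq] at h4
        refine ⟨c, Finset.mem_filter.2 ⟨?_, by rwa [← h4]⟩, by rw [hc]⟩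
        rw [hmem, hc]
        exact h1
    have := hJ.equitable _ (hg.lift_minimal hB) i j
    rw [← hcount, ← hcount] at this
    exact this

/-- A minimal set of copies that covers a dijoin uses only one copy of each arc, since a section
over the same arcs would be smaller otherwise. Hence replication commutes with taking minimal sets.
-/
theorem mem_weightedDijoinClutter {S : Finset (D.Copies w)} :
    S ∈ (weightedDijoinClutter w).members ↔
      Minimal (fun T : Finset (D.Copies w) => D.IsDijoin (T.image Sigma.fst)) S := by
  have hmono : ∀ J K : Finset D.A, J ⊆ K → D.IsDijoin J → D.IsDijoin K := fun J K hJK hJ B hB =>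
    (hJ B hB).mono (Finset.inter_subset_inter_right hJK)
  constructor
  · rintro ⟨hinj, hmin⟩
    refine ⟨hmin.prop, fun T hT hle x hx => ?_⟩
    have h1 : S.image Sigma.fst ⊆ T.image Sigma.fst :=
      hmin.le_of_le hT (Finset.image_subset_image hle)
    obtain ⟨y, hy, hyx⟩ := Finset.mem_image.1 (h1 (Finset.mem_image_of_mem _ hx))
    rwa [← hinj (hle hy) hx hyx]
  · intro hS
    have hsec : ∀ J ⊆ S.image Sigma.fst, D.IsDijoin J →
        ∃ T ⊆ S, Set.InjOn Sigma.fst (T : Set (D.Copies w)) ∧ T.image Sigma.fst = J := by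
      intro J hJ _
      have hsurj : Set.SurjOn Sigma.fst (S : Set (D.Copies w)) (J : Set D.A) := fun a ha => by
        obtain ⟨c, hc, rfl⟩ := Finset.mem_image.1 (hJ ha)
        exact ⟨c, hc, rfl⟩
      exact Finset.exists_subset_injOn_image_eq_of_surjOn (s := (S : Set (D.Copies w))) J hsurj
    have key : ∀ J ⊆ S.image Sigma.fst, D.IsDijoin J →
        Set.InjOn Sigma.fst (S : Set (D.Copies w)) ∧ S.image Sigma.fst = J := by
      intro J hJ hd
      obtain ⟨T, hT, h1, h2⟩ := hsec J hJ hd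
      have : S = T := hS.eq_of_ge (by rw [h2]; exact hd) hT
      rw [this]; exact ⟨h1, h2⟩
    refine ⟨(key _ subset_rfl hS.prop).1, hS.prop, fun J hd hJ => ?_⟩
    exact ((key J hJ hd).2).le

/-- Contract all copies outside the domain of `g`. A set of the other copies, together with these,
covers a dijoin of `D'` exactly if it corresponds to one of `D`. -/
theorem CutLift.exists_clutter_eq (hg : CutLift w w' g) :
    ∃ (X : Finset (D'.Copies w')) (e : D.Copies w ≃ Σ _ : Fin 1, {x : D'.Copies w' // x ∉ X}),
      (weightedDijoinClutter w).relabel e =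
        Clutter.prod fun _ => (weightedDijoinClutter w').contract X := by
  set X : Finset (D'.Copies w') := Finset.univ.filter fun c => g c.1 = none with hX
  have hXmem : ∀ c, c ∈ X ↔ g c.1 = none := fun c => by simp [hX]
  obtain ⟨e, he⟩ := hg.exists_equiv (p := fun c => c ∉ X) fun c => not_congr (hXmem c)
  set e' : D.Copies w ≃ Σ _ : Fin 1, {x : D'.Copies w' // x ∉ X} :=
    e.trans (Equiv.uniqueSigma (fun _ : Fin 1 => {x : D'.Copies w' // x ∉ X})).symm with he'
  have hd : ∀ c, e' c = ⟨0, e c⟩ := fun c => rfl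
  refine ⟨X, e', Clutter.ext_members fun S => ?_⟩
  rw [Clutter.mem_prod_one_iff, Clutter.mem_contract_iff
    (P := fun T : Finset (D'.Copies w') => D'.IsDijoin (T.image Sigma.fst))
    (fun S T hST hS B hB => (hS B hB).mono
      (Finset.inter_subset_inter_right (Finset.image_subset_image hST)))
    fun S => mem_weightedDijoinClutter]
  change S.map e'.symm.toEmbedding ∈ (weightedDijoinClutter w).members ↔ _
  rw [mem_weightedDijoinClutter]
  have hS : S.map e'.symm.toEmbedding = (Clutter.fiberZero S).map e.symm.toEmbedding := by
    ext c
    simp only [Finset.mem_map_equiv, Equiv.symm_symm, Clutter.fiberZero, Finset.mem_preimage, hd]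
  rw [hS]
  set R := Clutter.fiberZero S
  have key : ∀ R : Finset {x : D'.Copies w' // x ∉ X},
      D.IsDijoin ((R.map e.symm.toEmbedding).image Sigma.fst) ↔
      D'.IsDijoin ((R.map (Function.Embedding.subtype _) ∪ X).image Sigma.fst) := by
    intro R
    constructor
    · intro hR B' hB'
      by_cases hpos : ∀ a' ∈ B', 0 < w' a' → g a' ≠ none
      · obtain ⟨B, hB, rfl⟩ := hg.desc B' hB' hpos
        obtain ⟨a, ha⟩ := hR B hB
        obtain ⟨h1, h2⟩ := Finset.mem_inter.1 ha
        obtain ⟨c, hc, rfl⟩ := Finset.mem_image.1 h1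
        rw [Finset.mem_map_equiv, Equiv.symm_symm] at hc
        refine ⟨(e c).1.1, Finset.mem_inter.2 ⟨Finset.mem_image.2 ⟨(e c).1,
          Finset.mem_union_left _ (Finset.mem_map_of_mem _ hc), rfl⟩, ?_⟩⟩
        exact mem_liftArcs.2 ⟨c.1, h2, he c⟩
      -- The dicut contains an arc of positive weight outside the domain of `g`; the arc has a copy,
      -- and that copy belongs to `X`.
      · push Not at hpos
        obtain ⟨a', h1, h2, h3⟩ := hpos
        exact ⟨a', Finset.mem_inter.2 ⟨Finset.mem_image.2 ⟨⟨a', ⟨0, h2⟩⟩,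
          Finset.mem_union_right _ ((hXmem _).2 h3), rfl⟩, h1⟩⟩
    · intro hR B hB
      obtain ⟨a', ha'⟩ := hR _ (hg.lift B hB)
      obtain ⟨h1, h2⟩ := Finset.mem_inter.1 ha'
      obtain ⟨c', hc', rfl⟩ := Finset.mem_image.1 h1
      obtain ⟨a, ha, h3⟩ := mem_liftArcs.1 h2
      rcases Finset.mem_union.1 hc' with h | h
      · obtain ⟨x, hx, rfl⟩ := Finset.mem_map.1 h
        have h4 := he (e.symm x)
        rw [Equiv.apply_symm_apply] at h4
        have h5 : g x.1.1 = some a := h3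
        rw [h4, Option.some.injEq] at h5
        exact ⟨a, Finset.mem_inter.2 ⟨Finset.mem_image.2 ⟨e.symm x,
          Finset.mem_map_of_mem _ hx, h5⟩, ha⟩⟩
      · rw [hXmem, h3] at h; cases h
  constructor
  · intro h
    refine ⟨(key R).1 h.prop, fun T hT hle => ?_⟩
    have := h.le_of_le ((key T).2 hT) (Finset.map_subset_map.2 hle)
    exact Finset.map_subset_map.1 this
  · intro h
    refine ⟨(key R).2 h.prop, fun T hT hle => ?_⟩
    have h1 : T = (T.map e.toEmbedding).map e.symm.toEmbedding := by
      ext; simp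
    rw [h1] at hT hle ⊢
    exact Finset.map_subset_map.2 (h.le_of_le ((key _).1 hT) (Finset.map_subset_map.1 hle))

end CutLift

end DiMultigraph
end

noncomputable section
open scoped Classical
namespace DiMultigraph

variable {D : DiMultigraph.{u}}

theorem mem_outArcs {U : Finset D.V} {a : D.A} : a ∈ D.outArcs U ↔ D.tail a ∈ U ∧ D.head a ∉ U := by
  simp [outArcs]

theorem mem_inArcs {U : Finset D.V} {a : D.A} : a ∈ D.inArcs U ↔ D.tail a ∉ U ∧ D.head a ∈ U := by
  simp [inArcs]

theorem inArcs_eq_empty {U : Finset D.V} : D.inArcs U = ∅ ↔ ∀ a, D.head a ∈ U → D.tail a ∈ U := by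
  simp only [Finset.eq_empty_iff_forall_notMem, mem_inArcs, not_and]
  exact forall_congr' fun a => not_imp_not

theorem weight_outArcs_singleton (w : D.A → ℕ) (v : D.V) :
    weight w (D.outArcs {v}) = ∑ a, if D.tail a = v then w a else 0 := by
  rw [weight, outArcs, Finset.sum_filter]
  refine Finset.sum_congr rfl fun a _ => if_congr ?_ rfl rfl
  simp only [Finset.mem_singleton, and_iff_left_iff_imp]
  rintro rfl h
  exact D.tail_ne_head a h.symm

theorem weight_inArcs_singleton (w : D.A → ℕ) (v : D.V) :
    weight w (D.inArcs {v}) = ∑ a, if D.head a = v then w a else 0 := by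
  rw [weight, inArcs, Finset.sum_filter]
  refine Finset.sum_congr rfl fun a _ => if_congr ?_ rfl rfl
  simp only [Finset.mem_singleton, and_iff_right_iff_imp]
  rintro rfl h
  exact D.tail_ne_head a h

/-! ### Dicuts and degrees after adding pendant vertices -/

section Pendants

variable {P : Type u} [Fintype P] {base : P → D.V} {dir : P → Bool} {w : D.A → ℕ} {sz : P → ℕ}
  {τ : ℕ}

theorem withPendants_tail_inr (p : P) : (D.withPendants P base dir).tail (Sum.inr p) =
    if dir p then Sum.inr p else Sum.inl (base p) := rfl

theorem withPendants_head_inr (p : P) : (D.withPendants P base dir).head (Sum.inr p) =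
    if dir p then Sum.inl (base p) else Sum.inr p := rfl

/-- A closed set either traces a proper nonempty closed set of `D`, whose dicut it contains, or
contains all or none of the old vertices. In the latter case it separates some pendant vertex from
its base, and that single arc weighs enough. -/
theorem withPendants_dicutsAtLeast (h : DicutsAtLeast w τ) (hsz : ∀ p, τ ≤ sz p) :
    DicutsAtLeast (D := D.withPendants P base dir) (Sum.elim w sz) τ := by
  set D' := D.withPendants P base dir with hD'
  have ht : ∀ p, D'.tail (Sum.inr p) = if dir p then Sum.inr p else Sum.inl (base p) := fun _ => rfl
  have hh : ∀ p, D'.head (Sum.inr p) = if dir p then Sum.inl (base p) else Sum.inr p := fun _ => rfl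
  rintro B ⟨U, ⟨v₀, hv₀⟩, hU', hin, rfl⟩
  rw [inArcs_eq_empty] at hin
  have hle : ∀ p : P, (Sum.inr p : D'.A) ∈ D'.outArcs U →
      τ ≤ weight (D := D') (Sum.elim w sz) (D'.outArcs U) := fun p hp =>
    (hsz p).trans (Finset.single_le_sum (f := (Sum.elim w sz : D'.A → ℕ))
      (fun _ _ => Nat.zero_le _) hp)
  set C : Finset D.V := U.preimage Sum.inl Sum.inl_injective.injOn with hC
  have hmem : ∀ v, v ∈ C ↔ (Sum.inl v : D'.V) ∈ U := fun v => Finset.mem_preimage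
  by_cases h1 : C.Nonempty
  · by_cases h2 : C = Finset.univ
    · obtain ⟨v, hv⟩ : ∃ v, v ∉ U := by
        by_contra hcon
        push Not at hcon
        exact hU' (Finset.eq_univ_of_forall hcon)
      have hall : ∀ v : D.V, (Sum.inl v : D'.V) ∈ U := fun v => by
        rw [← hmem, h2]; exact Finset.mem_univ _
      rcases v with v | p
      · exact (hv (hall v)).elim
      · have h3 := hin (Sum.inr p)
        refine hle p (mem_outArcs.2 ?_)
        rw [ht, hh] at *
        cases hd : dir p
        · simp only [Bool.false_eq_true, if_false]
          exact ⟨hall _, hv⟩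
        · simp only [hd, if_true] at h3
          exact (hv (h3 (hall _))).elim
    · refine (h (D.outArcs C) ⟨C, h1, h2, inArcs_eq_empty.2 fun a ha => ?_, rfl⟩).trans ?_
      · rw [hmem] at ha ⊢
        exact hin (Sum.inl a) ha
      · have : weight w (D.outArcs C) = weight (D := D') (Sum.elim w sz)
            ((D.outArcs C).map Function.Embedding.inl) := by
          rw [weight, weight, Finset.sum_map]; rfl
        rw [this]
        refine Finset.sum_le_sum_of_subset fun a ha => ?_
        obtain ⟨b, hb, rfl⟩ := Finset.mem_map.1 ha
        rw [mem_outArcs, hmem, hmem] at hb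
        exact mem_outArcs.2 hb
  · rw [Finset.not_nonempty_iff_eq_empty, Finset.eq_empty_iff_forall_notMem] at h1
    have hall : ∀ v : D.V, (Sum.inl v : D'.V) ∉ U := fun v hv => h1 v ((hmem v).2 hv)
    rcases v₀ with v | p
    · exact (hall v hv₀).elim
    · have h3 := hin (Sum.inr p)
      refine hle p (mem_outArcs.2 ?_)
      rw [ht, hh] at *
      cases hd : dir p
      · simp only [hd, Bool.false_eq_true, if_false] at h3
        exact (hall _ (h3 hv₀)).elim
      · simp only [if_true]
        exact ⟨hv₀, hall _⟩

/-- Pendant arcs have positive weight, so a dicut whose positive arcs are all old never separates a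
pendant vertex from its base. It is thus determined by its trace on `D`. -/
theorem withPendants_cutLift (hsz : ∀ p, 0 < sz p) :
    CutLift (D' := D.withPendants P base dir) w (Sum.elim w sz)
      (Sum.elim some fun _ => none) := by
  set D' := D.withPendants P base dir with hD'
  have ht : ∀ p, D'.tail (Sum.inr p) = if dir p then Sum.inr p else Sum.inl (base p) := fun _ => rfl
  have hh : ∀ p, D'.head (Sum.inr p) = if dir p then Sum.inl (base p) else Sum.inr p := fun _ => rfl
  set g : D'.A → Option D.A := Sum.elim some fun _ => none with hg
  have hgl : ∀ B, ∀ a : D.A, (Sum.inl a : D'.A) ∈ liftArcs g B ↔ a ∈ B := fun B a => by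
    rw [mem_liftArcs]; simp [hg]
  have hgr : ∀ B, ∀ p : P, (Sum.inr p : D'.A) ∉ liftArcs g B := fun B a => by
    rw [mem_liftArcs]; simp [hg]
  refine ⟨fun a => ?_, fun a => ⟨Sum.inl a, rfl⟩, ?_, ?_⟩
  · rw [Finset.sum_filter, Fintype.sum_sum_type]
    simp [hg]
  · rintro B ⟨C, ⟨v, hv⟩, hC', hin, rfl⟩
    rw [inArcs_eq_empty] at hin
    set U : Finset D'.V := Finset.univ.filter fun v => Sum.elim id base v ∈ C with hU
    have hUl : ∀ v, (Sum.inl v : D'.V) ∈ U ↔ v ∈ C := fun v => by simp [hU]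
    have hUr : ∀ p, (Sum.inr p : D'.V) ∈ U ↔ base p ∈ C := fun p => by simp [hU]
    have hp : ∀ p, D'.tail (Sum.inr p) ∈ U ↔ D'.head (Sum.inr p) ∈ U := by
      intro p
      rw [ht, hh]
      cases dir p <;> simp [hUl, hUr]
    refine ⟨U, ⟨Sum.inl v, (hUl v).2 hv⟩, fun h => hC' (Finset.eq_univ_of_forall fun v => ?_),
      inArcs_eq_empty.2 ?_, ?_⟩
    · rw [← hUl, h]; exact Finset.mem_univ _
    · rintro (a | p) ha
      · exact (hUl _).2 (hin a ((hUl _).1 ha))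
      · exact (hp p).2 ha
    · ext (a | p)
      · rw [hgl, mem_outArcs, mem_outArcs, ← hUl, ← hUl]
        exact Iff.rfl
      · exact iff_of_false (hgr _ _) fun h => (mem_outArcs.1 h).2 ((hp p).1 (mem_outArcs.1 h).1)
  · rintro B ⟨U, ⟨v₀, hv₀⟩, hU', hin, rfl⟩ hpos
    rw [inArcs_eq_empty] at hin
    have hp : ∀ p, D'.tail (Sum.inr p) ∈ U ↔ D'.head (Sum.inr p) ∈ U := fun p =>
      ⟨fun h => by
        by_contra hn
        exact hpos (Sum.inr p) (mem_outArcs.2 ⟨h, hn⟩) (hsz p) rfl, hin _⟩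
    have hp' : ∀ p, (Sum.inr p : D'.V) ∈ U ↔ (Sum.inl (base p) : D'.V) ∈ U := by
      intro p
      have := hp p
      rw [ht, hh] at this
      cases hd : dir p <;> simp only [hd, Bool.false_eq_true, if_false, if_true] at this
      · exact this.symm
      · exact this
    set C : Finset D.V := U.preimage Sum.inl Sum.inl_injective.injOn with hC
    have hmem : ∀ v, v ∈ C ↔ (Sum.inl v : D'.V) ∈ U := fun v => Finset.mem_preimage
    refine ⟨D.outArcs C, ⟨C, ?_, fun h => hU' (Finset.eq_univ_of_forall ?_),
      inArcs_eq_empty.2 fun a ha => ?_, rfl⟩, ?_⟩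
    · rcases v₀ with v | p
      · exact ⟨v, (hmem v).2 hv₀⟩
      · exact ⟨base p, (hmem _).2 ((hp' p).1 hv₀)⟩
    · have hall : ∀ v : D.V, (Sum.inl v : D'.V) ∈ U := fun v => by
        rw [← hmem, h]; exact Finset.mem_univ _
      rintro (v | p)
      · exact hall v
      · exact (hp' p).2 (hall _)
    · rw [hmem] at ha ⊢
      exact hin (Sum.inl a) ha
    · ext (a | p)
      · rw [hgl, mem_outArcs, mem_outArcs, hmem, hmem]
        exact Iff.rfl
      · exact iff_of_false (fun h => (mem_outArcs.1 h).2 ((hp p).1 (mem_outArcs.1 h).1)) (hgr _ _)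

theorem withPendants_weight_out_inl (v : D.V) :
    weight (Sum.elim w sz) ((D.withPendants P base dir).outArcs {Sum.inl v}) =
      weight w (D.outArcs {v}) + ∑ p, if base p = v ∧ dir p = false then sz p else 0 := by
  rw [weight_outArcs_singleton, weight_outArcs_singleton, Fintype.sum_sum_type]
  congr 1
  · simp
  · refine Finset.sum_congr rfl fun p _ => ?_
    cases hd : dir p <;> simp [hd]

theorem withPendants_weight_in_inl (v : D.V) :
    weight (Sum.elim w sz) ((D.withPendants P base dir).inArcs {Sum.inl v}) =
      weight w (D.inArcs {v}) + ∑ p, if base p = v ∧ dir p = true then sz p else 0 := by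
  rw [weight_inArcs_singleton, weight_inArcs_singleton, Fintype.sum_sum_type]
  congr 1
  · simp
  · refine Finset.sum_congr rfl fun p _ => ?_
    cases hd : dir p <;> simp [hd]

theorem withPendants_weight_out_inr (p : P) :
    weight (Sum.elim w sz) ((D.withPendants P base dir).outArcs {Sum.inr p}) =
      if dir p then sz p else 0 := by
  rw [weight_outArcs_singleton, Fintype.sum_sum_type]
  trans 0 + ∑ q, if q = p then (if dir p then sz p else 0) else 0
  · congr 1
    · simp
    · refine Finset.sum_congr rfl fun q _ => ?_
      by_cases hq : q = p
      · subst hq; cases hd : dir q <;> simp [hd]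
      · cases hd : dir q <;> simp [hd, hq]
  · simp

theorem withPendants_weight_in_inr (p : P) :
    weight (Sum.elim w sz) ((D.withPendants P base dir).inArcs {Sum.inr p}) =
      if dir p then 0 else sz p := by
  rw [weight_inArcs_singleton, Fintype.sum_sum_type]
  trans 0 + ∑ q, if q = p then (if dir p then 0 else sz p) else 0
  · congr 1
    · simp
    · refine Finset.sum_congr rfl fun q _ => ?_
      by_cases hq : q = p
      · subst hq; cases hd : dir q <;> simp [hd]
      · cases hd : dir q <;> simp [hd, hq]
  · simp

end Pendants

end DiMultigraph
end

/-! ### Reduction to unit weights, balanced vertices and pendant terminals -/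

noncomputable section
open scoped Classical
namespace DiMultigraph

variable {D : DiMultigraph.{u}} {τ : ℕ} {w : D.A → ℕ} {fin : D.V → Prop}

/-- The vertices satisfying `fin` are sources or sinks of weighted degree `τ` or `τ + 1`, no two of
them adjacent, and the other vertices are balanced. -/
structure IsTerminalBalanced (τ : ℕ) (w : D.A → ℕ) (fin : D.V → Prop) : Prop where
  dicuts : DicutsAtLeast w τ
  source_or_sink : ∀ v, fin v → D.IsSource v ∨ D.IsSink v
  wdeg_eq : ∀ v, fin v → wdeg w v = τ ∨ wdeg w v = τ + 1
  not_adj : ∀ a, ¬ (fin (D.tail a) ∧ fin (D.head a))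
  balanced : ∀ v, ¬ fin v → weight w (D.outArcs {v}) = weight w (D.inArcs {v})

/-- Moreover, all weights are `0` or `1`, and a set entered by a single arc of weight `1` is left by
an arc of positive weight. -/
structure IsShieldable (τ : ℕ) (w : D.A → ℕ) (fin : D.V → Prop) : Prop
    extends IsTerminalBalanced τ w fin where
  le_one : ∀ a, w a ≤ 1
  mate : ∀ C a, D.inArcs C = {a} → w a = 1 → ∃ b ∈ D.outArcs C, 0 < w b

theorem CutLift.weight_liftArcs {D' : DiMultigraph.{u}} {w' : D'.A → ℕ} {g : D'.A → Option D.A}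
    (h : ∀ a, ∑ a' with g a' = some a, w' a' = w a) (B : Finset D.A) :
    weight w' (liftArcs g B) = weight w B := by
  rw [weight, weight, Finset.sum_congr rfl fun a _ => (h a).symm, ← Finset.sum_biUnion]
  · refine Finset.sum_congr ?_ fun _ _ => rfl
    ext b
    simp [mem_liftArcs]
  · intro b _ c _ hbc
    refine Finset.disjoint_left.2 fun x hx hx' => hbc ?_
    simp only [Finset.mem_filter, Finset.mem_univ, true_and] at hx hx'
    exact Option.some_injective _ (hx.symm.trans hx')

theorem outArcs_compl (U : Finset D.V) : D.outArcs Uᶜ = D.inArcs U := by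
  ext a; simp [mem_outArcs, mem_inArcs]

theorem inArcs_compl (U : Finset D.V) : D.inArcs Uᶜ = D.outArcs U := by
  ext a; simp [mem_outArcs, mem_inArcs]

section Parallel

variable (D w) in
/-- `D` with each arc `a` replaced by `max (w a) 1 + z` parallel arcs. -/
@[reducible] def splitArcs (z : ℕ) : DiMultigraph.{u} :=
  D.withArcs (Σ a, Fin (w a - 1 + z)) (fun k => D.tail k.1) (fun k => D.head k.1)
    fun k => D.tail_ne_head k.1

variable {z : ℕ}

variable (w z) in
/-- The weight `w a` of an arc is split into units, one for each of `w a` parallel arcs. -/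
def splitWeight : (splitArcs D w z).A → ℕ :=
  Sum.elim (fun a => min (w a) 1) fun k => if k.2.1 + 1 < w k.1 then 1 else 0

variable (w z) in
/-- The arc of `D` from which an arc of `splitArcs D w z` comes. -/
def splitArc : (splitArcs D w z).A → D.A := Sum.elim id Sigma.fst

theorem splitArcs_tail (a : (splitArcs D w z).A) :
    (splitArcs D w z).tail a = D.tail (splitArc w z a) := by
  rcases a with a | a <;> rfl

theorem splitArcs_head (a : (splitArcs D w z).A) :
    (splitArcs D w z).head a = D.head (splitArc w z a) := by
  rcases a with a | a <;> rfl

theorem splitWeight_le_one (a : (splitArcs D w z).A) : splitWeight w z a ≤ 1 := by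
  rcases a with a | a
  · exact min_le_right _ _
  · change (if _ then 1 else 0) ≤ 1
    split_ifs <;> simp

theorem sum_splitWeight (a : D.A) :
    ∑ b with some (splitArc w z b) = some a, splitWeight w z b = w a := by
  rw [Finset.sum_filter, Fintype.sum_sum_type]
  have h1 : (∑ b, if some (splitArc w z (Sum.inl b)) = some a then
      splitWeight w z (Sum.inl b) else 0) = min (w a) 1 := by
    rw [Finset.sum_eq_single a]
    · exact if_pos rfl
    · intro b _ hb
      exact if_neg fun h => hb (Option.some_injective _ h)
    · simp
  have h2 : (∑ b, if some (splitArc w z (Sum.inr b)) = some a then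
      splitWeight w z (Sum.inr b) else 0) = w a - 1 := by
    rw [← Finset.univ_sigma_univ, Finset.sum_sigma, Finset.sum_eq_single a]
    · trans ∑ k : Fin (w a - 1 + z), if k.1 < w a - 1 then 1 else 0
      · refine Finset.sum_congr rfl fun k _ => ?_
        rw [if_pos (show some (splitArc w z (Sum.inr ⟨a, k⟩)) = some a from rfl)]
        change (if k.1 + 1 < w a then 1 else 0) = _
        exact if_congr (by omega) rfl rfl
      · rw [Fin.sum_univ_eq_sum_range (fun k => if k < w a - 1 then 1 else 0),
          ← Finset.sum_filter]
        have : (Finset.range (w a - 1 + z)).filter (· < w a - 1) = Finset.range (w a - 1) := by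
          ext k; simp only [Finset.mem_filter, Finset.mem_range]; omega
        rw [this]; simp
    · intro b _ hb
      exact Finset.sum_eq_zero fun k _ => if_neg fun h => hb (Option.some_injective _ h)
    · simp
  rw [h1, h2]
  omega

theorem splitArcs_inArcs (U : Finset D.V) : (splitArcs D w z).inArcs U =
    liftArcs (fun b => some (splitArc w z b)) (D.inArcs U) := by
  ext b
  rw [mem_inArcs, splitArcs_tail, splitArcs_head, mem_liftArcs]
  simp [mem_inArcs]

theorem splitArcs_outArcs (U : Finset D.V) : (splitArcs D w z).outArcs U =
    liftArcs (fun b => some (splitArc w z b)) (D.outArcs U) := by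
  ext b
  rw [mem_outArcs, splitArcs_tail, splitArcs_head, mem_liftArcs]
  simp [mem_outArcs]

theorem splitArcs_cutLift :
    CutLift w (splitWeight w z) fun b => some (splitArc w z b) := by
  refine ⟨sum_splitWeight, fun a => ⟨Sum.inl a, rfl⟩, ?_, ?_⟩
  · rintro B ⟨U, hU, hU', hin, rfl⟩
    refine ⟨U, hU, hU', ?_, (splitArcs_outArcs U).symm⟩
    rw [splitArcs_inArcs, hin]
    simp [liftArcs]
  · rintro B ⟨U, hU, hU', hin, rfl⟩ _
    refine ⟨D.outArcs U, ⟨U, hU, hU', inArcs_eq_empty.2 fun a => ?_, rfl⟩, splitArcs_outArcs (D := D) U⟩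
    exact inArcs_eq_empty.1 hin (Sum.inl a)

theorem splitArcs_weight_outArcs (U : Finset D.V) :
    weight (splitWeight w z) ((splitArcs D w z).outArcs U) = weight w (D.outArcs U) := by
  rw [splitArcs_outArcs]; exact CutLift.weight_liftArcs sum_splitWeight _

theorem splitArcs_weight_inArcs (U : Finset D.V) :
    weight (splitWeight w z) ((splitArcs D w z).inArcs U) = weight w (D.inArcs U) := by
  rw [splitArcs_inArcs]; exact CutLift.weight_liftArcs sum_splitWeight _

theorem splitWeight_pos (hw : ∀ a, 0 < w a) (a : (splitArcs D w 0).A) : 0 < splitWeight w 0 a := by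
  rcases a with a | ⟨a, k⟩
  · exact lt_min (hw a) one_pos
  · change 0 < if k.1 + 1 < w a then 1 else 0
    rw [if_pos (by have := k.2; omega)]
    exact one_pos

/-- The condition `mate` is what has to be secured. If all weights are positive, a set entered by
one arc and left by none has a complement with a dicut of weight 1, below `τ`. Otherwise one spare
parallel arc per arc (`z = 1`) ensures that no set is entered by exactly one arc. -/
theorem IsTerminalBalanced.isShieldable (h : IsTerminalBalanced τ w fin) (hτ : 2 ≤ τ)
    (hz : z = 0 ∧ (∀ a, 0 < w a) ∨ z = 1) :
    IsShieldable (D := splitArcs D w z) τ (splitWeight w z) fin := by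
  have hd : DicutsAtLeast (splitWeight w z) τ := by
    rintro B ⟨U, hU, hU', hin, rfl⟩
    rw [splitArcs_weight_outArcs]
    exact h.dicuts _ ⟨U, hU, hU', inArcs_eq_empty.2 fun a => inArcs_eq_empty.1 hin (Sum.inl a), rfl⟩
  refine ⟨⟨hd, fun v hv => ?_, fun v hv => ?_, fun a => ?_, fun v hv => ?_⟩, splitWeight_le_one,
    fun C b hC hb => ?_⟩
  · refine (h.source_or_sink v hv).imp (fun hs a => ?_) fun hs a => ?_
    · rw [splitArcs_head]; exact hs _
    · rw [splitArcs_tail]; exact hs _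
  · rw [wdeg, splitArcs_weight_outArcs, splitArcs_weight_inArcs]; exact h.wdeg_eq v hv
  · rw [splitArcs_tail, splitArcs_head]; exact h.not_adj _
  · rw [splitArcs_weight_outArcs, splitArcs_weight_inArcs]; exact h.balanced v hv
  · rcases hz with ⟨rfl, hw⟩ | rfl
    · by_contra hcon
      have hout : (splitArcs D w 0).outArcs C = ∅ :=
        Finset.eq_empty_of_forall_notMem fun a ha => hcon ⟨a, ha, splitWeight_pos hw a⟩
      have hb' := mem_inArcs.1 (hC ▸ Finset.mem_singleton_self b)
      have := hd ((splitArcs D w 0).inArcs C) ⟨Cᶜ, ⟨_, Finset.mem_compl.2 hb'.1⟩,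
        fun hcc => Finset.mem_compl.1 (hcc ▸ Finset.mem_univ _) hb'.2,
        by rw [inArcs_compl, hout], (outArcs_compl C).symm⟩
      rw [hC, weight, Finset.sum_singleton, hb] at this
      omega
    -- A parallel companion of `b` enters `C` as well.
    · exfalso
      have hb' := mem_inArcs.1 (hC ▸ Finset.mem_singleton_self b)
      rw [splitArcs_tail, splitArcs_head] at hb'
      have hpar : ∀ b', splitArc w 1 b' = splitArc w 1 b → b' = b := fun b' hbb => by
        refine Finset.mem_singleton.1 (hC ▸ mem_inArcs.2 ?_)
        rwa [splitArcs_tail, splitArcs_head, hbb]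
      rcases b with a | ⟨a, k⟩
      · have := hpar (Sum.inr ⟨a, ⟨0, by omega⟩⟩) rfl
        cases this
      · have := hpar (Sum.inl a) rfl
        cases this

theorem HasFaces.splitArcs {k : ℕ} (h : D.HasFaces k) :
    (splitArcs D w z).HasFaces (k + Fintype.card (Σ a, Fin (w a - 1 + z))) :=
  h.withParallel _ _

end Parallel

section Pendants

variable {k : Bool → Bool → D.V → ℕ}

/-- Pendant vertices at `v`: for each direction `d`, there are `k d true v` of them of weight `τ + 1`
and `k d false v` of weight `τ`. -/
abbrev PendantIndex (k : Bool → Bool → D.V → ℕ) : Type u :=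
  Σ t : D.V × Bool × Bool, Fin (k t.2.1 t.2.2 t.1)

variable (D k) in
/-- `D` with these pendant vertices. -/
@[reducible] def addPendants : DiMultigraph.{u} :=
  D.withPendants (PendantIndex k) (fun p => p.1.1) fun p => p.1.2.1

/-- The weight of the arc of a pendant vertex. -/
def pendantWeight (τ : ℕ) (p : PendantIndex k) : ℕ := τ + if p.1.2.2 then 1 else 0

/-- The weight of `addPendants D k`. -/
def addPendantsWeight (k : Bool → Bool → D.V → ℕ) (τ : ℕ) (w : D.A → ℕ) : (addPendants D k).A → ℕ :=
  Sum.elim w (pendantWeight τ)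

theorem sum_pendantIndex {M : Type*} [AddCommMonoid M] (f : D.V × Bool × Bool → M) :
    ∑ p : PendantIndex k, f p.1 =
      ∑ v, (k true true v • f (v, true, true) + k true false v • f (v, true, false) +
        (k false true v • f (v, false, true) + k false false v • f (v, false, false))) := by
  rw [← Finset.univ_sigma_univ, Finset.sum_sigma, Fintype.sum_prod_type]
  simp [Fintype.sum_prod_type]

/-- Pendant sources send weight into their base and pendant sinks take weight out of it; `hbal` says
that together they cancel the imbalance there. -/
theorem addPendants_isTerminalBalanced (h : DicutsAtLeast w τ)
    (hbal : ∀ v, (weight w (D.outArcs {v}) : ℤ) - weight w (D.inArcs {v}) =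
      k true true v * (τ + 1) + k true false v * τ - (k false true v * (τ + 1) + k false false v * τ)) :
    IsTerminalBalanced (D := addPendants D k) τ (addPendantsWeight k τ w) (fun v => v.isRight) := by
  refine ⟨withPendants_dicutsAtLeast h fun p => Nat.le_add_right _ _, ?_, ?_, ?_, ?_⟩
  · rintro (v | p) hp
    · cases hp
    · cases hd : p.1.2.1
      · right
        rintro (a | q) hq
        · cases hq
        · rw [withPendants_tail_inr] at hq
          by_cases hqp : q = p
          · subst hqp; rw [hd] at hq; cases hq
          · split_ifs at hq
            exact hqp (Sum.inr_injective hq)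
      · left
        rintro (a | q) hq
        · cases hq
        · rw [withPendants_head_inr] at hq
          by_cases hqp : q = p
          · subst hqp; rw [hd] at hq; cases hq
          · split_ifs at hq
            exact hqp (Sum.inr_injective hq)
  · rintro (v | p) hp
    · cases hp
    · rw [wdeg, addPendantsWeight, withPendants_weight_out_inr, withPendants_weight_in_inr,
        pendantWeight]
      cases p.1.2.1 <;> cases p.1.2.2 <;> simp
  · rintro (a | q) ⟨h1, h2⟩
    · cases h1
    · rw [withPendants_tail_inr] at h1
      rw [withPendants_head_inr] at h2
      cases hd : q.1.2.1 <;> simp [hd] at h1 h2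
  · rintro (v | p) hv
    · rw [addPendantsWeight, withPendants_weight_out_inl, withPendants_weight_in_inl]
      have h1 : (∑ p : PendantIndex k, if p.1.1 = v ∧ p.1.2.1 = false then pendantWeight τ p else 0) =
          k false true v * (τ + 1) + k false false v * τ := by
        refine (sum_pendantIndex fun t => if t.1 = v ∧ t.2.1 = false then
          τ + (if t.2.2 then 1 else 0) else 0).trans ?_
        rw [Finset.sum_eq_single v]
        · simp
        · intro b _ hb; simp [hb]
        · simp
      have h2 : (∑ p : PendantIndex k, if p.1.1 = v ∧ p.1.2.1 = true then pendantWeight τ p else 0) =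
          k true true v * (τ + 1) + k true false v * τ := by
        refine (sum_pendantIndex fun t => if t.1 = v ∧ t.2.1 = true then
          τ + (if t.2.2 then 1 else 0) else 0).trans ?_
        rw [Finset.sum_eq_single v]
        · simp
        · intro b _ hb; simp [hb]
        · simp
      have := hbal v
      zify
      have h3 : (k false true v * (τ + 1) + k false false v * τ : ℤ) =
        ((k false true v * (τ + 1) + k false false v * τ : ℕ) : ℤ) := by push_cast; ring
      have h4 : (k true true v * (τ + 1) + k true false v * τ : ℤ) =
        ((k true true v * (τ + 1) + k true false v * τ : ℕ) : ℤ) := by push_cast; ring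
      rw [h3, h4, ← h1, ← h2] at this
      push_cast at this ⊢
      linarith
    · exact (hv rfl).elim

end Pendants

end DiMultigraph
end

noncomputable section
open scoped Classical
namespace DiMultigraph

/-! ### How a closed set can meet a double ring -/

section RingCut

variable {X V : Type u}

/-- The trace of a closed vertex set on the double rings replacing the vertices of a digraph: `S`, `T`
are the sources and sinks of the outer rings in the set, `H`, `Q` those of the inner rings. `I` and
`O` are the ring positions without an outward and without an inward spoke. -/
structure IsRingCut (vt : X → V) (ρ : Equiv.Perm X) (I O : X → Prop) (μ : {x // I x} ≃ {x // O x})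
    (S T H Q : X → Prop) : Prop where
  rot : ∀ x y, ρ.SameCycle x y ↔ vt x = vt y
  not_both : ∀ x, I x → ¬ O x
  match_vt : ∀ x, vt (μ x).1 = vt x.1
  outer_fwd : ∀ x, T x → S x
  outer_bck : ∀ x, T x → S (ρ x)
  inner_fwd : ∀ x, Q (ρ x) → H x
  inner_bck : ∀ x, Q x → H x
  spoke_in : ∀ x, ¬ O x → Q x → S x
  spoke_out : ∀ x, ¬ I x → T x → H x

namespace IsRingCut

variable {vt : X → V} {ρ : Equiv.Perm X} {I O : X → Prop} {μ : {x // I x} ≃ {x // O x}}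
  {S T H Q : X → Prop}

theorem vt_rot
    (h : IsRingCut vt ρ I O μ S T H Q) (x : X) : vt (ρ x) = vt x :=
  ((h.rot _ _).1 (Equiv.Perm.sameCycle_apply_right.2 (Equiv.Perm.SameCycle.refl ρ x))).symm

theorem of_step [Fintype X]
    (h : IsRingCut vt ρ I O μ S T H Q) {R : X → Prop} {v : V} (hR : ∀ x, vt x = v → R x → R (ρ x)) {x y : X}
    (hx : vt x = v) (hy : vt y = v) (hRx : R x) : R y := by
  obtain ⟨n, _, rfl⟩ := ((h.rot x y).2 (hx.trans hy.symm)).exists_pow_eq'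
  have : ∀ n : ℕ, vt ((ρ ^ n) x) = v ∧ R ((ρ ^ n) x) := by
    intro n
    induction n with
    | zero => exact ⟨hx, hRx⟩
    | succ n ih =>
      rw [pow_succ', Equiv.Perm.mul_apply]
      exact ⟨(h.vt_rot _).trans ih.1, hR _ ih.1 ih.2⟩
  exact (this n).2

/-- The partner of a position without an outward spoke has one, because no position lacks both
spokes. So each ring pair has spokes in both directions. -/
theorem exists_not_in
    (h : IsRingCut vt ρ I O μ S T H Q) (x : X) : ∃ y, vt y = vt x ∧ ¬ I y := by
  by_cases hx : I x
  · exact ⟨(μ ⟨x, hx⟩).1, h.match_vt _, fun hI => h.not_both _ hI (μ ⟨x, hx⟩).2⟩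
  · exact ⟨x, rfl, hx⟩

theorem symm_vt
    (h : IsRingCut vt ρ I O μ S T H Q) (x : {x // O x}) : vt (μ.symm x).1 = vt x.1 := by
  rw [← h.match_vt, Equiv.apply_symm_apply]

theorem exists_not_out
    (h : IsRingCut vt ρ I O μ S T H Q) (x : X) : ∃ y, vt y = vt x ∧ ¬ O y := by
  by_cases hx : O x
  · exact ⟨(μ.symm ⟨x, hx⟩).1, h.symm_vt _, h.not_both _ (μ.symm ⟨x, hx⟩).2⟩
  · exact ⟨x, rfl, hx⟩

theorem outer_const [Fintype X]
    (h : IsRingCut vt ρ I O μ S T H Q) {v : V} (hS : ∀ x, vt x = v → S x → T x) {x y : X} (hx : vt x = v)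
    (hy : vt y = v) : S x → S y :=
  h.of_step (fun z hz hSz => h.outer_bck z (hS z hz hSz)) hx hy

theorem inner_const [Fintype X]
    (h : IsRingCut vt ρ I O μ S T H Q) {v : V} (hH : ∀ x, vt x = v → H x → Q x) {x y : X} (hx : vt x = v)
    (hy : vt y = v) : H x → H y := by
  intro hHx
  by_contra hHy
  exact h.of_step (R := fun z => ¬ H z)
    (fun z hz hn hHz => hn (h.inner_fwd z (hH _ ((h.vt_rot z).trans hz) hHz))) hy hx hHy hHx

/-- An unsplit ring is inside or outside as a whole. An outward spoke carries membership from the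
outer to the inner ring, and an inward spoke carries it back. -/
theorem unsplit [Fintype X]
    (h : IsRingCut vt ρ I O μ S T H Q) {v : V} (hS : ∀ x, vt x = v → S x → T x) (hH : ∀ x, vt x = v → H x → Q x)
    {x y : X} (hx : vt x = v) (hy : vt y = v) : S x ↔ H y := by
  constructor
  · intro hSx
    obtain ⟨z, hz, hzI⟩ := h.exists_not_in x
    exact h.inner_const hH (hz.trans hx) hy
      (h.spoke_out z hzI (hS z (hz.trans hx) (h.outer_const hS hx (hz.trans hx) hSx)))
  · intro hHy
    obtain ⟨z, hz, hzO⟩ := h.exists_not_out x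
    exact h.outer_const hS (hz.trans hx) hx
      (h.spoke_in z hzO (hH z (hz.trans hx) (h.inner_const hH hy (hz.trans hx) hHy)))

/-- Since `ρ` is a bijection, both sets have as many elements as `S` has more than `T`. The two
kinds of outer ring arcs are therefore cut equally often. -/
theorem card_outer [Fintype X]
    (h : IsRingCut vt ρ I O μ S T H Q) : (Finset.univ.filter fun x => S (ρ x) ∧ ¬ T x).card =
    (Finset.univ.filter fun x => S x ∧ ¬ T x).card := by
  have h1 : ∀ R : X → Prop, (∀ x, T x → R x) → (Finset.univ.filter fun x => R x ∧ ¬ T x).card =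
      (Finset.univ.filter R).card - (Finset.univ.filter T).card := by
    intro R hR
    rw [← Finset.card_sdiff_of_subset (Finset.monotone_filter_right _ fun x _ => hR x)]
    congr 1; ext x; simp
  rw [h1 _ h.outer_bck, h1 _ h.outer_fwd]
  congr 1
  exact Finset.card_equiv ρ fun x => by simp

theorem card_inner [Fintype X]
    (h : IsRingCut vt ρ I O μ S T H Q) : (Finset.univ.filter fun x => H x ∧ ¬ Q (ρ x)).card =
    (Finset.univ.filter fun x => H x ∧ ¬ Q x).card := by
  have h1 : ∀ R : X → Prop, (∀ x, R x → H x) → (Finset.univ.filter fun x => H x ∧ ¬ R x).card =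
      (Finset.univ.filter H).card - (Finset.univ.filter R).card := by
    intro R hR
    rw [← Finset.card_sdiff_of_subset (Finset.monotone_filter_right _ fun x _ => hR x)]
    congr 1; ext x; simp
  rw [h1 _ h.inner_fwd, h1 _ h.inner_bck]
  congr 1
  exact Finset.card_equiv ρ fun x => by simp

/-- A double count along the chords: if no spoke and no chord leaves the set, the chords force at
least as many inner sinks as inner sources at this vertex, against the split at `x₀`. -/
theorem inner_split [Fintype X]
    (h : IsRingCut vt ρ I O μ S T H Q) (hS : ∀ x, S x → T x) {x₀ : X} (hx₀ : H x₀ ∧ ¬ Q x₀) :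
    (∃ x, ¬ O x ∧ S x ∧ ¬ Q x) ∨ (∃ x, ¬ I x ∧ H x ∧ ¬ T x) ∨ ∃ x, H x.1 ∧ ¬ Q (μ x).1 := by
  by_contra hcon
  push Not at hcon
  obtain ⟨hA, hB, hC⟩ := hcon
  have hconst : ∀ {x y}, vt x = vt x₀ → vt y = vt x₀ → S x → S y :=
    h.outer_const fun x _ => hS x
  by_cases hS0 : S x₀
  -- With the outer ring inside, only sinks without an inward spoke can be missing, and the chord
  -- ending at a missing sink must start at a missing source.
  · have hle : (Finset.univ.filter fun x => vt x = vt x₀ ∧ ¬ Q x).card ≤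
        (Finset.univ.filter fun x => vt x = vt x₀ ∧ ¬ H x).card := by
      have hO : ∀ x, vt x = vt x₀ → ¬ Q x → O x := fun x hx hq => by
        by_contra hO; exact hq (hA x hO (hconst rfl hx hS0))
      refine Finset.card_le_card_of_injOn
        (fun x => if hx : O x then (μ.symm ⟨x, hx⟩).1 else x) ?_ ?_
      · intro x hx
        simp only [Finset.coe_filter, Finset.mem_univ, true_and, Set.mem_ofPred_eq] at hx ⊢
        rw [dif_pos (hO x hx.1 hx.2)]
        refine ⟨(h.symm_vt _).trans hx.1, fun hh => hx.2 ?_⟩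
        have := hC _ hh
        rwa [Equiv.apply_symm_apply] at this
      · intro x hx y hy hxy
        simp only [Finset.coe_filter, Finset.mem_univ, true_and, Set.mem_ofPred_eq] at hx hy
        simp only [dif_pos (hO x hx.1 hx.2), dif_pos (hO y hy.1 hy.2)] at hxy
        exact congrArg Subtype.val (μ.symm.injective (Subtype.ext hxy))
    refine absurd (Finset.card_lt_card (Finset.ssubset_iff_of_subset ?_ |>.2 ⟨x₀, ?_, ?_⟩)) hle.not_gt
    · exact Finset.monotone_filter_right _ fun x _ hx => ⟨hx.1, fun hq => hx.2 (h.inner_bck x hq)⟩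
    · simpa using hx₀.2
    · simpa using hx₀.1
  -- With the outer ring outside, only sources without an outward spoke can be present, and their
  -- chords must end at sinks that are present.
  · have hle : (Finset.univ.filter fun x => vt x = vt x₀ ∧ H x).card ≤
        (Finset.univ.filter fun x => vt x = vt x₀ ∧ Q x).card := by
      have hI : ∀ x, vt x = vt x₀ → H x → I x := fun x hx hh => by
        by_contra hI
        exact hS0 (hconst hx rfl (h.outer_fwd x (hB x hI hh)))
      refine Finset.card_le_card_of_injOn
        (fun x => if hx : I x then (μ ⟨x, hx⟩).1 else x) ?_ ?_
      · intro x hx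
        simp only [Finset.coe_filter, Finset.mem_univ, true_and, Set.mem_ofPred_eq] at hx ⊢
        rw [dif_pos (hI x hx.1 hx.2)]
        exact ⟨(h.match_vt _).trans hx.1, hC _ hx.2⟩
      · intro x hx y hy hxy
        simp only [Finset.coe_filter, Finset.mem_univ, true_and, Set.mem_ofPred_eq] at hx hy
        simp only [dif_pos (hI x hx.1 hx.2), dif_pos (hI y hy.1 hy.2)] at hxy
        exact congrArg Subtype.val (μ.injective (Subtype.ext hxy))
    refine absurd (Finset.card_lt_card (Finset.ssubset_iff_of_subset ?_ |>.2 ⟨x₀, ?_, ?_⟩)) hle.not_gt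
    · exact Finset.monotone_filter_right _ fun x _ hx => ⟨hx.1, h.inner_bck x hx.2⟩
    · simpa using hx₀.1
    · simpa using hx₀.2

/-- The inner ring is constant here. If it lies outside, an outer source inside must lack its inward
spoke and no outer sink can be inside, so the set meets the rings in one outer source only. If it
lies inside, dually, the set misses one outer sink only. The exceptional position carries an old arc
of weight 1, which spreads the split to the rest of the digraph. -/
theorem outer_split [Fintype X]
    (h : IsRingCut vt ρ I O μ S T H Q) (hH : ∀ x, H x → Q x) {x₀ : X} (hx₀ : ∀ x, S x ∧ ¬ T x ↔ x = x₀)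
    (hA : ∀ x, ¬ O x → S x → Q x) (hB : ∀ x, ¬ I x → H x → T x) :
    (O x₀ ∧ ∀ x, vt x = vt x₀ → ¬ H x ∧ ¬ T x ∧ (S x → x = x₀)) ∨
    (I x₀ ∧ ∀ x, vt x = vt x₀ → H x ∧ S x ∧ (¬ T x → x = x₀)) := by
  have hconst : ∀ {x y}, vt x = vt x₀ → vt y = vt x₀ → H x → H y :=
    h.inner_const fun x _ => hH x
  have h0 := (hx₀ x₀).2 rfl
  by_cases hH0 : H x₀
  · right
    have hall : ∀ x, vt x = vt x₀ → H x := fun x hx => hconst rfl hx hH0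
    refine ⟨by_contra fun hI => h0.2 (hB _ hI hH0), fun x hx => ?_⟩
    have hSx : S x := by
      by_contra hSx
      have hI : I x := by_contra fun hI => hSx (h.outer_fwd x (hB _ hI (hall x hx)))
      exact hSx (h.spoke_in x (h.not_both x hI) (hH x (hall x hx)))
    exact ⟨hall x hx, hSx, fun hT => (hx₀ x).1 ⟨hSx, hT⟩⟩
  · left
    have hall : ∀ x, vt x = vt x₀ → ¬ H x := fun x hx hh => hH0 (hconst hx rfl hh)
    have hO : ∀ x, vt x = vt x₀ → S x → O x := fun x hx hSx =>
      by_contra fun hO => hall x hx (h.inner_bck x (hA x hO hSx))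
    refine ⟨hO x₀ rfl h0.1, fun x hx => ?_⟩
    have hTx : ¬ T x := fun hTx => hall x hx
      (h.spoke_out x (fun hI => h.not_both x hI (hO x hx (h.outer_fwd x hTx))) hTx)
    exact ⟨hall x hx, hTx, fun hSx => (hx₀ x).1 ⟨hSx, hTx⟩⟩

end IsRingCut

end RingCut

end DiMultigraph
end

noncomputable section
open scoped Classical
namespace DiMultigraph

/-! ### The shield and its weighted degrees -/

section Shield

variable (D : DiMultigraph.{u}) (w : D.A → ℕ) (fin : D.V → Prop)

/-- The darts at the vertices that are to be replaced by a shield. -/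
abbrev RingDart : Type u := {x : D.Dart // ¬ fin (D.dartVertex x)}

variable {D fin}

/-- The ring positions with an outgoing arc of weight `1`. -/
def UnitOut (x : RingDart D fin) : Prop := x.1.2 = false ∧ w x.1.1 = 1

/-- The ring positions with an incoming arc of weight `1`. -/
def UnitIn (x : RingDart D fin) : Prop := x.1.2 = true ∧ w x.1.1 = 1

theorem UnitIn.not_unitOut {w : D.A → ℕ} {x : RingDart D fin} (h : UnitIn w x) : ¬ UnitOut w x :=
  fun h' => by have := h.1.symm.trans h'.1; cases this

/-- The vertices of the shielded digraph: those satisfying `fin`, and four for each dart at another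
vertex. In `(x, o, t)`, the vertex lies in the outer ring if `o` is true, and is a source if `t` is
true. -/
abbrev ShieldVertex (D : DiMultigraph.{u}) (fin : D.V → Prop) : Type u :=
  {v // fin v} ⊕ (RingDart D fin × Bool × Bool)

variable (fin) in
/-- The vertex of the shielded digraph at which an old dart is attached. -/
def shieldEnd (x : D.Dart) : ShieldVertex D fin :=
  if h : fin (D.dartVertex x) then Sum.inl ⟨_, h⟩ else Sum.inr (⟨x, h⟩, true, !x.2)

theorem shieldEnd_of_not {x : D.Dart} (h : ¬ fin (D.dartVertex x)) :
    shieldEnd fin x = Sum.inr (⟨x, h⟩, true, !x.2) := dif_neg h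

theorem shieldEnd_of {x : D.Dart} (h : fin (D.dartVertex x)) :
    shieldEnd fin x = Sum.inl ⟨_, h⟩ := dif_pos h

theorem shieldEnd_eq_inl {x : D.Dart} {v : {v // fin v}} :
    shieldEnd fin x = Sum.inl v ↔ D.dartVertex x = v.1 := by
  by_cases h : fin (D.dartVertex x)
  · rw [shieldEnd_of h, Sum.inl.injEq, Subtype.ext_iff]
  · rw [shieldEnd_of_not h]
    exact iff_of_false (by simp) fun h' => h (h' ▸ v.2)

theorem shieldEnd_eq_inr {x : D.Dart} {y : RingDart D fin} {o t : Bool} :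
    shieldEnd fin x = Sum.inr (y, o, t) ↔ x = y.1 ∧ o = true ∧ t = !x.2 := by
  by_cases h : fin (D.dartVertex x)
  · rw [shieldEnd_of h]
    exact iff_of_false (by simp) fun h' => y.2 (h'.1 ▸ h)
  · rw [shieldEnd_of_not h]
    simp only [Sum.inr.injEq, Prod.mk.injEq, Subtype.ext_iff]
    tauto

variable (fin) in
/-- The shield, without chords. In the ring arc `(x, o, f)`, `o` tells whether it lies in the outer
ring, and `f` whether it is the arc of weight `1`. -/
@[reducible] def shieldRing (ρ : Equiv.Perm (RingDart D fin)) : DiMultigraph.{u} where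
  V := ShieldVertex D fin
  A := D.A ⊕ (RingDart D fin × Bool × Bool) ⊕
    ({x : RingDart D fin // ¬ UnitOut w x} ⊕ {x : RingDart D fin // ¬ UnitIn w x})
  -- The outer ring runs through source `x`, sink `x`, source `ρ x`, and the inner ring through sink
  -- `x`, source `x`, sink `ρ x`. Outer sources thus face inner sinks and outer sinks face inner
  -- sources, which makes the spokes radial. This is why the shift by `ρ` sits at different ends in
  -- the two rings.
  tail := Sum.elim (fun a => shieldEnd fin (a, false)) (Sum.elim
    (fun r => Sum.inr (if r.2.1 && !r.2.2 then ρ r.1 else r.1, r.2.1, true))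
    (Sum.elim (fun x => Sum.inr (x.1, true, true)) fun x => Sum.inr (x.1, false, true)))
  head := Sum.elim (fun a => shieldEnd fin (a, true)) (Sum.elim
    (fun r => Sum.inr (if !r.2.1 && r.2.2 then ρ r.1 else r.1, r.2.1, false))
    (Sum.elim (fun x => Sum.inr (x.1, false, false)) fun x => Sum.inr (x.1, true, false)))
  tail_ne_head := by
    rintro (a | r | x | x)
    · simp only [Sum.elim_inl]
      intro h
      by_cases hf : fin (D.dartVertex (a, true))
      · rw [shieldEnd_of hf, shieldEnd_eq_inl] at h
        exact D.tail_ne_head a h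
      · rw [shieldEnd_of_not hf, shieldEnd_eq_inr] at h
        simp at h
    · simp
    · simp
    · simp

variable (fin) in
/-- The shield: every vertex not satisfying `fin` is replaced by two concentric rings, with spokes
between the rings and chords inside the inner one. -/
@[reducible] def shield (ρ : Equiv.Perm (RingDart D fin))
    (μ : {x : RingDart D fin // UnitIn w x} ≃ {x : RingDart D fin // UnitOut w x}) :
    DiMultigraph.{u} :=
  (shieldRing w fin ρ).withArcs {x : RingDart D fin // UnitIn w x}
    (fun x => Sum.inr (x.1, false, true)) (fun x => Sum.inr ((μ x).1, false, false)) (by simp)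

variable {ρ : Equiv.Perm (RingDart D fin)}
  {μ : {x : RingDart D fin // UnitIn w x} ≃ {x : RingDart D fin // UnitOut w x}}

variable (ρ μ) in
/-- The weight of the shield. -/
def shieldWeight (τ : ℕ) : (shield w fin ρ μ).A → ℕ :=
  -- The two ring arcs at a ring vertex weigh `1 + (τ - 2)`, which leaves room for exactly one more
  -- unit. The weight `τ - 2` is positive only for `τ ≥ 3`.
  Sum.elim (Sum.elim w (Sum.elim (fun r => if r.2.2 then 1 else τ - 2) fun _ => 1)) fun _ => 1

variable (ρ μ) in
/-- The old arcs of the shield. -/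
def shieldArc : (shield w fin ρ μ).A → Option D.A :=
  Sum.elim (Sum.elim some fun _ => none) fun _ => none

variable {w}

theorem shield_sum {M : Type*} [AddCommMonoid M] (f : (shield w fin ρ μ).A → M) :
    ∑ a, f a = (∑ a, f (Sum.inl (Sum.inl a))) +
      (∑ x, (f (Sum.inl (Sum.inr (Sum.inl (x, true, true)))) +
        f (Sum.inl (Sum.inr (Sum.inl (x, true, false)))) +
        (f (Sum.inl (Sum.inr (Sum.inl (x, false, true)))) +
        f (Sum.inl (Sum.inr (Sum.inl (x, false, false))))))) +
      (∑ x, f (Sum.inl (Sum.inr (Sum.inr (Sum.inl x))))) +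
      (∑ x, f (Sum.inl (Sum.inr (Sum.inr (Sum.inr x))))) +
      ∑ x, f (Sum.inr x) := by
  rw [Fintype.sum_sum_type, Fintype.sum_sum_type, Fintype.sum_sum_type, Fintype.sum_sum_type]
  simp only [Fintype.sum_prod_type, Fintype.sum_bool, add_assoc]

variable {τ : ℕ}

theorem shield_out_fin (v : {v // fin v}) :
    weight (shieldWeight w ρ μ τ) ((shield w fin ρ μ).outArcs {Sum.inl v}) =
      weight w (D.outArcs {v.1}) := by
  rw [weight_outArcs_singleton, shield_sum, weight_outArcs_singleton]
  simp [shieldEnd_eq_inl, shieldWeight]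
  rfl

theorem shield_in_fin (v : {v // fin v}) :
    weight (shieldWeight w ρ μ τ) ((shield w fin ρ μ).inArcs {Sum.inl v}) =
      weight w (D.inArcs {v.1}) := by
  rw [weight_inArcs_singleton, shield_sum, weight_inArcs_singleton]
  simp [shieldEnd_eq_inl, shieldWeight]
  rfl

theorem shield_out_sink (x : RingDart D fin) (o : Bool) :
    weight (shieldWeight w ρ μ τ) ((shield w fin ρ μ).outArcs {Sum.inr (x, o, false)}) = 0 := by
  rw [weight_outArcs_singleton, shield_sum]
  simp [shieldEnd_eq_inr]

theorem shield_in_source (x : RingDart D fin) (o : Bool) :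
    weight (shieldWeight w ρ μ τ) ((shield w fin ρ μ).inArcs {Sum.inr (x, o, true)}) = 0 := by
  rw [weight_inArcs_singleton, shield_sum]
  simp [shieldEnd_eq_inr]

theorem card_filter_val_eq {α : Type*} (p : α → Prop) (x : α) [Fintype {x // p x}]
    [DecidablePred fun y : {x // p x} => y.1 = x] :
    (Finset.univ.filter fun y : {x // p x} => y.1 = x).card = if p x then 1 else 0 := by
  split_ifs with h
  · rw [Finset.card_eq_one]
    exact ⟨⟨x, h⟩, by ext y; simp [Subtype.ext_iff]⟩
  · rw [Finset.card_eq_zero, Finset.filter_eq_empty_iff]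
    rintro y - rfl
    exact h y.2

theorem sum_shieldEnd (hw : ∀ a, w a ≤ 1) (x : RingDart D fin) (b : Bool) :
    (∑ a, if (a, b) = x.1 then w a else 0) = if x.1.2 = b ∧ w x.1.1 = 1 then 1 else 0 := by
  rw [Finset.sum_eq_single x.1.1]
  · have := hw x.1.1
    by_cases hb : x.1.2 = b
    · rw [if_pos (by rw [← hb])]
      split_ifs with h
      · exact h.2
      · have : w x.1.1 ≠ 1 := fun h' => h ⟨hb, h'⟩
        omega
    · rw [if_neg fun h => hb (by rw [← h]), if_neg fun h => hb h.1]
  · intro a _ ha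
    exact if_neg fun h => ha (by rw [← h])
  · simp

/-- The missing unit comes from the old arc when that has weight 1, and from the spoke otherwise;
the spoke is present in just that case. On the inner ring, chords replace the missing spokes. -/
theorem shield_out_outer (hτ : 2 ≤ τ) (hw : ∀ a, w a ≤ 1) (x : RingDart D fin) :
    weight (shieldWeight w ρ μ τ) ((shield w fin ρ μ).outArcs {Sum.inr (x, true, true)}) = τ := by
  rw [weight_outArcs_singleton, shield_sum]
  simp [shieldEnd_eq_inr, shieldWeight, Finset.sum_add_distrib]
  have h1 : (∑ y, if ρ y = x then τ - 2 else 0) = τ - 2 := by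
    rw [Equiv.sum_comp ρ fun y => if y = x then τ - 2 else 0]; simp
  rw [h1, sum_shieldEnd hw, card_filter_val_eq (fun y => ¬ UnitOut w y)]
  by_cases h : UnitOut w x
  · rw [if_pos (show x.1.2 = false ∧ w x.1.1 = 1 from h), if_neg (not_not.2 h)]; omega
  · rw [if_neg (show ¬ (x.1.2 = false ∧ w x.1.1 = 1) from h), if_pos h]; omega

theorem shield_out_inner (hτ : 2 ≤ τ) (x : RingDart D fin) :
    weight (shieldWeight w ρ μ τ) ((shield w fin ρ μ).outArcs {Sum.inr (x, false, true)}) = τ := by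
  rw [weight_outArcs_singleton, shield_sum]
  simp [shieldEnd_eq_inr, shieldWeight, Finset.sum_add_distrib]
  rw [card_filter_val_eq (fun y => ¬ UnitIn w y), card_filter_val_eq (UnitIn w)]
  by_cases h : UnitIn w x
  · rw [if_pos h, if_neg (not_not.2 h)]; omega
  · rw [if_neg h, if_pos h]; omega

theorem shield_in_outer (hτ : 2 ≤ τ) (hw : ∀ a, w a ≤ 1) (x : RingDart D fin) :
    weight (shieldWeight w ρ μ τ) ((shield w fin ρ μ).inArcs {Sum.inr (x, true, false)}) = τ := by
  rw [weight_inArcs_singleton, shield_sum]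
  simp [shieldEnd_eq_inr, shieldWeight, Finset.sum_add_distrib]
  rw [sum_shieldEnd hw, card_filter_val_eq (fun y => ¬ UnitIn w y)]
  by_cases h : UnitIn w x
  · rw [if_pos (show x.1.2 = true ∧ w x.1.1 = 1 from h), if_neg (not_not.2 h)]; omega
  · rw [if_neg (show ¬ (x.1.2 = true ∧ w x.1.1 = 1) from h), if_pos h]; omega

theorem shield_in_inner (hτ : 2 ≤ τ) (x : RingDart D fin) :
    weight (shieldWeight w ρ μ τ) ((shield w fin ρ μ).inArcs {Sum.inr (x, false, false)}) = τ := by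
  rw [weight_inArcs_singleton, shield_sum]
  simp [shieldEnd_eq_inr, shieldWeight, Finset.sum_add_distrib]
  have h1 : (Finset.univ.filter fun y => ρ y = x).card = 1 := by
    rw [Finset.card_eq_one]
    exact ⟨ρ.symm x, by ext y; simp [Equiv.eq_symm_apply]⟩
  have h2 : (Finset.univ.filter fun y => (μ y).1 = x).card =
      (Finset.univ.filter fun y : {x // UnitOut w x} => y.1 = x).card :=
    Finset.card_equiv μ fun y => by simp
  rw [h1, h2, card_filter_val_eq (fun y => ¬ UnitOut w y), card_filter_val_eq (UnitOut w)]
  by_cases h : UnitOut w x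
  · rw [if_pos h, if_neg (not_not.2 h)]; omega
  · rw [if_neg h, if_pos h]; omega

end Shield

end DiMultigraph
end

noncomputable section
open scoped Classical
namespace DiMultigraph

/-! ### Dicuts of the shielded digraph -/

section ShieldCut

variable {D : DiMultigraph.{u}} {w : D.A → ℕ} {fin : D.V → Prop} {τ : ℕ}
  {ρ : Equiv.Perm (RingDart D fin)}
  {μ : {x : RingDart D fin // UnitIn w x} ≃ {x : RingDart D fin // UnitOut w x}}

/-- The vertex of `D` at which a ring position lies. -/
def ringVertex (x : RingDart D fin) : D.V := D.dartVertex x.1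

/-- The trace of a vertex set of the shield on one kind of ring vertices. -/
def ringTrace (U : Finset (ShieldVertex D fin)) (o t : Bool) (x : RingDart D fin) : Prop :=
  (Sum.inr (x, o, t) : ShieldVertex D fin) ∈ U

/-- The projection to `D` of a vertex set of the shield. -/
def shieldProj (U : Finset (ShieldVertex D fin)) : Finset D.V :=
  Finset.univ.filter fun v => (∃ h : fin v, (Sum.inl ⟨v, h⟩ : ShieldVertex D fin) ∈ U) ∨
    ∃ x : RingDart D fin, ringVertex x = v ∧ ringTrace U false true x

theorem mem_shieldProj {U : Finset (ShieldVertex D fin)} {v : D.V} :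
    v ∈ shieldProj U ↔ (∃ h : fin v, (Sum.inl ⟨v, h⟩ : ShieldVertex D fin) ∈ U) ∨
      ∃ x : RingDart D fin, ringVertex x = v ∧ ringTrace U false true x := by
  simp [shieldProj]

theorem isRingCut (hρ : ∀ x y, ρ.SameCycle x y ↔ ringVertex x = ringVertex y)
    (hμ : ∀ x, ringVertex (μ x).1 = ringVertex x.1) {U : Finset (shield w fin ρ μ).V}
    (hU : ∀ a, (shield w fin ρ μ).head a ∈ U → (shield w fin ρ μ).tail a ∈ U) :
    IsRingCut ringVertex ρ (UnitIn w) (UnitOut w) μ (ringTrace U true true) (ringTrace U true false)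
      (ringTrace U false true) (ringTrace U false false) where
  rot := hρ
  not_both _ h := h.not_unitOut
  match_vt := hμ
  outer_fwd x := hU (Sum.inl (Sum.inr (Sum.inl (x, true, true))))
  outer_bck x := hU (Sum.inl (Sum.inr (Sum.inl (x, true, false))))
  inner_fwd x := hU (Sum.inl (Sum.inr (Sum.inl (x, false, true))))
  inner_bck x := hU (Sum.inl (Sum.inr (Sum.inl (x, false, false))))
  spoke_in x h := hU (Sum.inl (Sum.inr (Sum.inr (Sum.inl ⟨x, h⟩))))
  spoke_out x h := hU (Sum.inl (Sum.inr (Sum.inr (Sum.inr ⟨x, h⟩))))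

section Closed

variable {U : Finset (shield w fin ρ μ).V}

/-- The hypotheses concern only the rings at the vertex of `z`, so the statement remains available
away from a single split ring. -/
theorem shieldEnd_mem_iff {z : D.Dart}
    (h : IsRingCut ringVertex ρ (UnitIn w) (UnitOut w) μ (ringTrace U true true)
      (ringTrace U true false) (ringTrace U false true) (ringTrace U false false))
    (hS : ∀ x : RingDart D fin, ringVertex x = D.dartVertex z →
      ringTrace U true true x → ringTrace U true false x)
    (hH : ∀ x : RingDart D fin, ringVertex x = D.dartVertex z →
      ringTrace U false true x → ringTrace U false false x) :
    shieldEnd fin z ∈ U ↔ D.dartVertex z ∈ shieldProj U := by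
  rw [mem_shieldProj]
  by_cases hz : fin (D.dartVertex z)
  · rw [shieldEnd_of hz]
    constructor
    · exact fun hm => Or.inl ⟨hz, hm⟩
    · rintro (⟨_, hm⟩ | ⟨x, hx, _⟩)
      · exact hm
      · exact (x.2 (by rw [show D.dartVertex x.1 = _ from hx]; exact hz)).elim
  · rw [shieldEnd_of_not hz]
    have hun : ∀ y : RingDart D fin, ringVertex y = D.dartVertex z →
        (ringTrace U true true ⟨z, hz⟩ ↔ ringTrace U false true y) := fun y hy =>
      h.unsplit (v := D.dartVertex z) hS hH rfl hy
    have hT : ringTrace U true false ⟨z, hz⟩ ↔ ringTrace U true true ⟨z, hz⟩ :=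
      ⟨h.outer_fwd _, hS _ rfl⟩
    have hb : (Sum.inr (⟨z, hz⟩, true, !z.2) : ShieldVertex D fin) ∈ U ↔
        ringTrace U true true ⟨z, hz⟩ := by
      cases z.2
      · exact Iff.rfl
      · exact hT
    rw [hb]
    constructor
    · exact fun hm => Or.inr ⟨⟨z, hz⟩, rfl, (hun _ rfl).1 hm⟩
    · rintro (⟨hf, _⟩ | ⟨x, hx, hm⟩)
      · exact (hz hf).elim
      · exact (hun x hx).2 hm

/-- A closed set that splits no ring comes from a closed set of `D`. -/
theorem shield_unsplit
    (h : IsRingCut ringVertex ρ (UnitIn w) (UnitOut w) μ (ringTrace U true true)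
      (ringTrace U true false) (ringTrace U false true) (ringTrace U false false))
    (hU : ∀ a, (shield w fin ρ μ).head a ∈ U → (shield w fin ρ μ).tail a ∈ U)
    (hne : U.Nonempty) (hne' : U ≠ Finset.univ)
    (hS : ∀ x, ringTrace U true true x → ringTrace U true false x)
    (hH : ∀ x, ringTrace U false true x → ringTrace U false false x) :
    ∃ B, D.IsDicut B ∧ (shield w fin ρ μ).outArcs U = liftArcs (shieldArc w ρ μ) B := by
  have hend : ∀ z : D.Dart, shieldEnd fin z ∈ U ↔ D.dartVertex z ∈ shieldProj U := fun z =>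
    shieldEnd_mem_iff h (fun x _ => hS x) fun x _ => hH x
  have hun : ∀ x y : RingDart D fin, ringVertex x = ringVertex y →
      (ringTrace U true true x ↔ ringTrace U false true y) := fun x y hxy =>
    h.unsplit (fun z _ => hS z) (fun z _ => hH z) hxy rfl
  have hring : ∀ (x : RingDart D fin) o t,
      ((Sum.inr (x, o, t) : ShieldVertex D fin) ∈ U ↔ ringVertex x ∈ shieldProj U) := by
    have hH' : ∀ x : RingDart D fin, ringTrace U false true x ↔ ringVertex x ∈ shieldProj U := by
      intro x
      rw [mem_shieldProj]
      constructor
      · exact fun hm => Or.inr ⟨x, rfl, hm⟩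
      · rintro (⟨hf, _⟩ | ⟨y, hy, hm⟩)
        · exact (x.2 hf).elim
        · exact (hun x x rfl).1 ((hun x y hy.symm).2 hm)
    intro x o t
    rw [← hH']
    cases o <;> cases t
    · exact ⟨h.inner_bck x, hH x⟩
    · exact Iff.rfl
    · exact ⟨fun hT => (hun x x rfl).1 (h.outer_fwd x hT), fun hh => hS x ((hun x x rfl).2 hh)⟩
    · exact hun x x rfl
  refine ⟨D.outArcs (shieldProj U), ⟨shieldProj U, ?_, fun hcon => hne' ?_,
    inArcs_eq_empty.2 fun a ha => ?_, rfl⟩, ?_⟩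
  · obtain ⟨v | ⟨x, o, t⟩, hv⟩ := hne
    · exact ⟨v.1, mem_shieldProj.2 (Or.inl ⟨v.2, hv⟩)⟩
    · exact ⟨_, (hring x o t).1 hv⟩
  · refine Finset.eq_univ_of_forall ?_
    rintro (v | ⟨x, o, t⟩)
    · rcases mem_shieldProj.1 (hcon ▸ Finset.mem_univ v.1) with ⟨_, hm⟩ | ⟨x, hx, _⟩
      · exact hm
      · exact (x.2 (by rw [show D.dartVertex x.1 = _ from hx]; exact v.2)).elim
    · rw [hring, hcon]; exact Finset.mem_univ _
  · exact (hend (a, false)).1 (hU (Sum.inl (Sum.inl a)) ((hend (a, true)).2 ha))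
  · ext a
    rw [mem_outArcs, mem_liftArcs]
    rcases a with (a | ⟨x, o, f⟩ | x | x) | x
    · have : (shieldEnd fin (a, false) ∈ U ∧ shieldEnd fin (a, true) ∉ U) ↔
          a ∈ D.outArcs (shieldProj U) := by
        rw [hend, hend, mem_outArcs]; rfl
      refine this.trans ⟨fun hm => ⟨a, hm, rfl⟩, ?_⟩
      rintro ⟨b, hb, hab⟩
      rwa [Option.some_injective _ hab]
    all_goals
      refine iff_of_false (fun hm => hm.2 ?_) (fun ⟨_, _, hab⟩ => by cases hab)
      have hm := hm.1
    · have hr : ∀ c : Bool, ringVertex (if c then ρ x else x) = ringVertex x := by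
        intro c; cases c
        · rfl
        · exact h.vt_rot x
      refine (hring _ _ _).2 ?_
      have := (hring _ _ _).1 hm
      rw [hr] at this ⊢
      exact this
    · exact (hring _ _ _).2 ((hring _ _ _).1 hm)
    · exact (hring _ _ _).2 ((hring _ _ _).1 hm)
    · refine (hring _ _ _).2 ?_
      rw [h.match_vt]
      exact (hring _ _ _).1 hm

/-- A closed set that splits exactly one ring at one place is also left by an arc of positive weight
outside the rings. -/
theorem shield_split_once (hw : IsShieldable τ w fin)
    (h : IsRingCut ringVertex ρ (UnitIn w) (UnitOut w) μ (ringTrace U true true)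
      (ringTrace U true false) (ringTrace U false true) (ringTrace U false false))
    (hU : ∀ a, (shield w fin ρ μ).head a ∈ U → (shield w fin ρ μ).tail a ∈ U)
    (hone : (Finset.univ.filter fun x => ringTrace U true true x ∧ ¬ ringTrace U true false x).card +
      (Finset.univ.filter fun x => ringTrace U false true x ∧ ¬ ringTrace U false false x).card = 1) :
    ∃ a ∈ (shield w fin ρ μ).outArcs U, 0 < shieldWeight w ρ μ τ a ∧
      ∀ r, a ≠ Sum.inl (Sum.inr (Sum.inl r)) := by
  have hA : ∀ x, ¬ UnitOut w x → ringTrace U true true x → ¬ ringTrace U false false x →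
      ∃ a ∈ (shield w fin ρ μ).outArcs U, 0 < shieldWeight w ρ μ τ a ∧
      ∀ r, a ≠ Sum.inl (Sum.inr (Sum.inl r)) := fun x hx h1 h2 =>
    ⟨Sum.inl (Sum.inr (Sum.inr (Sum.inl ⟨x, hx⟩))), mem_outArcs.2 ⟨h1, h2⟩, one_pos,
      fun r hr => by cases hr⟩
  have hB : ∀ x, ¬ UnitIn w x → ringTrace U false true x → ¬ ringTrace U true false x →
      ∃ a ∈ (shield w fin ρ μ).outArcs U, 0 < shieldWeight w ρ μ τ a ∧
      ∀ r, a ≠ Sum.inl (Sum.inr (Sum.inl r)) := fun x hx h1 h2 =>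
    ⟨Sum.inl (Sum.inr (Sum.inr (Sum.inr ⟨x, hx⟩))), mem_outArcs.2 ⟨h1, h2⟩, one_pos,
      fun r hr => by cases hr⟩
  have hE : ∀ a, shieldEnd fin (a, false) ∈ U → shieldEnd fin (a, true) ∉ U → 0 < w a →
      ∃ a ∈ (shield w fin ρ μ).outArcs U, 0 < shieldWeight w ρ μ τ a ∧
      ∀ r, a ≠ Sum.inl (Sum.inr (Sum.inl r)) := fun a h1 h2 h3 =>
    ⟨Sum.inl (Sum.inl a), mem_outArcs.2 ⟨h1, h2⟩, h3, fun r hr => by cases hr⟩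
  by_contra hcon
  -- If no such arc leaves, spokes and old arcs of positive weight carry membership forward as well
  -- as backward.
  have hA' := fun x h1 h2 => not_not.1 fun h3 => hcon (hA x h1 h2 h3)
  have hB' := fun x h1 h2 => not_not.1 fun h3 => hcon (hB x h1 h2 h3)
  have hE' := fun a h1 h3 => not_not.1 fun h2 => hcon (hE a h1 h2 h3)
  rcases Nat.add_eq_one_iff.1 hone with ⟨h0, h1⟩ | ⟨h1, h0⟩
  · have hS : ∀ x, ringTrace U true true x → ringTrace U true false x := fun x hx => by
      by_contra hx'
      exact Finset.notMem_empty x (Finset.card_eq_zero.1 h0 ▸ by simp [hx, hx'])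
    obtain ⟨x₀, hx₀⟩ := Finset.card_eq_one.1 h1
    have hx₀' := (Finset.mem_filter.1 (hx₀ ▸ Finset.mem_singleton_self x₀)).2
    rcases h.inner_split hS hx₀' with ⟨x, h2, h3, h4⟩ | ⟨x, h2, h3, h4⟩ | ⟨x, h2, h3⟩
    · exact h4 (hA' x h2 h3)
    · exact h4 (hB' x h2 h3)
    · exact hcon ⟨Sum.inr x, mem_outArcs.2 ⟨h2, h3⟩, one_pos, fun r hr => by cases hr⟩
  · have hH : ∀ x, ringTrace U false true x → ringTrace U false false x := fun x hx => by
      by_contra hx'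
      exact Finset.notMem_empty x (Finset.card_eq_zero.1 h0 ▸ by simp [hx, hx'])
    obtain ⟨x₀, hx₀⟩ := Finset.card_eq_one.1 h1
    have hx₀' : ∀ x, ringTrace U true true x ∧ ¬ ringTrace U true false x ↔ x = x₀ := fun x => by
      rw [← Finset.mem_singleton, ← hx₀]; simp
    have hend : ∀ z : D.Dart, D.dartVertex z ≠ ringVertex x₀ →
        (shieldEnd fin z ∈ U ↔ D.dartVertex z ∈ shieldProj U) := fun z hz => by
      refine shieldEnd_mem_iff h (fun x hx hSx => ?_) fun x _ => hH x
      by_contra hTx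
      have := (hx₀' x).1 ⟨hSx, hTx⟩
      exact hz (by rw [← hx, this])
    have hring : ∀ z : D.Dart, D.dartVertex z = ringVertex x₀ → ∃ x : RingDart D fin, x.1 = z ∧
        ringVertex x = ringVertex x₀ ∧ (shieldEnd fin z ∈ U ↔ ringTrace U true (!z.2) x) := by
      intro z hz
      have hf : ¬ fin (D.dartVertex z) := by rw [hz]; exact x₀.2
      exact ⟨⟨z, hf⟩, rfl, hz, by rw [shieldEnd_of_not hf]; exact Iff.rfl⟩
    have hpos : ∀ a, D.inArcs (shieldProj U) = {a} → w a = 1 →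
        ∃ b, D.tail b ∈ shieldProj U ∧ D.head b ∉ shieldProj U ∧ 0 < w b := fun a h1 h2 => by
      obtain ⟨b, hb, hb'⟩ := hw.mate _ a h1 h2
      exact ⟨b, (mem_outArcs.1 hb).1, (mem_outArcs.1 hb).2, hb'⟩
    have hcl : ∀ a, shieldEnd fin (a, true) ∈ U → shieldEnd fin (a, false) ∈ U := fun a =>
      hU (Sum.inl (Sum.inl a))
    rcases h.outer_split hH hx₀' hA' hB' with ⟨hO, hall⟩ | ⟨hI, hall⟩
    -- The set contains just one outer source at this vertex and projects to a set that avoids the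
    -- vertex.
    · have hv₀ : ringVertex x₀ ∉ shieldProj U := fun hm => by
        rcases mem_shieldProj.1 hm with ⟨hf, _⟩ | ⟨x, hx, hm⟩
        · exact x₀.2 hf
        · exact (hall x hx).1 hm
      have hx₀e : x₀.1 = (x₀.1.1, false) := by rw [← hO.1]
      have htail : D.tail x₀.1.1 = ringVertex x₀ := by
        change D.dartVertex (x₀.1.1, false) = D.dartVertex x₀.1; rw [← hx₀e]
      have h1 : shieldEnd fin (x₀.1.1, false) ∈ U := by
        rw [← hx₀e, shieldEnd_of_not x₀.2]
        have := ((hx₀' x₀).2 rfl).1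
        rw [hO.1]
        exact this
      have h2 := hE' _ h1 (by rw [hO.2]; exact one_pos)
      have hne : D.head x₀.1.1 ≠ ringVertex x₀ := by
        rw [← htail]; exact (D.tail_ne_head _).symm
      -- The unit arc at `x₀` must end inside the projection. Any entering arc has its tail end in
      -- `U` by closedness, hence starts at position `x₀`, the only one available at the vertex.
      have h3 : D.inArcs (shieldProj U) = {x₀.1.1} := by
        ext a
        rw [mem_inArcs, Finset.mem_singleton]
        constructor
        · rintro ⟨ht, hh⟩
          have hh' : D.head a ≠ ringVertex x₀ := fun he => hv₀ (he ▸ hh)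
          have h4 := hcl a ((hend (a, true) hh').2 hh)
          by_cases he : D.tail a = ringVertex x₀
          · obtain ⟨x, hx, hxv, hiff⟩ := hring (a, false) he
            have := (hall x hxv).2.2 (hiff.1 h4)
            rw [← this, hx]
          · exact (ht ((hend (a, false) he).1 h4)).elim
        · rintro rfl
          exact ⟨by rwa [htail], (hend (x₀.1.1, true) hne).1 h2⟩
      -- The arc `b` of positive weight leaves the projection, hence also `U`: away from the vertex
      -- membership is that of the projection, and at the vertex no outer sink lies in `U`.
      obtain ⟨b, hb1, hb2, hb3⟩ := hpos _ h3 hO.2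
      have ht : D.tail b ≠ ringVertex x₀ := fun he => hv₀ (he ▸ hb1)
      have h5 := hE' b ((hend (b, false) ht).2 hb1) hb3
      by_cases he : D.head b = ringVertex x₀
      · obtain ⟨x, hx, hxv, hiff⟩ := hring (b, true) he
        exact (hall x hxv).2.1 (hiff.1 h5)
      · exact hb2 ((hend (b, true) he).1 h5)
    -- The dual case: only one outer sink at the vertex is missing, and its unit arc is the only one
    -- entering the projection.
    · have hv₀ : ringVertex x₀ ∈ shieldProj U :=
        mem_shieldProj.2 (Or.inr ⟨x₀, rfl, (hall x₀ rfl).1⟩)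
      have hx₀e : x₀.1 = (x₀.1.1, true) := by rw [← hI.1]
      have hhead : D.head x₀.1.1 = ringVertex x₀ := by
        change D.dartVertex (x₀.1.1, true) = D.dartVertex x₀.1; rw [← hx₀e]
      have h1 : shieldEnd fin (x₀.1.1, true) ∉ U := by
        rw [← hx₀e, shieldEnd_of_not x₀.2]
        have := ((hx₀' x₀).2 rfl).2
        rw [hI.1]
        exact this
      have h2 : shieldEnd fin (x₀.1.1, false) ∉ U := fun hm =>
        h1 (hE' _ hm (by rw [hI.2]; exact one_pos))
      have hne : D.tail x₀.1.1 ≠ ringVertex x₀ := by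
        rw [← hhead]; exact D.tail_ne_head _
      have h3 : D.inArcs (shieldProj U) = {x₀.1.1} := by
        ext a
        rw [mem_inArcs, Finset.mem_singleton]
        constructor
        · rintro ⟨ht, hh⟩
          have ht' : D.tail a ≠ ringVertex x₀ := fun he => ht (he ▸ hv₀)
          have h4 : shieldEnd fin (a, true) ∉ U := fun hm =>
            ht ((hend (a, false) ht').1 (hcl a hm))
          by_cases he : D.head a = ringVertex x₀
          · obtain ⟨x, hx, hxv, hiff⟩ := hring (a, true) he
            have := (hall x hxv).2.2 fun hT => h4 (hiff.2 hT)
            rw [← this, hx]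
          · exact (h4 ((hend (a, true) he).2 hh)).elim
        · rintro rfl
          exact ⟨fun hm => h2 ((hend (x₀.1.1, false) hne).2 hm), by rwa [hhead]⟩
      obtain ⟨b, hb1, hb2, hb3⟩ := hpos _ h3 hI.2
      have hh : D.head b ≠ ringVertex x₀ := fun he => hb2 (he ▸ hv₀)
      have h4 : shieldEnd fin (b, false) ∈ U := by
        by_cases he : D.tail b = ringVertex x₀
        · obtain ⟨x, hx, hxv, hiff⟩ := hring (b, false) he
          exact hiff.2 (hall x hxv).2.1
        · exact (hend (b, false) he).2 hb1
      exact hb2 ((hend (b, true) hh).1 (hE' b h4 hb3))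

end Closed

end ShieldCut

end DiMultigraph
end

noncomputable section
open scoped Classical
namespace DiMultigraph

/-! ### Weights of dicuts, degrees and `ρ` of the shielded digraph -/

section ShieldWeight

variable {D : DiMultigraph.{u}} {w : D.A → ℕ} {fin : D.V → Prop} {τ : ℕ}
  {ρ : Equiv.Perm (RingDart D fin)}
  {μ : {x : RingDart D fin // UnitIn w x} ≃ {x : RingDart D fin // UnitOut w x}}

/-- The weight of the ring arcs leaving a closed set. -/
theorem ring_weight (hτ : 2 ≤ τ) {U : Finset (shield w fin ρ μ).V}
    (h : IsRingCut ringVertex ρ (UnitIn w) (UnitOut w) μ (ringTrace U true true)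
      (ringTrace U true false) (ringTrace U false true) (ringTrace U false false)) :
    weight (shieldWeight w ρ μ τ) (((shield w fin ρ μ).outArcs U).filter
      fun a => ∃ r, a = Sum.inl (Sum.inr (Sum.inl r))) =
    (τ - 1) * ((Finset.univ.filter fun x => ringTrace U true true x ∧ ¬ ringTrace U true false x).card +
      (Finset.univ.filter fun x => ringTrace U false true x ∧ ¬ ringTrace U false false x).card) := by
  have h0 : weight (shieldWeight w ρ μ τ) (((shield w fin ρ μ).outArcs U).filter
      fun a => ∃ r, a = Sum.inl (Sum.inr (Sum.inl r))) =
      ∑ a, if (∃ r, a = Sum.inl (Sum.inr (Sum.inl r))) ∧ a ∈ (shield w fin ρ μ).outArcs U then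
        shieldWeight w ρ μ τ a else 0 := by
    rw [weight, ← Finset.sum_filter]
    refine Finset.sum_congr ?_ fun _ _ => rfl
    ext a
    simp only [Finset.mem_filter, Finset.mem_univ, true_and]
    exact and_comm
  have hr : ∀ (x : RingDart D fin) (o f : Bool) (p : Prop) [Decidable p],
      (Sum.inl (Sum.inr (Sum.inl (x, o, f))) ∈ (shield w fin ρ μ).outArcs U ↔ p) →
      (if (∃ r, (Sum.inl (Sum.inr (Sum.inl (x, o, f))) : (shield w fin ρ μ).A) =
        Sum.inl (Sum.inr (Sum.inl r))) ∧
        Sum.inl (Sum.inr (Sum.inl (x, o, f))) ∈ (shield w fin ρ μ).outArcs U then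
        shieldWeight w ρ μ τ (Sum.inl (Sum.inr (Sum.inl (x, o, f)))) else 0) =
      if p then (if f then 1 else τ - 2) else 0 := fun x o f p _ hp =>
    if_congr ((and_iff_right ⟨_, rfl⟩).trans hp) rfl rfl
  have hz : ∀ {ι : Type u} [Fintype ι] (f : ι → (shield w fin ρ μ).A),
      (∀ i r, f i ≠ Sum.inl (Sum.inr (Sum.inl r))) →
      (∑ i, if (∃ r, f i = Sum.inl (Sum.inr (Sum.inl r))) ∧ f i ∈ (shield w fin ρ μ).outArcs U then
        shieldWeight w ρ μ τ (f i) else 0) = 0 := fun f hf =>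
    Finset.sum_eq_zero fun i _ => if_neg fun ⟨⟨r, hr⟩, _⟩ => hf i r hr
  rw [h0, shield_sum (μ := μ), hz (fun a => Sum.inl (Sum.inl a)) (fun _ _ h => by cases h),
    hz (fun x => Sum.inl (Sum.inr (Sum.inr (Sum.inl x)))) (fun _ _ h => by cases h),
    hz (fun x => Sum.inl (Sum.inr (Sum.inr (Sum.inr x)))) (fun _ _ h => by cases h),
    hz (fun x => Sum.inr x) (fun _ _ h => by cases h)]
  rw [Finset.sum_congr rfl fun x _ => congrArg₂ (· + ·)
    (congrArg₂ (· + ·)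
      (hr x true true (ringTrace U true true x ∧ ¬ ringTrace U true false x) mem_outArcs)
      (hr x true false (ringTrace U true true (ρ x) ∧ ¬ ringTrace U true false x) mem_outArcs))
    (congrArg₂ (· + ·)
      (hr x false true (ringTrace U false true x ∧ ¬ ringTrace U false false (ρ x)) mem_outArcs)
      (hr x false false (ringTrace U false true x ∧ ¬ ringTrace U false false x) mem_outArcs))]
  have hs : ∀ (R : RingDart D fin → Prop) [DecidablePred R] (c : ℕ), (∑ x, if R x then c else 0) =
      (Finset.univ.filter R).card * c := fun R _ c => by
    rw [← Finset.sum_filter, Finset.sum_const, smul_eq_mul]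
  rw [Finset.sum_add_distrib, Finset.sum_add_distrib, Finset.sum_add_distrib, hs, hs, hs, hs]
  -- In either ring, arcs of weight 1 and arcs of weight `τ - 2` leave in equal numbers, so each
  -- unit of excess costs `τ - 1`.
  rw [h.card_outer, h.card_inner]
  obtain ⟨t, rfl⟩ := Nat.exists_eq_add_of_le hτ
  have h1 : 2 + t - 1 = t + 1 := by omega
  simp only [h1, Nat.add_sub_cancel_left, if_true, Bool.false_eq_true, if_false]
  ring

/-- The excess `n` of sources over sinks in all rings decides: `n = 0` gives an old dicut. For `n >
0` some ring arc of positive weight leaves, and the weight `(τ - 1) n` is already at least `τ`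
unless `n = 1`, when one further arc completes it. -/
theorem shield_dicut_cases (hτ : 2 ≤ τ) (hw : IsShieldable τ w fin)
    (hρ : ∀ x y, ρ.SameCycle x y ↔ ringVertex x = ringVertex y)
    (hμ : ∀ x, ringVertex (μ x).1 = ringVertex x.1) {B' : Finset (shield w fin ρ μ).A}
    (hB' : (shield w fin ρ μ).IsDicut B') :
    (∃ B, D.IsDicut B ∧ B' = liftArcs (shieldArc w ρ μ) B) ∨
      ((∃ a ∈ B', 0 < shieldWeight w ρ μ τ a ∧ shieldArc w ρ μ a = none) ∧
        τ ≤ weight (shieldWeight w ρ μ τ) B') := by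
  obtain ⟨U, hne, hne', hin, rfl⟩ := hB'
  have hU := inArcs_eq_empty.1 hin
  have h := isRingCut hρ hμ hU
  have hrw := ring_weight hτ h
  set n := (Finset.univ.filter fun x => ringTrace U true true x ∧ ¬ ringTrace U true false x).card +
      (Finset.univ.filter fun x => ringTrace U false true x ∧ ¬ ringTrace U false false x).card with hn
  have hle := Finset.sum_le_sum_of_subset (f := shieldWeight w ρ μ τ)
    (Finset.filter_subset (fun a => ∃ r, a = Sum.inl (Sum.inr (Sum.inl r)))
      ((shield w fin ρ μ).outArcs U))
  by_cases hn0 : n = 0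
  · left
    have h1 : ∀ (R R' : RingDart D fin → Prop),
        (Finset.univ.filter fun x => R x ∧ ¬ R' x).card = 0 → ∀ x, R x → R' x := by
      intro R R' h0 x hx
      by_contra hx'
      exact Finset.notMem_empty x (Finset.card_eq_zero.1 h0 ▸ by simp [hx, hx'])
    exact shield_unsplit h hU hne hne' (h1 _ _ (by omega)) (h1 _ _ (by omega))
  · right
    constructor
    · have hpos : 0 < weight (shieldWeight w ρ μ τ) (((shield w fin ρ μ).outArcs U).filter
          fun a => ∃ r, a = Sum.inl (Sum.inr (Sum.inl r))) := by
        rw [hrw]; exact Nat.mul_pos (by omega) (Nat.pos_of_ne_zero hn0)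
      obtain ⟨a, ha, ha'⟩ := Finset.sum_pos_iff.1 hpos
      obtain ⟨h2, r, rfl⟩ := Finset.mem_filter.1 ha
      exact ⟨_, h2, ha', rfl⟩
    · by_cases hn1 : n = 1
      · obtain ⟨a, ha, ha', har⟩ := shield_split_once hw h hU hn1
        have hsub : insert a (((shield w fin ρ μ).outArcs U).filter
            fun a => ∃ r, a = Sum.inl (Sum.inr (Sum.inl r))) ⊆ (shield w fin ρ μ).outArcs U :=
          Finset.insert_subset ha (Finset.filter_subset _ _)
        have h3 := Finset.sum_le_sum_of_subset (f := shieldWeight w ρ μ τ) hsub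
        rw [Finset.sum_insert fun hm => by
          obtain ⟨r, hr⟩ := (Finset.mem_filter.1 hm).2; exact har r hr] at h3
        rw [weight] at hrw ⊢
        rw [hrw, hn1, mul_one] at h3
        omega
      · rw [weight] at hrw ⊢
        rw [hrw] at hle
        refine le_trans ?_ hle
        have : 2 ≤ n := by omega
        calc τ ≤ (τ - 1) * 2 := by omega
          _ ≤ (τ - 1) * n := Nat.mul_le_mul_left _ this

theorem sum_shieldArc (a : D.A) :
    ∑ a' with shieldArc w ρ μ a' = some a, shieldWeight w ρ μ τ a' = w a := by
  rw [Finset.sum_filter, shield_sum]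
  simp [shieldArc, shieldWeight]

theorem shield_lift (hρ : ∀ x y, ρ.SameCycle x y ↔ ringVertex x = ringVertex y)
    (hμ : ∀ x, ringVertex (μ x).1 = ringVertex x.1)
    (hc : D.CutConnected) {B : Finset D.A} (hB : D.IsDicut B) :
    (shield w fin ρ μ).IsDicut (liftArcs (shieldArc w ρ μ) B) := by
  obtain ⟨C, ⟨v₀, hv₀⟩, hC', hin, rfl⟩ := hB
  rw [inArcs_eq_empty] at hin
  -- Connectedness ensures that every vertex has a dart. A vertex without darts would leave no ring
  -- behind, and the preimage of `C` could become empty or everything.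
  obtain ⟨a₀, _⟩ := hc C ⟨v₀, hv₀⟩ hC'
  have : Nonempty D.A := ⟨a₀⟩
  set U : Finset (shield w fin ρ μ).V := Finset.univ.filter fun v =>
    Sum.elim (fun v => v.1 ∈ C) (fun r => ringVertex r.1 ∈ C) (v : ShieldVertex D fin) with hU
  have hmem : ∀ v, v ∈ U ↔ Sum.elim (fun v => v.1 ∈ C) (fun r => ringVertex r.1 ∈ C)
    (v : ShieldVertex D fin) := fun v => by simp [hU]
  have hend : ∀ z : D.Dart, shieldEnd fin z ∈ U ↔ D.dartVertex z ∈ C := by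
    intro z
    rw [hmem]
    by_cases hz : fin (D.dartVertex z)
    · rw [shieldEnd_of hz]; exact Iff.rfl
    · rw [shieldEnd_of_not hz]; exact Iff.rfl
  have hrot : ∀ x, ringVertex (ρ x) = ringVertex x := fun x =>
    ((hρ _ _).1 (Equiv.Perm.sameCycle_apply_right.2 (Equiv.Perm.SameCycle.refl ρ x))).symm
  have hif : ∀ (c : Bool) x, ringVertex (if c then ρ x else x) = ringVertex x := by
    intro c x; cases c
    · rfl
    · exact hrot x
  have hnew : ∀ a, shieldArc w ρ μ a = none →
      ((shield w fin ρ μ).tail a ∈ U ↔ (shield w fin ρ μ).head a ∈ U) := by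
    rintro ((a | ⟨x, o, f⟩ | x | x) | x) ha
    · cases ha
    · rw [hmem, hmem]
      change ringVertex (if _ then _ else _) ∈ C ↔ ringVertex (if _ then _ else _) ∈ C
      rw [hif, hif]
    · rw [hmem, hmem]; exact Iff.rfl
    · rw [hmem, hmem]; exact Iff.rfl
    · rw [hmem, hmem]
      change ringVertex x.1 ∈ C ↔ ringVertex (μ x).1 ∈ C
      rw [hμ]
  have hcases : ∀ a, shieldArc w ρ μ a = none ∨ ∃ b, a = Sum.inl (Sum.inl b) := by
    rintro ((a | ⟨x, o, f⟩ | x | x) | x)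
    · exact Or.inr ⟨a, rfl⟩
    all_goals exact Or.inl rfl
  have hall : ∀ v : D.V, ∃ u : ShieldVertex D fin, Sum.elim (fun v => v.1) (fun r => ringVertex r.1) u = v := by
    intro v
    by_cases hf : fin v
    · exact ⟨Sum.inl ⟨v, hf⟩, rfl⟩
    · obtain ⟨x, rfl⟩ := hc.exists_dart v
      exact ⟨Sum.inr (⟨x, hf⟩, true, true), rfl⟩
  have hmem' : ∀ u : ShieldVertex D fin, u ∈ U ↔
      Sum.elim (fun v => v.1) (fun r => ringVertex r.1) u ∈ C := by
    intro u; rw [hmem]; rcases u with u | u <;> rfl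
  refine ⟨U, ?_, fun hcon => hC' (Finset.eq_univ_of_forall fun v => ?_),
    inArcs_eq_empty.2 fun a ha => ?_, ?_⟩
  · obtain ⟨u, rfl⟩ := hall v₀
    exact ⟨u, (hmem' u).2 hv₀⟩
  · obtain ⟨u, rfl⟩ := hall v
    rw [← hmem', hcon]; exact Finset.mem_univ _
  · rcases hcases a with h0 | ⟨b, rfl⟩
    · exact (hnew a h0).2 ha
    · exact (hend (b, false)).2 (hin b ((hend (b, true)).1 ha))
  · ext a
    rw [mem_outArcs, mem_liftArcs]
    rcases hcases a with h0 | ⟨b, rfl⟩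
    · rw [h0, hnew a h0]; simp
    · have : (shieldEnd fin (b, false) ∈ U ∧ shieldEnd fin (b, true) ∉ U) ↔ b ∈ D.outArcs C := by
        rw [hend, hend, mem_outArcs]; rfl
      refine Iff.trans ⟨?_, fun hm => ⟨b, hm, rfl⟩⟩ this.symm
      rintro ⟨c, hc, hbc⟩
      rwa [Option.some_injective _ hbc]

theorem shield_cutLift (hτ : 2 ≤ τ) (hw : IsShieldable τ w fin)
    (hρ : ∀ x y, ρ.SameCycle x y ↔ ringVertex x = ringVertex y)
    (hμ : ∀ x, ringVertex (μ x).1 = ringVertex x.1) :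
    CutLift w (shieldWeight w ρ μ τ) (shieldArc w ρ μ) := by
  refine ⟨sum_shieldArc, fun a => ⟨Sum.inl (Sum.inl a), rfl⟩,
    fun B hB => shield_lift hρ hμ (hw.dicuts.cutConnected (by omega)) hB, fun B' hB' hpos => ?_⟩
  rcases shield_dicut_cases hτ hw hρ hμ hB' with h | ⟨⟨a, h1, h2, h3⟩, _⟩
  · exact h
  · exact (hpos a h1 h2 h3).elim

theorem shield_dicutsAtLeast (hτ : 2 ≤ τ) (hw : IsShieldable τ w fin)
    (hρ : ∀ x y, ρ.SameCycle x y ↔ ringVertex x = ringVertex y)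
    (hμ : ∀ x, ringVertex (μ x).1 = ringVertex x.1) : DicutsAtLeast (shieldWeight w ρ μ τ) τ := by
  intro B' hB'
  rcases shield_dicut_cases hτ hw hρ hμ hB' with ⟨B, hB, rfl⟩ | ⟨_, h⟩
  · rw [CutLift.weight_liftArcs sum_shieldArc]; exact hw.dicuts B hB
  · exact h

theorem shield_wdeg_fin (v : {v // fin v}) :
    wdeg (D := shield w fin ρ μ) (shieldWeight w ρ μ τ) (Sum.inl v) = wdeg w v.1 := by
  rw [wdeg, shield_out_fin, shield_in_fin, wdeg]

theorem shield_wdeg_ring (hτ : 2 ≤ τ) (hw : ∀ a, w a ≤ 1) (r : RingDart D fin × Bool × Bool) :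
    wdeg (D := shield w fin ρ μ) (shieldWeight w ρ μ τ) (Sum.inr r) = τ := by
  obtain ⟨x, o, t⟩ := r
  rw [wdeg]
  cases t
  · rw [shield_out_sink]
    cases o
    · rw [shield_in_inner hτ, zero_add]
    · rw [shield_in_outer hτ hw, zero_add]
  · rw [shield_in_source]
    cases o
    · rw [shield_out_inner hτ, add_zero]
    · rw [shield_out_outer hτ hw, add_zero]

theorem shield_isSource_ring (x : RingDart D fin) (o : Bool) :
    (shield w fin ρ μ).IsSource (Sum.inr (x, o, true)) := by
  rintro ((a | r | y | y) | y) h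
  · have := (shieldEnd_eq_inr.1 h).2.2
    cases this
  all_goals simp at h

theorem shield_isSink_ring (x : RingDart D fin) (o : Bool) :
    (shield w fin ρ μ).IsSink (Sum.inr (x, o, false)) := by
  rintro ((a | r | y | y) | y) h
  · have := (shieldEnd_eq_inr.1 h).2.2
    cases this
  all_goals simp at h

theorem shield_isSource_fin {v : {v // fin v}} :
    (shield w fin ρ μ).IsSource (Sum.inl v) ↔ D.IsSource v.1 := by
  constructor
  · exact fun h a ha => h (Sum.inl (Sum.inl a)) (shieldEnd_eq_inl.2 ha)
  · rintro h ((a | r | y | y) | y) ha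
    · exact h a (shieldEnd_eq_inl.1 ha)
    all_goals cases ha

theorem shield_isSink_fin {v : {v // fin v}} :
    (shield w fin ρ μ).IsSink (Sum.inl v) ↔ D.IsSink v.1 := by
  constructor
  · exact fun h a ha => h (Sum.inl (Sum.inl a)) (shieldEnd_eq_inl.2 ha)
  · rintro h ((a | r | y | y) | y) ha
    · exact h a (shieldEnd_eq_inl.1 ha)
    all_goals cases ha

theorem shield_isTauBipartite (hτ : 2 ≤ τ) (hw : IsShieldable τ w fin)
    (hρ : ∀ x y, ρ.SameCycle x y ↔ ringVertex x = ringVertex y)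
    (hμ : ∀ x, ringVertex (μ x).1 = ringVertex x.1) :
    IsTauBipartite (D := shield w fin ρ μ) τ (shieldWeight w ρ μ τ) where
  bipartite := by
    rintro (v | ⟨x, o, _ | _⟩)
    · rw [shield_isSource_fin, shield_isSink_fin]; exact hw.source_or_sink v.1 v.2
    · exact Or.inr (shield_isSink_ring x o)
    · exact Or.inl (shield_isSource_ring x o)
  wdeg_eq := by
    rintro (v | r)
    · rw [shield_wdeg_fin]; exact hw.wdeg_eq v.1 v.2
    · exact Or.inl (shield_wdeg_ring hτ hw.le_one r)
  stable := by
    -- Ring vertices have degree `τ`, so vertices of degree `τ + 1` are old terminals, and no old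
    -- arc joins two terminals.
    have h : ∀ u, wdeg (D := shield w fin ρ μ) (shieldWeight w ρ μ τ) u = τ + 1 → ∃ v, u = Sum.inl v := by
      rintro (v | r) hu
      · exact ⟨v, rfl⟩
      · rw [shield_wdeg_ring hτ hw.le_one r] at hu; omega
    rintro ((a | r | y | y) | y) ⟨h1, h2⟩ <;> obtain ⟨v, hv⟩ := h _ h1 <;>
      obtain ⟨v', hv'⟩ := h _ h2
    · have e1 : D.tail a = v.1 := shieldEnd_eq_inl.1 hv
      have e2 : D.head a = v'.1 := shieldEnd_eq_inl.1 hv'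
      exact hw.not_adj a ⟨e1 ▸ v.2, e2 ▸ v'.2⟩
    all_goals cases hv
  dicuts := shield_dicutsAtLeast hτ hw hρ hμ

theorem shieldWeight_pos (hτ : 3 ≤ τ) (hw : ∀ a, 0 < w a) (a : (shield w fin ρ μ).A) :
    0 < shieldWeight w ρ μ τ a := by
  rcases a with (a | ⟨x, o, _ | _⟩ | y | y) | y
  · exact hw a
  · change 0 < τ - 2; omega
  all_goals exact one_pos

theorem shield_isSinkRegular (hτ : 2 ≤ τ) (hw : ∀ a, w a ≤ 1)
    (h : ∀ v, fin v → D.IsSink v → wdeg w v = τ) :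
    IsSinkRegular (D := shield w fin ρ μ) τ (shieldWeight w ρ μ τ) := by
  rintro (v | r) hv
  · rw [shield_wdeg_fin]; exact h v.1 v.2 (shield_isSink_fin.1 hv)
  · exact shield_wdeg_ring hτ hw r

/-- Each ring position contributes two sources and two sinks, so only the terminals matter. -/
theorem shield_isBalanced (h : (Finset.univ.filter fun v => fin v ∧ D.IsSource v).card =
    (Finset.univ.filter fun v => fin v ∧ D.IsSink v).card) : (shield w fin ρ μ).IsBalanced := by
  have h1 : ∀ (x : RingDart D fin) o t, (shield w fin ρ μ).IsSource (Sum.inr (x, o, t)) ↔ t = true := by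
    rintro x o (_ | _)
    · refine iff_of_false (fun hs => ?_) (by simp)
      cases o
      · exact hs (Sum.inl (Sum.inr (Sum.inl (x, false, false)))) rfl
      · exact hs (Sum.inl (Sum.inr (Sum.inl (x, true, true)))) rfl
    · exact iff_of_true (shield_isSource_ring x o) rfl
  have h2 : ∀ (x : RingDart D fin) o t, (shield w fin ρ μ).IsSink (Sum.inr (x, o, t)) ↔ t = false := by
    rintro x o (_ | _)
    · exact iff_of_true (shield_isSink_ring x o) rfl
    · refine iff_of_false (fun hs => ?_) (by simp)
      cases o
      · exact hs (Sum.inl (Sum.inr (Sum.inl (x, false, true)))) rfl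
      · exact hs (Sum.inl (Sum.inr (Sum.inl (x, true, true)))) rfl
  have key : ∀ (R : (shield w fin ρ μ).V → Prop) (R₀ : D.V → Prop) (b : Bool),
      (∀ v, R (Sum.inl v) ↔ R₀ v.1) → (∀ x o t, R (Sum.inr (x, o, t)) ↔ t = b) →
      (Finset.univ.filter R).card = (Finset.univ.filter fun v => fin v ∧ R₀ v).card +
        Fintype.card (RingDart D fin × Bool) := by
    intro R R₀ b hR hR'
    have : (Finset.univ.filter R).card = ∑ v : ShieldVertex D fin, if R v then 1 else 0 := by
      rw [Finset.card_filter]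
    rw [this, Fintype.sum_sum_type]
    congr 1
    · rw [Finset.sum_congr rfl fun v _ => if_congr (hR v) rfl rfl, ← Finset.card_filter,
        ← Finset.card_map (Function.Embedding.subtype _)]
      congr 1
      ext v; simp; tauto
    · rw [Finset.sum_congr rfl fun r _ => if_congr (hR' r.1 r.2.1 r.2.2) rfl rfl]
      rw [Fintype.sum_prod_type, Fintype.card_prod, Fintype.card_bool, ← Finset.card_univ,
        ← smul_eq_mul, ← Finset.sum_const]
      refine Finset.sum_congr rfl fun x _ => ?_
      rw [Fintype.sum_prod_type]
      cases b <;> simp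
  rw [IsBalanced, key _ _ true (fun v => shield_isSource_fin) h1,
    key _ _ false (fun v => shield_isSink_fin) h2, h]

/-- The net weight at a ring vertex is `τ` or `-τ`, with residue 0. -/
theorem shield_rho (hτ : 2 ≤ τ) (hw : ∀ a, w a ≤ 1) :
    rho (D := shield w fin ρ μ) τ (shieldWeight w ρ μ τ) = (1 / (τ : ℚ)) * ∑ v : {v // fin v},
      ((((weight w (D.outArcs {v.1}) : ℤ) - (weight w (D.inArcs {v.1}) : ℤ)) % (τ : ℤ) : ℤ) : ℚ) := by
  rw [rho, Fintype.sum_sum_type]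
  congr 1
  rw [Finset.sum_congr rfl fun v _ => by rw [shield_out_fin, shield_in_fin]]
  refine add_eq_left.2 (Finset.sum_eq_zero ?_)
  rintro ⟨x, o, _ | _⟩ -
  · rw [shield_out_sink]
    cases o
    · rw [shield_in_inner hτ]; simp
    · rw [shield_in_outer hτ hw]; simp
  · rw [shield_in_source]
    cases o
    · rw [shield_out_inner hτ]; simp
    · rw [shield_out_outer hτ hw]; simp

end ShieldWeight

end DiMultigraph
end

noncomputable section
open scoped Classical
namespace DiMultigraph

/-! ### A rotation system for the shield without chords -/

section ShieldRotation

variable {D : DiMultigraph.{u}} (w : D.A → ℕ) {fin : D.V → Prop} (σ : Equiv.Perm D.Dart)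
  (ρ : Equiv.Perm (RingDart D fin))

/-- The darts of the shield without chords. -/
abbrev ShieldDart : Type u := (shieldRing w fin ρ).Dart

variable {w ρ} in
/-- An old dart. -/
abbrev extDart (z : D.Dart) : ShieldDart w ρ := (Sum.inl z.1, z.2)

variable {w ρ} in
/-- A dart of a ring arc. -/
abbrev ringDart (x : RingDart D fin) (o f b : Bool) : ShieldDart w ρ := (Sum.inr (Sum.inl (x, o, f)), b)

variable {w ρ} in
/-- A dart of an inward spoke. -/
abbrev inDart (x : {x : RingDart D fin // ¬ UnitOut w x}) (b : Bool) : ShieldDart w ρ :=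
  (Sum.inr (Sum.inr (Sum.inl x)), b)

variable {w ρ} in
/-- A dart of an outward spoke. -/
abbrev outDart (x : {x : RingDart D fin // ¬ UnitIn w x}) (b : Bool) : ShieldDart w ρ :=
  (Sum.inr (Sum.inr (Sum.inr x)), b)

/-- The rotation system of the shield without chords. -/
def shieldNext : ShieldDart w ρ → ShieldDart w ρ
  -- At an outer source the order is: old dart, arc to the sink of the same position, inward spoke,
  -- arc to the sink of the preceding position; absent darts are skipped. The other ring vertices
  -- follow the same picture of concentric rings.
  | (Sum.inl a, b) => if h : fin (D.dartVertex (a, b)) then extDart (σ (a, b))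
      else if b then ringDart ⟨(a, b), h⟩ true false true else ringDart ⟨(a, b), h⟩ true true false
  | (Sum.inr (Sum.inl (x, true, true)), false) =>
      if h : UnitOut w x then ringDart (ρ.symm x) true false false else inDart ⟨x, h⟩ false
  | (Sum.inr (Sum.inl (x, true, true)), true) =>
      if x.1.2 then extDart x.1 else ringDart x true false true
  | (Sum.inr (Sum.inl (x, true, false)), false) =>
      if (ρ x).1.2 then ringDart (ρ x) true true false else extDart (ρ x).1
  | (Sum.inr (Sum.inl (x, true, false)), true) =>
      if h : UnitIn w x then ringDart x true true true else outDart ⟨x, h⟩ true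
  | (Sum.inr (Sum.inl (x, false, true)), true) =>
      if h : UnitOut w (ρ x) then ringDart (ρ x) false false true else inDart ⟨ρ x, h⟩ true
  | (Sum.inr (Sum.inl (x, false, true)), false) => ringDart x false false false
  | (Sum.inr (Sum.inl (x, false, false)), false) =>
      if h : UnitIn w x then ringDart x false true false else outDart ⟨x, h⟩ false
  | (Sum.inr (Sum.inl (x, false, false)), true) => ringDart (ρ.symm x) false true true
  | (Sum.inr (Sum.inr (Sum.inl x)), false) => ringDart (ρ.symm x.1) true false false
  | (Sum.inr (Sum.inr (Sum.inl x)), true) => ringDart x.1 false false true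
  | (Sum.inr (Sum.inr (Sum.inr x)), false) => ringDart x.1 false true false
  | (Sum.inr (Sum.inr (Sum.inr x)), true) => ringDart x.1 true true true

variable {w σ ρ}

theorem next_ext_of {z : D.Dart} (h : fin (D.dartVertex z)) :
    shieldNext w σ ρ (extDart z) = extDart (σ z) := dif_pos h

theorem next_ext_in {x : RingDart D fin} (h : x.1.2 = true) :
    shieldNext w σ ρ (extDart x.1) = ringDart x true false true := (dif_neg x.2).trans (if_pos h)

theorem next_ext_out {x : RingDart D fin} (h : x.1.2 = false) :
    shieldNext w σ ρ (extDart x.1) = ringDart x true true false :=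
  (dif_neg x.2).trans (if_neg (by simp [h]))

theorem next_ring_ttf (x : RingDart D fin) : shieldNext w σ ρ (ringDart x true true false) =
    if h : UnitOut w x then ringDart (ρ.symm x) true false false else inDart ⟨x, h⟩ false := rfl

theorem next_ring_ttt (x : RingDart D fin) : shieldNext w σ ρ (ringDart x true true true) =
    if x.1.2 then extDart x.1 else ringDart x true false true := rfl

theorem next_ring_tff (x : RingDart D fin) : shieldNext w σ ρ (ringDart x true false false) =
    if (ρ x).1.2 then ringDart (ρ x) true true false else extDart (ρ x).1 := rfl

theorem next_ring_tft (x : RingDart D fin) : shieldNext w σ ρ (ringDart x true false true) =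
    if h : UnitIn w x then ringDart x true true true else outDart ⟨x, h⟩ true := rfl

theorem next_ring_ftt (x : RingDart D fin) : shieldNext w σ ρ (ringDart x false true true) =
    if h : UnitOut w (ρ x) then ringDart (ρ x) false false true else inDart ⟨ρ x, h⟩ true := rfl

theorem next_ring_fff (x : RingDart D fin) : shieldNext w σ ρ (ringDart x false false false) =
    if h : UnitIn w x then ringDart x false true false else outDart ⟨x, h⟩ false := rfl

theorem next_ring_fft (x : RingDart D fin) : shieldNext w σ ρ (ringDart x false false true) =
    ringDart (ρ.symm x) false true true := rfl

theorem shieldDart_cases (z : ShieldDart w ρ) : (∃ z₀ : D.Dart, fin (D.dartVertex z₀) ∧ z = extDart z₀) ∨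
    (∃ x : RingDart D fin, x.1.2 = true ∧ z = extDart x.1) ∨
    (∃ x : RingDart D fin, x.1.2 = false ∧ z = extDart x.1) ∨
    (∃ x o f b, z = ringDart x o f b) ∨ (∃ x b, z = inDart x b) ∨ ∃ x b, z = outDart x b := by
  rcases z with ⟨a | ⟨x, o, f⟩ | x | x, b⟩
  · by_cases h : fin (D.dartVertex (a, b))
    · exact Or.inl ⟨(a, b), h, rfl⟩
    · cases b
      · exact Or.inr (Or.inr (Or.inl ⟨⟨(a, false), h⟩, rfl, rfl⟩))
      · exact Or.inr (Or.inl ⟨⟨(a, true), h⟩, rfl, rfl⟩)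
  · exact Or.inr (Or.inr (Or.inr (Or.inl ⟨x, o, f, b, rfl⟩)))
  · exact Or.inr (Or.inr (Or.inr (Or.inr (Or.inl ⟨x, b, rfl⟩))))
  · exact Or.inr (Or.inr (Or.inr (Or.inr (Or.inr ⟨x, b, rfl⟩))))

theorem shieldNext_surjective (hσ : IsRotation σ) : Function.Surjective (shieldNext w σ ρ) := by
  intro z
  rcases shieldDart_cases z with ⟨z, h, rfl⟩ | ⟨x, h, rfl⟩ | ⟨x, h, rfl⟩ | ⟨x, o, f, b, rfl⟩ |
    ⟨x, b, rfl⟩ | ⟨x, b, rfl⟩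
  · refine ⟨extDart (σ.symm z), ?_⟩
    rw [next_ext_of, Equiv.apply_symm_apply]
    rwa [← hσ.dartVertex_apply, Equiv.apply_symm_apply]
  · exact ⟨ringDart x true true true, by rw [next_ring_ttt, if_pos h]⟩
  · refine ⟨ringDart (ρ.symm x) true false false, ?_⟩
    rw [next_ring_tff, Equiv.apply_symm_apply, if_neg (by simp [h])]
  · cases o <;> cases f <;> cases b
    · exact ⟨ringDart x false true false, rfl⟩
    · by_cases h : UnitOut w x
      · refine ⟨ringDart (ρ.symm x) false true true, ?_⟩
        rw [next_ring_ftt, dif_pos (by rwa [Equiv.apply_symm_apply]), Equiv.apply_symm_apply]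
      · exact ⟨inDart ⟨x, h⟩ true, rfl⟩
    · by_cases h : UnitIn w x
      · exact ⟨ringDart x false false false, by rw [next_ring_fff, dif_pos h]⟩
      · exact ⟨outDart ⟨x, h⟩ false, rfl⟩
    · exact ⟨ringDart (ρ x) false false true, by rw [next_ring_fft, Equiv.symm_apply_apply]⟩
    · by_cases h : UnitOut w (ρ x)
      · exact ⟨ringDart (ρ x) true true false, by
          rw [next_ring_ttf, dif_pos h, Equiv.symm_apply_apply]⟩
      · exact ⟨inDart ⟨ρ x, h⟩ false, by
          change ringDart (ρ.symm (ρ x)) true false false = _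
          rw [Equiv.symm_apply_apply]⟩
    · cases h : x.1.2
      · exact ⟨ringDart x true true true, by rw [next_ring_ttt, if_neg (by simp [h])]⟩
      · exact ⟨extDart x.1, next_ext_in h⟩
    · cases h : x.1.2
      · exact ⟨extDart x.1, next_ext_out h⟩
      · refine ⟨ringDart (ρ.symm x) true false false, ?_⟩
        rw [next_ring_tff, Equiv.apply_symm_apply, if_pos h]
    · by_cases h : UnitIn w x
      · exact ⟨ringDart x true false true, by rw [next_ring_tft, dif_pos h]⟩
      · exact ⟨outDart ⟨x, h⟩ true, rfl⟩
  · cases b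
    · exact ⟨ringDart x.1 true true false, by rw [next_ring_ttf, dif_neg x.2]⟩
    · refine ⟨ringDart (ρ.symm x.1) false true true, ?_⟩
      have : ∀ y (hy : y = x.1) (h : ¬ UnitOut w y), (inDart ⟨y, h⟩ true : ShieldDart w ρ) = inDart x true := by
        rintro y rfl h; rfl
      rw [next_ring_ftt, dif_neg (by rw [Equiv.apply_symm_apply]; exact x.2)]
      exact this _ (Equiv.apply_symm_apply _ _) _
  · cases b
    · exact ⟨ringDart x.1 false false false, by rw [next_ring_fff, dif_neg x.2]⟩
    · exact ⟨ringDart x.1 true false true, by rw [next_ring_tft, dif_neg x.2]⟩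

variable (w σ ρ) in
/-- A dart at each ring vertex. -/
def ringRep : RingDart D fin → Bool → Bool → ShieldDart w ρ
  | x, true, true => ringDart (ρ.symm x) true false false
  | x, true, false => ringDart x true true true
  | x, false, true => ringDart x false false false
  | x, false, false => ringDart (ρ.symm x) false true true

/-- Every dart at a ring vertex reaches one fixed dart there after a few steps. The darts at a ring
vertex therefore form a single cycle. -/
theorem shield_reaches {σ' : Equiv.Perm (ShieldDart w ρ)} (hσ' : ∀ z, σ' z = shieldNext w σ ρ z)
    (z : ShieldDart w ρ) : (∃ z₀ : D.Dart, fin (D.dartVertex z₀) ∧ z = extDart z₀) ∨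
    ∃ x o t, (shieldRing w fin ρ).dartVertex z = Sum.inr (x, o, t) ∧
      orbSetoid {σ'} z (ringRep w ρ x o t) := by
  have hmem : ∀ z, orbSetoid {σ'} z (shieldNext w σ ρ z) := fun z => by
    have := orbSetoid_of_mem (S := {σ'}) (Set.mem_singleton _) z
    rwa [hσ'] at this
  have hstep : ∀ {z z' z''}, shieldNext w σ ρ z = z' → orbSetoid {σ'} z' z'' → orbSetoid {σ'} z z'' :=
    fun h h' => Setoid.trans' _ (h ▸ hmem _) h'
  have hrefl : ∀ z, orbSetoid {σ'} z z := fun z => Setoid.refl' _ z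
  have h_ttf : ∀ x, orbSetoid {σ'} (ringDart x true true false) (ringDart (ρ.symm x) true false false) := by
    intro x
    by_cases h : UnitOut w x
    · exact hstep ((next_ring_ttf x).trans (dif_pos h)) (hrefl _)
    · exact hstep ((next_ring_ttf x).trans (dif_neg h)) (hmem _)
  have h_tft : ∀ x, orbSetoid {σ'} (ringDart x true false true) (ringDart x true true true) := by
    intro x
    by_cases h : UnitIn w x
    · exact hstep ((next_ring_tft x).trans (dif_pos h)) (hrefl _)
    · exact hstep ((next_ring_tft x).trans (dif_neg h)) (hmem _)
  rcases shieldDart_cases z with ⟨z, h, rfl⟩ | ⟨x, h, rfl⟩ | ⟨x, h, rfl⟩ | ⟨x, o, f, b, rfl⟩ |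
    ⟨x, b, rfl⟩ | ⟨x, b, rfl⟩
  · exact Or.inl ⟨z, h, rfl⟩
  · refine Or.inr ⟨x, true, false, ?_, hstep (next_ext_in h) (h_tft x)⟩
    obtain ⟨⟨a, b⟩, hx⟩ := x
    subst h
    exact shieldEnd_of_not hx
  · refine Or.inr ⟨x, true, true, ?_, hstep (next_ext_out h) (h_ttf x)⟩
    obtain ⟨⟨a, b⟩, hx⟩ := x
    subst h
    exact shieldEnd_of_not hx
  · right
    cases o <;> cases f <;> cases b
    · exact ⟨x, false, true, rfl, hrefl _⟩
    · exact ⟨x, false, false, rfl, hmem _⟩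
    · exact ⟨x, false, true, rfl, hmem _⟩
    · refine ⟨ρ x, false, false, rfl, ?_⟩
      rw [ringRep, Equiv.symm_apply_apply]
    · refine ⟨ρ x, true, true, rfl, ?_⟩
      rw [ringRep, Equiv.symm_apply_apply]
    · exact ⟨x, true, false, rfl, h_tft x⟩
    · exact ⟨x, true, true, rfl, h_ttf x⟩
    · exact ⟨x, true, false, rfl, hrefl _⟩
  · right
    cases b
    · exact ⟨x.1, true, true, rfl, hmem _⟩
    · exact ⟨x.1, false, false, rfl, hstep rfl (hmem (ringDart x.1 false false true))⟩
  · right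
    cases b
    · exact ⟨x.1, false, true, rfl, hstep rfl (hmem (ringDart x.1 false true false))⟩
    · exact ⟨x.1, true, false, rfl, hmem _⟩

theorem dartVertex_shieldNext (hσ : IsRotation σ) (z : ShieldDart w ρ) :
    (shieldRing w fin ρ).dartVertex (shieldNext w σ ρ z) = (shieldRing w fin ρ).dartVertex z := by
  have hext : ∀ z : D.Dart, (shieldRing w fin ρ).dartVertex (extDart z) = shieldEnd fin z := by
    rintro ⟨a, _ | _⟩ <;> rfl
  have hx : ∀ x : RingDart D fin, shieldEnd fin x.1 = Sum.inr (x, true, !x.1.2) := fun x =>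
    shieldEnd_of_not x.2
  rcases shieldDart_cases z with ⟨z, h, rfl⟩ | ⟨x, h, rfl⟩ | ⟨x, h, rfl⟩ | ⟨x, o, f, b, rfl⟩ |
    ⟨x, b, rfl⟩ | ⟨x, b, rfl⟩
  · rw [next_ext_of h, hext, hext, shieldEnd_of h, shieldEnd_eq_inl]
    exact hσ.dartVertex_apply z
  · rw [next_ext_in h, hext, hx, h]; rfl
  · rw [next_ext_out h, hext, hx, h]; rfl
  · cases o <;> cases f <;> cases b
    · rw [next_ring_fff]; split_ifs <;> rfl
    · change Sum.inr (ρ (ρ.symm x), false, false) = Sum.inr (x, false, false)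
      rw [Equiv.apply_symm_apply]
    · rfl
    · rw [next_ring_ftt]; split_ifs <;> rfl
    · rw [next_ring_tff]
      split_ifs with h
      · rfl
      · rw [hext, hx]; simp only [Bool.not_eq_true] at h; rw [h]; rfl
    · rw [next_ring_tft]; split_ifs <;> rfl
    · rw [next_ring_ttf]
      split_ifs
      · change Sum.inr (ρ (ρ.symm x), true, true) = Sum.inr (x, true, true)
        rw [Equiv.apply_symm_apply]
      · rfl
    · rw [next_ring_ttt]
      split_ifs with h
      · rw [hext, hx, h]; rfl
      · rfl
  · cases b
    · change Sum.inr (ρ (ρ.symm x.1), true, true) = Sum.inr (x.1, true, true)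
      rw [Equiv.apply_symm_apply]
    · rfl
  · cases b <;> rfl

theorem shield_isRotation (hσ : IsRotation σ) {σ' : Equiv.Perm (ShieldDart w ρ)}
    (hσ' : ∀ z, σ' z = shieldNext w σ ρ z) : IsRotation (D := shieldRing w fin ρ) σ' := by
  intro z z'
  constructor
  · intro h
    refine sameCycle_induction (⊥ : Setoid (shieldRing w fin ρ).V) (shieldRing w fin ρ).dartVertex
      (fun z => ?_) h
    rw [hσ']
    exact (dartVertex_shieldNext hσ z).symm
  · intro h
    refine (orbSetoid_singleton _ _ _).1 ?_
    have hext : ∀ z : D.Dart, (shieldRing w fin ρ).dartVertex (extDart z) = shieldEnd fin z := by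
      rintro ⟨a, _ | _⟩ <;> rfl
    rcases shield_reaches hσ' z with ⟨z, hz, rfl⟩ | ⟨x, o, t, h1, h2⟩ <;>
      rcases shield_reaches hσ' z' with ⟨z', hz', rfl⟩ | ⟨x', o', t', h3, h4⟩
    · rw [hext, hext, shieldEnd_of hz, eq_comm, shieldEnd_eq_inl] at h
      obtain ⟨n, _, rfl⟩ := ((hσ z z').2 h.symm).exists_pow_eq'
      have : ∀ n : ℕ, D.dartVertex ((σ ^ n) z) = D.dartVertex z ∧
          orbSetoid {σ'} (extDart z) (extDart ((σ ^ n) z)) := by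
        intro n
        induction n with
        | zero => exact ⟨rfl, Setoid.refl' _ _⟩
        | succ n ih =>
          rw [pow_succ', Equiv.Perm.mul_apply]
          refine ⟨(hσ.dartVertex_apply _).trans ih.1, Setoid.trans' _ ih.2 ?_⟩
          have h5 := orbSetoid_of_mem (S := {σ'}) (Set.mem_singleton _) (extDart ((σ ^ n) z))
          rwa [hσ', next_ext_of (by rw [ih.1]; exact hz)] at h5
      exact (this n).2
    · rw [hext, shieldEnd_of hz, h3] at h; cases h
    · rw [hext, shieldEnd_of hz', h1] at h; cases h
    · rw [h1, h3] at h
      cases h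
      exact Setoid.trans' _ h2 (Setoid.symm' _ h4)

end ShieldRotation

end DiMultigraph
end

noncomputable section
open scoped Classical
namespace DiMultigraph

/-! ### Faces of the shield and the drawing of its chords -/

section ShieldFaces

variable {D : DiMultigraph.{u}} {w : D.A → ℕ} {fin : D.V → Prop} {σ : Equiv.Perm D.Dart}
  {ρ : Equiv.Perm (RingDart D fin)}

variable (w fin σ) in
/-- The faces of the shield without chords: the old faces, one face next to each spoke, and the
insides of the inner rings. -/
abbrev ShieldFace : Type u := Quotient (orbSetoid {σ * D.dartFlip}) ⊕
  ({x : RingDart D fin // ¬ UnitOut w x} ⊕ {x : RingDart D fin // ¬ UnitIn w x}) ⊕ {v // ¬ fin v}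

variable (w σ ρ) in
/-- The face between the outer and the inner ring next to the backward arc of the outer one. -/
def bckFace (x : RingDart D fin) : ShieldFace w fin σ :=
  -- A face between the rings is named after the next spoke in the direction of `ρ`. If position `ρ
  -- x` has no inward spoke, it has an outward one.
  if h : UnitOut w (ρ x) then
    Sum.inr (Sum.inl (Sum.inr ⟨ρ x, fun h' => h'.not_unitOut h⟩))
  else Sum.inr (Sum.inl (Sum.inl ⟨ρ x, h⟩))

variable (w σ ρ) in
/-- The face between the outer and the inner ring next to the forward arc of the outer one. -/
def fwdFace (x : RingDart D fin) : ShieldFace w fin σ :=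
  if h : UnitIn w x then bckFace w σ ρ x else Sum.inr (Sum.inl (Sum.inr ⟨x, h⟩))

variable (w σ ρ) in
/-- The face to which a dart of the shield belongs. -/
def shieldFace : ShieldDart w ρ → ShieldFace w fin σ
  | (Sum.inl a, b) => Sum.inl (Quotient.mk _ (a, b))
  | (Sum.inr (Sum.inl (x, true, true)), false) =>
      Sum.inl (Quotient.mk _ (if x.1.2 then x.1 else σ x.1))
  | (Sum.inr (Sum.inl (x, true, true)), true) => fwdFace w σ ρ x
  | (Sum.inr (Sum.inl (x, true, false)), false) => bckFace w σ ρ x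
  | (Sum.inr (Sum.inl (x, true, false)), true) => Sum.inl (Quotient.mk _ (σ x.1))
  | (Sum.inr (Sum.inl (x, false, true)), false) => bckFace w σ ρ x
  | (Sum.inr (Sum.inl (x, false, true)), true) => Sum.inr (Sum.inr ⟨ringVertex x, x.2⟩)
  | (Sum.inr (Sum.inl (x, false, false)), false) => Sum.inr (Sum.inr ⟨ringVertex x, x.2⟩)
  | (Sum.inr (Sum.inl (x, false, false)), true) => fwdFace w σ ρ x
  | (Sum.inr (Sum.inr (Sum.inl x)), false) => fwdFace w σ ρ x.1
  | (Sum.inr (Sum.inr (Sum.inl x)), true) => Sum.inr (Sum.inl (Sum.inl x))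
  | (Sum.inr (Sum.inr (Sum.inr x)), false) => Sum.inr (Sum.inl (Sum.inr x))
  | (Sum.inr (Sum.inr (Sum.inr x)), true) => bckFace w σ ρ x.1

theorem bckFace_symm (x : {x : RingDart D fin // ¬ UnitOut w x}) :
    bckFace w σ ρ (ρ.symm x.1) = Sum.inr (Sum.inl (Sum.inl x)) := by
  have : ∀ y (_ : y = x.1) (h : ¬ UnitOut w y),
      (Sum.inr (Sum.inl (Sum.inl ⟨y, h⟩)) : ShieldFace w fin σ) = Sum.inr (Sum.inl (Sum.inl x)) := by
    rintro y rfl h; rfl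
  rw [bckFace, dif_neg (by rw [Equiv.apply_symm_apply]; exact x.2)]
  exact this _ (Equiv.apply_symm_apply _ _) _

theorem bckFace_symm_of_unitOut {x : RingDart D fin} (h : UnitOut w x) :
    bckFace w σ ρ (ρ.symm x) = fwdFace w σ ρ x := by
  have hI : ¬ UnitIn w x := fun h' => h'.not_unitOut h
  have : ∀ y (_ : y = x) (h : ¬ UnitIn w y),
      (Sum.inr (Sum.inl (Sum.inr ⟨y, h⟩)) : ShieldFace w fin σ) =
        Sum.inr (Sum.inl (Sum.inr ⟨x, hI⟩)) := by
    rintro y rfl h; rfl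
  rw [bckFace, dif_pos (by rwa [Equiv.apply_symm_apply]), fwdFace, dif_neg hI]
  exact this _ (Equiv.apply_symm_apply _ _) _

theorem bckFace_of_unitOut {x : RingDart D fin} (h : UnitOut w (ρ x)) :
    bckFace w σ ρ x = fwdFace w σ ρ (ρ x) := by
  rw [← bckFace_symm_of_unitOut h, Equiv.symm_apply_apply]

/-- A finite check over the kinds of darts. Between the rings it reflects that a missing spoke
merges the two regions beside it, which then have the same next spoke; outside the outer ring, the
boundary follows the old faces. -/
theorem shieldFace_next (hσ : IsRotation σ) (hρ : ∀ x, (ρ x).1 = σ x.1) (z : ShieldDart w ρ) :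
    shieldFace w σ ρ (shieldNext w σ ρ (z.1, !z.2)) = shieldFace w σ ρ z := by
  have hq : ∀ a b, (Quotient.mk _ (σ (a, !b)) : Quotient (orbSetoid {σ * D.dartFlip})) =
      Quotient.mk _ (a, b) := fun a b => by
    have := orbSetoid_of_mem (S := {σ * D.dartFlip}) (Set.mem_singleton _) (a, b)
    rw [Equiv.Perm.mul_apply, dartFlip_apply] at this
    exact Quotient.sound (Setoid.symm' _ this)
  have hext : ∀ z : D.Dart, shieldFace w σ ρ (extDart z) = Sum.inl (Quotient.mk _ z) := fun z => rfl
  have hvert : ∀ x y : RingDart D fin, ringVertex x = ringVertex y →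
      (Sum.inr (Sum.inr ⟨ringVertex x, x.2⟩) : ShieldFace w fin σ) =
        Sum.inr (Sum.inr ⟨ringVertex y, y.2⟩) := by
    intro x y h
    congr 2
    exact Subtype.ext h
  rcases z with ⟨a | ⟨x, o, f⟩ | x | x, b⟩
  · by_cases h : fin (D.dartVertex (a, !b))
    · have := next_ext_of (w := w) (σ := σ) (ρ := ρ) h
      change shieldFace w σ ρ (shieldNext w σ ρ (extDart (a, !b))) = _
      rw [this, hext, hq]
      rfl
    · set x : RingDart D fin := ⟨(a, !b), h⟩ with hx
      change shieldFace w σ ρ (shieldNext w σ ρ (extDart x.1)) = Sum.inl (Quotient.mk _ (a, b))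
      rw [← hq]
      change _ = Sum.inl (Quotient.mk _ (σ x.1))
      cases hb : x.1.2
      · rw [next_ext_out hb]
        change Sum.inl (Quotient.mk _ (if x.1.2 then x.1 else σ x.1)) = _
        rw [if_neg (by simp [hb])]
      · rw [next_ext_in hb]
        rfl
  · cases o <;> cases f <;> cases b
    · refine (hvert _ _ ?_)
      change D.dartVertex (ρ.symm x).1 = D.dartVertex x.1
      rw [← hσ.dartVertex_apply, ← hρ, Equiv.apply_symm_apply]
    · change shieldFace w σ ρ (shieldNext w σ ρ (ringDart x false false false)) = fwdFace w σ ρ x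
      rw [next_ring_fff, fwdFace]
      split_ifs <;> rfl
    · change shieldFace w σ ρ (shieldNext w σ ρ (ringDart x false true true)) = bckFace w σ ρ x
      rw [next_ring_ftt]
      split_ifs with h
      · exact (bckFace_of_unitOut h).symm
      · rw [bckFace, dif_neg h]; rfl
    · rfl
    · change shieldFace w σ ρ (shieldNext w σ ρ (ringDart x true false true)) = bckFace w σ ρ x
      rw [next_ring_tft]
      split_ifs with h
      · change fwdFace w σ ρ x = _
        rw [fwdFace, dif_pos h]
      · rfl
    · change shieldFace w σ ρ (shieldNext w σ ρ (ringDart x true false false)) =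
        Sum.inl (Quotient.mk _ (σ x.1))
      rw [next_ring_tff, ← hρ]
      split_ifs with h
      · change Sum.inl (Quotient.mk _ (if (ρ x).1.2 then (ρ x).1 else σ (ρ x).1)) = _
        rw [if_pos h]
      · rw [hext]
    · change shieldFace w σ ρ (shieldNext w σ ρ (ringDart x true true true)) =
        Sum.inl (Quotient.mk _ (if x.1.2 then x.1 else σ x.1))
      rw [next_ring_ttt]
      split_ifs with h
      · rw [hext]
      · rfl
    · change shieldFace w σ ρ (shieldNext w σ ρ (ringDart x true true false)) = fwdFace w σ ρ x
      rw [next_ring_ttf]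
      split_ifs with h
      · exact bckFace_symm_of_unitOut h
      · rfl
  · cases b
    · rfl
    · exact bckFace_symm x
  · cases b
    · change fwdFace w σ ρ x.1 = Sum.inr (Sum.inl (Sum.inr x))
      rw [fwdFace, dif_neg x.2]
    · rfl

theorem shield_card_faces (hσ : IsRotation σ) (hρ : ∀ x, (ρ x).1 = σ x.1)
    (hdart : ∀ v, ¬ fin v → ∃ x, D.dartVertex x = v) {σ' : Equiv.Perm (ShieldDart w ρ)}
    (hσ' : ∀ z, σ' z = shieldNext w σ ρ z) :
    numOrbits {σ * D.dartFlip} + (Fintype.card {x : RingDart D fin // ¬ UnitOut w x} +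
      Fintype.card {x : RingDart D fin // ¬ UnitIn w x} + Fintype.card {v // ¬ fin v}) ≤
    numOrbits {σ' * (shieldRing w fin ρ).dartFlip} := by
  have h := le_numOrbits_of_invariant (g := σ' * (shieldRing w fin ρ).dartFlip) (shieldFace w σ ρ)
    (fun z => by rw [Equiv.Perm.mul_apply, dartFlip_apply, hσ']; exact shieldFace_next hσ hρ z)
    (by
      rintro (q | (x | x) | v)
      · induction q using Quotient.inductionOn with | h z => exact ⟨extDart z, rfl⟩
      · exact ⟨inDart x true, rfl⟩
      · exact ⟨outDart x false, rfl⟩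
      · obtain ⟨v, hv⟩ := v
        obtain ⟨x, rfl⟩ := hdart v hv
        exact ⟨ringDart ⟨x, hv⟩ false true true, rfl⟩)
  rw [Nat.card_sum, Nat.card_sum, Nat.card_sum, ← numOrbits_eq, Nat.card_eq_fintype_card,
    Nat.card_eq_fintype_card, Nat.card_eq_fintype_card] at h
  exact h

theorem card_filter_unit {o : Bool} (hw : ∀ a, w a ≤ 1) {v : D.V} (hv : ¬ fin v) :
    (Finset.univ.filter fun x : RingDart D fin => (x.1.2 = o ∧ w x.1.1 = 1) ∧ ringVertex x = v).card =
      ∑ a, if D.dartVertex (a, o) = v then w a else 0 := by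
  have h1 : ∀ a, (if D.dartVertex (a, o) = v then w a else 0) =
      if D.dartVertex (a, o) = v ∧ w a = 1 then 1 else 0 := by
    intro a
    have := hw a
    by_cases h : D.dartVertex (a, o) = v
    · by_cases h' : w a = 1
      · rw [if_pos h, if_pos ⟨h, h'⟩, h']
      · rw [if_pos h, if_neg fun h => h' h.2]; omega
    · rw [if_neg h, if_neg fun h' => h h'.1]
  rw [Finset.sum_congr rfl fun a _ => h1 a, ← Finset.card_filter]
  refine Finset.card_bij (fun x _ => x.1.1) ?_ ?_ ?_
  · intro x hx
    obtain ⟨⟨h2, h3⟩, h4⟩ := (Finset.mem_filter.1 hx).2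
    refine Finset.mem_filter.2 ⟨Finset.mem_univ _, ?_, h3⟩
    rw [← h2]; exact h4
  · intro x hx y hy hxy
    have h2 := (Finset.mem_filter.1 hx).2.1.1
    have h3 := (Finset.mem_filter.1 hy).2.1.1
    exact Subtype.ext (Prod.ext hxy (h2.trans h3.symm))
  · intro a ha
    obtain ⟨h2, h3⟩ := (Finset.mem_filter.1 ha).2
    exact ⟨⟨(a, o), h2 ▸ hv⟩, Finset.mem_filter.2 ⟨Finset.mem_univ _, ⟨rfl, h3⟩, h2⟩, rfl⟩

theorem exists_equiv_map {ι Y : Type*} [Fintype ι] (f : ι ↪ Y) :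
    ∃ e : ι ≃ {y // y ∈ Finset.univ.map f}, ∀ i, (e i).1 = f i :=
  ⟨Equiv.ofBijective (fun i => ⟨f i, Finset.mem_map_of_mem _ (Finset.mem_univ i)⟩)
    ⟨fun i j h => f.injective (congrArg Subtype.val h), fun ⟨y, hy⟩ => by
      obtain ⟨i, _, rfl⟩ := Finset.mem_map.1 hy; exact ⟨i, rfl⟩⟩, fun _ => rfl⟩

/-- The chords of the shield can be chosen without crossings. -/
theorem exists_chords (hw : ∀ a, w a ≤ 1)
    (hbal : ∀ v, ¬ fin v → weight w (D.outArcs {v}) = weight w (D.inArcs {v}))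
    (hσ : IsRotation σ) (hρ : ∀ x, (ρ x).1 = σ x.1)
    (hdart : ∀ v, ¬ fin v → ∃ x, D.dartVertex x = v) :
    ∃ μ : {x : RingDart D fin // UnitIn w x} ≃ {x : RingDart D fin // UnitOut w x},
      (∀ x, ringVertex (μ x).1 = ringVertex x.1) ∧
      (shield w fin ρ μ).HasFaces (numOrbits {σ * D.dartFlip} +
        (Fintype.card {x : RingDart D fin // ¬ UnitOut w x} +
          Fintype.card {x : RingDart D fin // ¬ UnitIn w x} + Fintype.card {v // ¬ fin v}) +
        Fintype.card {x : RingDart D fin // UnitIn w x}) := by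
  obtain ⟨σ', hσ'⟩ : ∃ σ' : Equiv.Perm (ShieldDart w ρ), ∀ z, σ' z = shieldNext w σ ρ z :=
    ⟨Equiv.ofBijective _ (Finite.surjective_iff_bijective.1 (shieldNext_surjective hσ)),
      fun _ => rfl⟩
  have hrot := shield_isRotation hσ hσ'
  set φ := σ' * (shieldRing w fin ρ).dartFlip with hφ
  have hρsc : ∀ x y, ringVertex x = ringVertex y → ∃ n : ℕ, (ρ ^ n) x = y := by
    intro x y hxy
    obtain ⟨n, hn', hn⟩ := ((hσ x.1 y.1).2 hxy).exists_pow_eq'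
    refine ⟨n, Subtype.ext ?_⟩
    rw [← hn]
    clear hn hn'
    induction n with
    | zero => rfl
    | succ n ih => rw [pow_succ', pow_succ', Equiv.Perm.mul_apply, Equiv.Perm.mul_apply, hρ, ih]
  -- The corners inside the inner ring at which chords start (at inner sources) and, in `fT`, end
  -- (at inner sinks). The shift by `ρ.symm` appears because sink `x` is the head of the unit arc of
  -- the preceding position.
  set fS : {x : RingDart D fin // UnitIn w x} ↪ ShieldDart w ρ :=
    ⟨fun x => ringDart x.1 false false false, fun x y h => Subtype.ext (by simpa using h)⟩ with hfS
  set fT : {x : RingDart D fin // UnitOut w x} ↪ ShieldDart w ρ :=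
    ⟨fun x => ringDart (ρ.symm x.1) false true true, fun x y h => Subtype.ext (by simpa using h)⟩
    with hfT
  have hstep1 : ∀ x, φ.SameCycle (ringDart x false false false) (ringDart (ρ.symm x) false true true) := by
    intro x
    refine ⟨1, ?_⟩
    rw [zpow_one, hφ, Equiv.Perm.mul_apply, dartFlip_apply, hσ']; rfl
  have hstep2 : ∀ x, φ.SameCycle (ringDart x false true true) (ringDart x false false false) := by
    intro x
    refine ⟨1, ?_⟩
    rw [zpow_one, hφ, Equiv.Perm.mul_apply, dartFlip_apply, hσ']; rfl
  have hSS : ∀ x y : RingDart D fin, ringVertex x = ringVertex y →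
      φ.SameCycle (ringDart x false false false) (ringDart y false false false) := by
    intro x y hxy
    obtain ⟨n, rfl⟩ := hρsc x y hxy
    clear hxy
    induction n with
    | zero => exact Equiv.Perm.SameCycle.refl _ _
    | succ n ih =>
      refine ih.trans (Equiv.Perm.SameCycle.symm ?_)
      have := (hstep1 ((ρ ^ (n + 1)) x)).trans (hstep2 _)
      rw [pow_succ', Equiv.Perm.mul_apply, Equiv.symm_apply_apply] at this
      rwa [pow_succ', Equiv.Perm.mul_apply]
  -- The labels of inner faces record the vertex, so corners of different vertices lie in different
  -- faces; those of one vertex share a face by `hSS`.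
  have hface : ∀ z z', φ.SameCycle z z' → shieldFace w σ ρ z = shieldFace w σ ρ z' := by
    intro z z' h
    refine sameCycle_induction (⊥ : Setoid (ShieldFace w fin σ)) (shieldFace w σ ρ) (fun z => ?_) h
    rw [hφ, Equiv.Perm.mul_apply, dartFlip_apply, hσ']
    exact (shieldFace_next hσ hρ z).symm
  have hvsymm : ∀ x, ringVertex (ρ.symm x) = ringVertex x := fun x => by
    change D.dartVertex (ρ.symm x).1 = D.dartVertex x.1
    rw [← hσ.dartVertex_apply, ← hρ, Equiv.apply_symm_apply]
  have hS_iff : ∀ x y : RingDart D fin, φ.SameCycle (ringDart x false false false)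
      (ringDart y false false false) ↔ ringVertex y = ringVertex x := by
    intro x y
    refine ⟨fun h => ?_, fun h => hSS x y h.symm⟩
    have := hface _ _ h
    exact (congrArg Subtype.val (Sum.inr_injective (Sum.inr_injective this))).symm
  have hT_iff : ∀ x y : RingDart D fin, φ.SameCycle (ringDart x false false false)
      (ringDart (ρ.symm y) false true true) ↔ ringVertex y = ringVertex x := by
    intro x y
    refine ⟨fun h => ?_, fun h => (hSS x y h.symm).trans (hstep1 y)⟩
    have := hface _ _ h
    rw [← hvsymm y]
    exact (congrArg Subtype.val (Sum.inr_injective (Sum.inr_injective this))).symm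
  have hcount : ∀ (P : RingDart D fin → Prop) (f : {x // P x} ↪ ShieldDart w ρ) (x₀ : RingDart D fin),
      (∀ y, φ.SameCycle (ringDart x₀ false false false) (f y) ↔ ringVertex y.1 = ringVertex x₀) →
      ((Finset.univ.map f).filter (φ.SameCycle (ringDart x₀ false false false))).card =
        (Finset.univ.filter fun x => P x ∧ ringVertex x = ringVertex x₀).card := by
    intro P f x₀ hf
    rw [Finset.filter_map, Finset.card_map]
    rw [← Finset.card_map (Function.Embedding.subtype P)]
    congr 1
    ext x
    simp only [Finset.mem_map, Finset.mem_filter, Finset.mem_univ, true_and, Function.comp, hf,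
      Function.Embedding.subtype_apply, Subtype.exists, exists_and_right, exists_eq_right]
    exact ⟨fun ⟨h1, h2⟩ => ⟨h1, h2⟩, fun ⟨h1, h2⟩ => ⟨h1, h2⟩⟩
  -- Balance at `v` with weights at most 1: as many unit arcs enter as leave. This is the hypothesis
  -- of `exists_noncrossing`.
  have hcard : ∀ v, ¬ fin v → (Finset.univ.filter fun x : RingDart D fin => UnitIn w x ∧ ringVertex x = v).card =
      (Finset.univ.filter fun x : RingDart D fin => UnitOut w x ∧ ringVertex x = v).card := by
    intro v hv
    have h1 := card_filter_unit (o := true) hw hv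
    have h2 := card_filter_unit (o := false) hw hv
    have h3 := hbal v hv
    rw [weight_outArcs_singleton, weight_inArcs_singleton] at h3
    convert h1.trans (h3.symm.trans h2.symm) <;> exact Iff.rfl
  have hcardST : (Finset.univ.map fT).card = Fintype.card {x : RingDart D fin // UnitIn w x} := by
    rw [Finset.card_map, Finset.card_univ, Fintype.card_subtype, Fintype.card_subtype,
      Finset.card_eq_sum_card_fiberwise (f := ringVertex) (t := Finset.univ) (fun _ _ => Finset.mem_univ _),
      Finset.card_eq_sum_card_fiberwise (f := ringVertex) (t := Finset.univ) (fun _ _ => Finset.mem_univ _)]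
    refine Finset.sum_congr rfl fun v _ => ?_
    rw [Finset.filter_filter, Finset.filter_filter]
    by_cases hv : fin v
    · have : ∀ P : RingDart D fin → Prop,
          (Finset.univ.filter fun x => P x ∧ ringVertex x = v) = ∅ := fun P =>
        Finset.filter_eq_empty_iff.2 fun x _ h => x.2 (by rw [show D.dartVertex x.1 = v from h.2]; exact hv)
      rw [this, this]
    · exact (hcard v hv).symm
  obtain ⟨μ', hne, hμ', σ'', hrot', hle⟩ := exists_noncrossing
    (Fintype.card {x : RingDart D fin // UnitIn w x}) hrot
    (Finset.univ.map fS) (Finset.univ.map fT)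
    (by rw [Finset.card_map, Finset.card_univ]) hcardST
    (by
      intro x hx y hy
      obtain ⟨x, _, rfl⟩ := Finset.mem_map.1 hx
      obtain ⟨y, _, rfl⟩ := Finset.mem_map.1 hy
      intro h
      have h' : (Sum.inr (x.1, false, true) : ShieldVertex D fin) =
        Sum.inr (ρ (ρ.symm y.1), false, false) := h
      simp at h')
    (by
      intro z hz
      obtain ⟨x, _, rfl⟩ := Finset.mem_map.1 hz
      convert (hcount (UnitIn w) fS x.1 fun y => hS_iff _ _).trans ((hcard _ x.1.2).trans
        (hcount (UnitOut w) fT x.1 fun y => hT_iff _ _).symm) <;> rfl)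
  obtain ⟨eS, heS⟩ := exists_equiv_map fS
  obtain ⟨eT, heT⟩ := exists_equiv_map fT
  have hμT : ∀ x, (μ' (eS x)).1 = fT (eT.symm (μ' (eS x))) := fun x => by
    rw [← heT, Equiv.apply_symm_apply]
  refine ⟨eS.trans (μ'.trans eT.symm), fun x => ?_, ?_⟩
  · have h1 := hμ' (eS x)
    rw [hμT, heS] at h1
    exact (hT_iff _ _).1 h1
  · refine HasFaces.of_equiv (D := (shieldRing w fin ρ).withArcs _ _ _ hne)
      ⟨σ'', hrot', le_trans ?_ hle⟩ (Equiv.refl _) (Equiv.sumCongr (Equiv.refl _) eS.symm) ?_ ?_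
    · exact Nat.add_le_add_right (shield_card_faces hσ hρ hdart hσ') _
    · rintro (a | y)
      · rfl
      · obtain ⟨x, rfl⟩ := eS.surjective y
        change Sum.inr ((eS.symm (eS x)).1, false, true) = (shieldRing w fin ρ).dartVertex (eS x).1
        rw [heS, Equiv.symm_apply_apply]
        rfl
    · rintro (a | y)
      · rfl
      · obtain ⟨x, rfl⟩ := eS.surjective y
        change Sum.inr ((eT.symm (μ' (eS (eS.symm (eS x))))).1, false, false) =
          (shieldRing w fin ρ).dartVertex (μ' (eS x)).1
        rw [hμT, Equiv.symm_apply_apply]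
        change _ = Sum.inr (ρ (ρ.symm _), false, false)
        rw [Equiv.apply_symm_apply]

end ShieldFaces

end DiMultigraph
end

/-! ### Assembling the lifts -/

noncomputable section
open scoped Classical
namespace DiMultigraph

variable {D : DiMultigraph.{u}} {w : D.A → ℕ} {fin : D.V → Prop} {τ : ℕ}

theorem IsShieldable.exists_shield (hτ : 2 ≤ τ) (h : IsShieldable τ w fin) :
    ∃ (ρ : Equiv.Perm (RingDart D fin))
      (μ : {x : RingDart D fin // UnitIn w x} ≃ {x : RingDart D fin // UnitOut w x}),
      (∀ x y, ρ.SameCycle x y ↔ ringVertex x = ringVertex y) ∧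
      (∀ x, ringVertex (μ x).1 = ringVertex x.1) ∧
      (D.IsPlanar → (shield w fin ρ μ).IsPlanar) := by
  cases isEmpty_or_nonempty D.A with
  | inl hA =>
    have hX : IsEmpty (RingDart D fin) := ⟨fun x => hA.false x.1.1⟩
    refine ⟨1, Equiv.equivOfIsEmpty _ _, fun x => hX.elim x, fun x => hX.elim x.1, fun _ => ?_⟩
    have : IsEmpty (shield w fin (1 : Equiv.Perm (RingDart D fin)) (Equiv.equivOfIsEmpty _ _)).A :=
      ⟨by rintro ((a | r | y | y) | y)
          exacts [hA.false a, hX.false r.1, hX.false y.1, hX.false y.1, hX.false y.1]⟩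
    exact isPlanar_of_isEmpty
  | inr hA =>
    have hc : D.CutConnected := h.dicuts.cutConnected (by omega)
    obtain ⟨σ, hσ, hF⟩ : ∃ σ : Equiv.Perm D.Dart, IsRotation σ ∧
        (D.IsPlanar → Fintype.card D.A + 2 ≤ Fintype.card D.V + numOrbits {σ * D.dartFlip}) := by
      by_cases hp : D.IsPlanar
      · obtain ⟨σ, hσ, hle⟩ := hc.isPlanar_iff.1 hp
        exact ⟨σ, hσ, fun _ => hle⟩
      · obtain ⟨σ, hσ⟩ := exists_isRotation (D := D)
        exact ⟨σ, hσ, fun h => (hp h).elim⟩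
    set ρ : Equiv.Perm (RingDart D fin) :=
      σ.subtypePerm fun x => by rw [hσ.dartVertex_apply] with hρdef
    obtain ⟨μ, hμ, σ', hσ', hle⟩ := exists_chords (ρ := ρ) h.le_one h.balanced hσ (fun _ => rfl)
      fun v _ => hc.exists_dart v
    have hρ : ∀ x y, ρ.SameCycle x y ↔ ringVertex x = ringVertex y := fun x y => by
      rw [hρdef, Equiv.Perm.sameCycle_subtypePerm]; exact hσ _ _
    refine ⟨ρ, μ, hρ, hμ, fun hp => ?_⟩
    have hc' := (shield_dicutsAtLeast hτ h hρ hμ).cutConnected (by omega)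
    have : Nonempty (shield w fin ρ μ).A := hA.map fun a => Sum.inl (Sum.inl a)
    refine hc'.isPlanar_iff.2 ⟨σ', hσ', ?_⟩
    -- The Euler count is preserved: a ring position adds four vertices and four ring arcs, each
    -- spoke and each chord comes with a new face, and each replaced vertex is traded for the inside
    -- of its inner ring.
    have h1 := hF hp
    have h2 := Fintype.card_subtype_compl fin
    have h3 := Fintype.card_subtype_le fin
    simp only [Fintype.card_sum] at hle ⊢
    omega

section Planarity

theorem IsPlanar.splitArcs {z : ℕ} (hp : D.IsPlanar) (h : D.CutConnected) :
    (splitArcs D w z).IsPlanar := by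
  cases isEmpty_or_nonempty D.A with
  | inl hA =>
    have : IsEmpty (DiMultigraph.splitArcs D w z).A :=
      ⟨by rintro (a | a); exacts [hA.false a, hA.false a.1]⟩
    exact isPlanar_of_isEmpty
  | inr hA =>
    obtain ⟨σ, hσ, hle⟩ := h.isPlanar_iff.1 hp
    obtain ⟨σ', hσ', hle'⟩ := HasFaces.splitArcs (w := w) (z := z) ⟨σ, hσ, le_rfl⟩
    have hc : (DiMultigraph.splitArcs D w z).CutConnected := fun U hU hU' =>
      let ⟨a, ha⟩ := h U hU hU'
      ⟨Sum.inl a, ha⟩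
    have : Nonempty (DiMultigraph.splitArcs D w z).A := hA.map Sum.inl
    refine hc.isPlanar_iff.2 ⟨σ', hσ', ?_⟩
    have hV : Fintype.card (DiMultigraph.splitArcs D w z).V = Fintype.card D.V := rfl
    rw [Fintype.card_sum, hV]
    omega

variable {k : Bool → Bool → D.V → ℕ}

/-- A pendant vertex is drawn in a corner at its base, which requires a dart there. Without arcs
there is none; `hk` then says that there are no pendant vertices, as befits vanishing imbalances. -/
theorem IsPlanar.addPendants (hp : D.IsPlanar) (h : D.CutConnected)
    (h' : (addPendants D k).CutConnected) (hk : IsEmpty D.A → ∀ d b v, k d b v = 0) :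
    (addPendants D k).IsPlanar := by
  cases isEmpty_or_nonempty D.A with
  | inl hA =>
    have : IsEmpty (DiMultigraph.addPendants D k).A :=
      ⟨by
        rintro (a | p)
        · exact hA.false a
        · exact (Fin.cast (hk hA _ _ _) p.2).elim0⟩
    exact isPlanar_of_isEmpty
  | inr hA =>
    obtain ⟨σ, hσ, hle⟩ := h.isPlanar_iff.1 hp
    obtain ⟨σ', hσ', hle'⟩ := HasFaces.withPendants (D := D) ⟨σ, hσ, le_rfl⟩ (PendantIndex k)
      (fun p => p.1.1) (fun p => p.1.2.1) fun p => h.exists_dart _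
    have : Nonempty (DiMultigraph.addPendants D k).A := hA.map Sum.inl
    refine h'.isPlanar_iff.2 ⟨σ', hσ', le_trans ?_ (Nat.add_le_add_left hle' _)⟩
    rw [Fintype.card_sum, Fintype.card_sum]
    omega

end Planarity

section Terminals

variable {k : Bool → Bool → D.V → ℕ} {z : ℕ}

theorem splitArcs_isSource {v : D.V} : (splitArcs D w z).IsSource v ↔ D.IsSource v :=
  ⟨fun h a => h (Sum.inl a), fun h a => by rw [splitArcs_head]; exact h _⟩

theorem splitArcs_isSink {v : D.V} : (splitArcs D w z).IsSink v ↔ D.IsSink v :=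
  ⟨fun h a => h (Sum.inl a), fun h a => by rw [splitArcs_tail]; exact h _⟩

theorem addPendants_isSource (p : PendantIndex k) :
    (addPendants D k).IsSource (Sum.inr p) ↔ p.1.2.1 = true := by
  constructor
  · intro h
    by_contra hd
    exact h (Sum.inr p) (if_neg hd)
  · rintro hd (a | q) h
    · cases h
    · rw [withPendants_head_inr] at h
      split_ifs at h with hq
      exact hq (Sum.inr_injective h ▸ hd)

theorem addPendants_isSink (p : PendantIndex k) :
    (addPendants D k).IsSink (Sum.inr p) ↔ p.1.2.1 = false := by
  constructor
  · intro h
    by_contra hd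
    exact h (Sum.inr p) (if_pos (Bool.not_eq_false _ ▸ hd))
  · rintro hd (a | q) h
    · cases h
    · rw [withPendants_tail_inr] at h
      split_ifs at h with hq
      rw [Sum.inr_injective h, hd] at hq
      cases hq

theorem sum_subtype_isRight {M : Type*} [AddCommMonoid M] {V P : Type u} [Fintype V] [Fintype P]
    {fin : V ⊕ P → Prop} (h : ∀ v, fin v ↔ v.isRight = true) (f : V ⊕ P → M) :
    ∑ v : {v // fin v}, f v.1 = ∑ p, f (Sum.inr p) := by
  rw [← Finset.sum_subtype (Finset.univ.filter fin) (by simp) f, Finset.sum_filter,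
    Fintype.sum_sum_type]
  simp [h]

theorem card_filter_isRight {V P : Type u} [Fintype V] [Fintype P] {fin : V ⊕ P → Prop}
    (h : ∀ v, fin v ↔ v.isRight = true) (q : V ⊕ P → Prop) :
    (Finset.univ.filter fun v : V ⊕ P => fin v ∧ q v).card =
      ∑ p, if q (Sum.inr p) then 1 else 0 := by
  rw [Finset.card_filter, Fintype.sum_sum_type]
  simp [h]

end Terminals

/-- Weighted digraphs lift to `(τ, τ + 1)`-bipartite ones: the imbalance of each vertex is moved to
pendant vertices, arcs are split into arcs of weight at most `1`, and the old vertices are replaced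
by shields. -/
theorem exists_bipartite_lift (hτ : 2 ≤ τ) (h : DicutsAtLeast w τ) (k : Bool → Bool → D.V → ℕ)
    (hbal : ∀ v, (weight w (D.outArcs {v}) : ℤ) - weight w (D.inArcs {v}) =
      k true true v * (τ + 1) + k true false v * τ - (k false true v * (τ + 1) + k false false v * τ))
    (hk : IsEmpty D.A → ∀ d b v, k d b v = 0) :
    ∃ (D' : DiMultigraph.{u}) (w' : D'.A → ℕ) (g : D'.A → Option D.A),
      CutLift w w' g ∧ IsTauBipartite τ w' ∧
      ((∀ a, 0 < w a) → 3 ≤ τ → ∀ a, 0 < w' a) ∧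
      (D.IsPlanar → D'.IsPlanar) ∧
      ((∀ v, k false true v = 0) →
        IsSinkRegular τ w' ∧ rho τ w' = (1 / (τ : ℚ)) * ∑ v, (k true true v : ℚ)) ∧
      ((∀ v, k true true v + k true false v = k false true v + k false false v) →
        D'.IsBalanced) := by
  have hτ0 : 0 < τ := by omega
  set w₁ := addPendantsWeight k τ w with hw₁
  set fin : (addPendants D k).V → Prop := fun v => v.isRight with hfin
  have h₁ : IsTerminalBalanced (D := addPendants D k) τ w₁ fin := addPendants_isTerminalBalanced h hbal
  -- Spare arcs of weight 0 are introduced only if some weight is already 0, so that positive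
  -- weights stay positive.
  obtain ⟨z, hz, hz'⟩ : ∃ z : ℕ, (z = 0 ∧ (∀ a, 0 < w₁ a) ∨ z = 1) ∧
      ((∀ a, 0 < w a) → z = 0 ∧ ∀ a, 0 < w₁ a) := by
    have hpos : (∀ a, 0 < w a) → ∀ a, 0 < w₁ a := by
      rintro hw (a | p)
      · exact hw a
      · exact Nat.add_pos_left hτ0 _
    by_cases hw : ∀ a, 0 < w a
    · exact ⟨0, Or.inl ⟨rfl, hpos hw⟩, fun _ => ⟨rfl, hpos hw⟩⟩
    · exact ⟨1, Or.inr rfl, fun h => (hw h).elim⟩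
  have h₂ : IsShieldable (D := splitArcs (addPendants D k) w₁ z) τ (splitWeight w₁ z) fin :=
    h₁.isShieldable hτ hz
  have hc₁ := h₁.dicuts.cutConnected hτ0
  obtain ⟨ρ, μ, hρ, hμ, hpl⟩ := h₂.exists_shield hτ
  refine ⟨shield (splitWeight w₁ z) fin ρ μ, shieldWeight (splitWeight w₁ z) ρ μ τ, _,
    ((withPendants_cutLift fun p => Nat.add_pos_left hτ0 _).trans splitArcs_cutLift).trans
      (shield_cutLift hτ h₂ hρ hμ), shield_isTauBipartite hτ h₂ hρ hμ, ?_, ?_, ?_, ?_⟩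
  · intro hw hτ3
    obtain ⟨rfl, hw'⟩ := hz' hw
    exact shieldWeight_pos hτ3 (splitWeight_pos hw')
  · exact fun hp => hpl ((hp.addPendants (h.cutConnected hτ0) hc₁ hk).splitArcs hc₁)
  · intro hk0
    refine ⟨shield_isSinkRegular hτ h₂.le_one ?_, ?_⟩
    · rintro (v | p) hv hs
      · cases hv
      · have hd := (addPendants_isSink p).1 (splitArcs_isSink.1 hs)
        rw [wdeg, splitArcs_weight_outArcs, splitArcs_weight_inArcs, hw₁, addPendantsWeight,
          withPendants_weight_out_inr, withPendants_weight_in_inr, hd, pendantWeight]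
        cases hb : p.1.2.2
        · simp
        · have : k p.1.2.1 p.1.2.2 p.1.1 = 0 := by rw [hd, hb]; exact hk0 _
          exact (Fin.cast this p.2).elim0
    · rw [shield_rho hτ h₂.le_one]
      congr 1
      refine (sum_subtype_isRight (fun _ => Iff.rfl) fun v => (((
        (weight (splitWeight w₁ z) ((splitArcs (addPendants D k) w₁ z).outArcs {v}) : ℤ) -
        (weight (splitWeight w₁ z) ((splitArcs (addPendants D k) w₁ z).inArcs {v}) : ℤ)) %
          (τ : ℤ) : ℤ) : ℚ)).trans ?_
      -- Terminals of degree `τ` have residue 0. Without sinks of degree `τ + 1`, only the sources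
      -- of that degree contribute to `ρ`, one each.
      have hmod : ((τ : ℤ) + 1) % τ = 1 := by
        rw [Int.add_emod_left, Int.emod_eq_of_lt] <;> omega
      set F : D.V × Bool × Bool → ℚ := fun t => ((((if t.2.1 then
        (τ : ℤ) + (if t.2.2 then 1 else 0) else 0) - (if t.2.1 then 0 else
        (τ : ℤ) + (if t.2.2 then 1 else 0))) % (τ : ℤ) : ℤ) : ℚ) with hF
      trans ∑ p : PendantIndex k, F p.1
      · refine Finset.sum_congr rfl fun p _ => ?_
        rw [splitArcs_weight_outArcs, splitArcs_weight_inArcs, hw₁, addPendantsWeight,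
          withPendants_weight_out_inr, withPendants_weight_in_inr, pendantWeight]
        push_cast
        rfl
      · refine (sum_pendantIndex F).trans ?_
        refine Finset.sum_congr rfl fun v _ => ?_
        simp [hF, hk0, hmod]
  · intro hk'
    refine shield_isBalanced ?_
    refine (card_filter_isRight (fun _ => Iff.rfl) (splitArcs (addPendants D k) w₁ z).IsSource).trans
      (Eq.trans ?_ (card_filter_isRight (fun _ => Iff.rfl) (splitArcs (addPendants D k) w₁ z).IsSink).symm)
    simp only [splitArcs_isSource, splitArcs_isSink, addPendants_isSource, addPendants_isSink]
    refine (sum_pendantIndex fun t => if t.2.1 = true then 1 else 0).trans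
      (Eq.trans ?_ (sum_pendantIndex fun t => if t.2.1 = false then 1 else 0).symm)
    refine Finset.sum_congr rfl fun v _ => ?_
    simpa using hk' v

theorem weight_singleton_of_isEmpty [IsEmpty D.A] (v : D.V) :
    (weight w (D.outArcs {v}) : ℤ) - weight w (D.inArcs {v}) = 0 := by
  rw [weight_outArcs_singleton, weight_inArcs_singleton]; simp

/-- From `d = d(τ + 1) - dτ`: a positive imbalance `d` takes `d` sources of degree `τ + 1` and `d`
sinks of degree `τ`, and a negative one the same with the degrees exchanged. -/
theorem exists_balanced_lift (hτ : 2 ≤ τ) (h : DicutsAtLeast w τ) :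
    ∃ (D' : DiMultigraph.{u}) (w' : D'.A → ℕ) (g : D'.A → Option D.A),
      CutLift w w' g ∧ IsTauBipartite τ w' ∧
      ((∀ a, 0 < w a) → 3 ≤ τ → ∀ a, 0 < w' a) ∧
      (D.IsPlanar → D'.IsPlanar) ∧ D'.IsBalanced := by
  set d : D.V → ℤ := fun v => (weight w (D.outArcs {v}) : ℤ) - weight w (D.inArcs {v}) with hd
  obtain ⟨D', w', g, h1, h2, h3, h4, -, h5⟩ := exists_bipartite_lift hτ h
    (fun dir big v => if dir = big then (d v).toNat else (-d v).toNat)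
    (fun v => by
      change d v = _
      simp only [if_true, Bool.true_eq_false, Bool.false_eq_true, if_false]
      linear_combination -Int.toNat_sub_toNat_neg (d v))
    (fun _ dir big v => by
      have : d v = 0 := weight_singleton_of_isEmpty v
      simp [this])
  exact ⟨D', w', g, h1, h2, h3, h4, h5 fun v => by simp [add_comm]⟩

/-- With `r = d mod τ` and `e = ⌊d/τ⌋`, use `r` sources of degree `τ + 1` and `|e - r|` terminals of
degree `τ`, which are sources or sinks according to the sign of `e - r`. The sources of degree `τ +
1` then number `r` at each vertex, which keeps `ρ` unchanged. -/
theorem exists_sinkRegular_lift (hτ : 2 ≤ τ) (h : DicutsAtLeast w τ) :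
    ∃ (D' : DiMultigraph.{u}) (w' : D'.A → ℕ) (g : D'.A → Option D.A),
      CutLift w w' g ∧ IsTauBipartite τ w' ∧
      ((∀ a, 0 < w a) → 3 ≤ τ → ∀ a, 0 < w' a) ∧
      (D.IsPlanar → D'.IsPlanar) ∧ IsSinkRegular τ w' ∧ rho τ w' = rho τ w := by
  set d : D.V → ℤ := fun v => (weight w (D.outArcs {v}) : ℤ) - weight w (D.inArcs {v}) with hd
  have hm : ∀ v, ((d v % τ).toNat : ℤ) = d v % τ := fun v =>
    Int.toNat_of_nonneg (Int.emod_nonneg _ (by omega))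
  set q : D.V → ℤ := fun v => d v / τ - d v % τ with hq
  obtain ⟨D', w', g, h1, h2, h3, h4, h5, -⟩ := exists_bipartite_lift hτ h
    (fun dir big v => match dir, big with
      | true, true => (d v % τ).toNat
      | true, false => (q v).toNat
      | false, true => 0
      | false, false => (-q v).toNat)
    (fun v => by
      change d v = _
      have := Int.toNat_sub_toNat_neg (q v)
      have h' := Int.emod_add_mul_ediv (d v) τ
      simp only [hm]
      push_cast
      linear_combination -h' - (τ : ℤ) * this)
    (fun _ dir big v => by
      have : d v = 0 := weight_singleton_of_isEmpty v
      cases dir <;> cases big <;> simp [this, hq])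
  obtain ⟨h6, h7⟩ := h5 fun _ => rfl
  refine ⟨D', w', g, h1, h2, h3, h4, h6, h7.trans ?_⟩
  rw [rho]
  congr 1
  refine Finset.sum_congr rfl fun v _ => ?_
  have := congrArg (Int.cast : ℤ → ℚ) (hm v)
  rwa [Int.cast_natCast] at this

theorem hasDecomposeLift_of_cutLift {Q : ∀ D' : DiMultigraph.{u}, (D'.A → ℕ) → Prop}
    (h : ∃ (D' : DiMultigraph.{u}) (w' : D'.A → ℕ) (g : D'.A → Option D.A),
      CutLift w w' g ∧ IsTauBipartite τ w' ∧
      ((∀ a, 0 < w a) → 3 ≤ τ → ∀ a, 0 < w' a) ∧ (D.IsPlanar → D'.IsPlanar) ∧ Q D' w') :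
    HasDecomposeLift τ D w Q := by
  obtain ⟨D', w', g, h1, h2, h3, h4, h5⟩ := h
  obtain ⟨X, e, he⟩ := h1.exists_clutter_eq
  exact ⟨1, fun _ => D', fun _ => w', fun _ => h2, fun hw hτ _ => h3 hw hτ, fun hp _ => h4 hp,
    ⟨fun _ => X, e, he⟩, fun _ => h5⟩

/-- Only one direction needs work: the statement is applied to the lift, and its packing is pulled
back along `g`. -/
theorem packingStatement_iff {K : ∀ D : DiMultigraph.{u}, (D.A → ℕ) → Prop} {r : Option ℕ}
    {pl eqt : Bool} (h : ∀ (D : DiMultigraph.{u}) (w : D.A → ℕ), DicutsAtLeast w τ →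
      ∃ (D' : DiMultigraph.{u}) (w' : D'.A → ℕ) (g : D'.A → Option D.A),
        CutLift w w' g ∧ K D' w' ∧ DicutsAtLeast w' τ ∧ (D.IsPlanar → D'.IsPlanar) ∧
        ∀ c ∈ r, rho τ w ≤ (c : ℚ) → rho τ w' ≤ c) :
    PackingStatement.{u} τ r pl eqt ↔ PackingStatementOn.{u} K τ r pl eqt := by
  refine ⟨fun H D w _ => H D w trivial, fun H D w _ hd hp hr => ?_⟩
  obtain ⟨D', w', g, h1, h2, h3, h4, h5⟩ := h D w hd
  have := H D' w' h2 h3 (fun e => h4 (hp e)) fun c hc => h5 c hc (hr c hc)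
  cases eqt
  · obtain ⟨J, hJ⟩ := this
    exact h1.exists_packing hJ
  · obtain ⟨J, hJ⟩ := this
    exact h1.exists_equitablePacking hJ

end DiMultigraph
end

theorem mainTheorem7 (τ : ℕ) (hτ : 2 ≤ τ) :
    (∀ (D : DiMultigraph.{u}) (w : D.A → ℕ), DiMultigraph.DicutsAtLeast w τ →
      DiMultigraph.HasDecomposeLift τ D w (fun D' _ => D'.IsBalanced) ∧
      DiMultigraph.HasDecomposeLift τ D w (fun _ w' =>
        DiMultigraph.IsSinkRegular τ w' ∧ DiMultigraph.rho τ w' ≤ DiMultigraph.rho τ w)) ∧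
    (∀ pl eqt : Bool,
      DiMultigraph.PackingStatement.{u} τ none pl eqt ↔
        DiMultigraph.PackingStatementOn.{u}
          (fun D w => DiMultigraph.IsTauBipartite τ w ∧ D.IsBalanced) τ none pl eqt) ∧
    (∀ (r : ℕ) (pl eqt : Bool),
      DiMultigraph.PackingStatement.{u} τ (some r) pl eqt ↔
        DiMultigraph.PackingStatementOn.{u}
          (fun _ w => DiMultigraph.IsTauBipartite τ w ∧ DiMultigraph.IsSinkRegular τ w)
          τ (some r) pl eqt) := by
  refine ⟨fun D w h => ⟨DiMultigraph.hasDecomposeLift_of_cutLift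
    (DiMultigraph.exists_balanced_lift hτ h), DiMultigraph.hasDecomposeLift_of_cutLift ?_⟩,
    fun pl eqt => DiMultigraph.packingStatement_iff fun D w h => ?_,
    fun r pl eqt => DiMultigraph.packingStatement_iff fun D w h => ?_⟩
  · obtain ⟨D', w', g, h1, h2, h3, h4, h5, h6⟩ := DiMultigraph.exists_sinkRegular_lift hτ h
    exact ⟨D', w', g, h1, h2, h3, h4, h5, h6.le⟩
  · obtain ⟨D', w', g, h1, h2, -, h4, h5⟩ := DiMultigraph.exists_balanced_lift hτ h
    exact ⟨D', w', g, h1, ⟨h2, h5⟩, h2.dicuts, h4, fun c hc => by cases hc⟩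
  · obtain ⟨D', w', g, h1, h2, -, h4, h5, h6⟩ := DiMultigraph.exists_sinkRegular_lift hτ h
    exact ⟨D', w', g, h1, ⟨h2, h5⟩, h2.dicuts, h4, fun c _ hle => h6.trans_le hle⟩
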